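/- Let $Y$ be a compact Riemannian manifold without boundary on which a compact Lie group $G$ acts smoothly from the left by isometries $L_g$, let $\mathcal O_y$ be the orbit of $y$, and let $(TG)^0\subset T^*Y$ be the set of covectors that vanish on the tangent spaces of the orbits. The lifted action on $T^*Y$ is $\widetilde L_g\xi=\xi\circ dL_{g^{-1}}$. Let $X$ be a compact connected Riemannian manifold, $\tilde p:\widetilde X\to X$ its universal covering with the induced metric, and $\varphi:\Gamma\to G$ a homomorphism with dense image from the group $\Gamma\cong\pi_1(X)$ of deck transformations. Let $\mathcal S=(\widetilde X\times Y)/\Gamma$ be the quotient by the diagonal action $\gamma\cdot(\tilde x,y)=(\gamma\tilde x,\varphi(\gamma)y)$, with quotient map $\sigma$ and with the Riemannian metric that makes $\sigma$ a local isometry for the product metric. The sets $\sigma(\widetilde X\times\{y\})$ are the leaves of a foliation of $\mathcal S$; let $\overline{\mathcal F}_{\mathcal S}$ be the partition of $\mathcal S$ into the closures of the leaves and $(T\overline{\mathcal F}_{\mathcal S})^0\subset T^*\mathcal S$ the set of covectors that vanish on the tangent spaces of the leaf closures. With $\pi_2:X\times Y\to Y$ the projection, for $q=(\tilde x,y)$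 let $\phi_q=\bigl(d(\tilde p\times \mathrm{id}_Y)_q^*\bigr)^{-1}\circ d\sigma_q^*: T^*_{\sigma(q)}\mathcal S\to T^*_{(\tilde p(\tilde x),y)}(X\times Y)$. On the nonzero covectors of $\mathcal S$ and of $Y$ let $\Phi^t$ and $\Phi^t_Y$ be the Hamiltonian flows of the length function $|\xi|$. * Covectors $\xi,\eta\in (TG)^0$ are the endpoints of a Hamiltonian arc of length $T$ that is relatively closed with respect to the action if $\eta=\Phi_Y^T(\xi)$ and $\eta=\widetilde L_g\xi$ for some $g\in G$. * Covectors $\xi,\eta\in (T\overline{\mathcal F}_{\mathcal S})^0$ at $s$ and $s'$ are the endpoints of a transverse Hamiltonian arc of length $T$ that is relatively closed with respect to $\overline{\mathcal F}_{\mathcal S}$ if $\eta=\Phi^T(\xi)$ and if there are a piecewise smooth curve $\overline\alpha$ from $s$ to $s'$ in a leaf closure and a holonomy map $h_{\overline\alpha}$ along it with $\eta\circ dh_{\overline\alpha}=\xi$. Here a holonomy map along a smooth curve $\overline\alpha:[0,1]\to\mathcal S$ is the end $h_1$ of a smooth family $h_t$, $t\in[0,1]$, of local diffeomorphisms of a neighbourhood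 of $\overline\alpha(0)$ into $\mathcal S$ with $h_0=\mathrm{id}$ and $h_t(\overline\alpha(0))=\overline\alpha(t)$ such that $h_t(z)$ lies in the leaf closure through $z$ for all $t$ and $z$; along a piecewise smooth curve one composes such maps. Let $s_i=\sigma(\tilde x_i,y_i)$ for $i=1,2$, and let $\xi_{s_1}\in T^*_{s_1}\mathcal S$, $\eta_{s_2}\in T^*_{s_2}\mathcal S$, $\xi_{y_1}\in T^*_{y_1}Y$, $\eta_{y_2}\in T^*_{y_2}Y$ satisfy $\phi_{(\tilde x_1,y_1)}(\xi_{s_1})=d\pi_2^*(\xi_{y_1})$ and $\phi_{(\tilde x_2,y_2)}(\eta_{s_2})=d\pi_2^*(\eta_{y_2})$. (1) If $\tilde x_1=\tilde x_2$, then $\xi_{s_1}$ and $\eta_{s_2}$ are the endpoints of a transverse Hamiltonian arc of length $T$ that is relatively closed with respect to $\overline{\mathcal F}_{\mathcal S}$ if and only if $\xi_{y_1}$ and $\eta_{y_2}$ are the endpoints of a Hamiltonian arc of length $T$ that is relatively closed with respect to the action of $G$ on $Y$. (2) For arbitrary $\tilde x_1,\tilde x_2$, the covectors $\xi_{s_1}$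 and $\eta_{s_2}$ are the endpoints of a transverse Hamiltonian arc of length $T$ that is relatively closed with respect to $\overline{\mathcal F}_{\mathcal S}$ if and only if there is a deck transformation $\gamma\in\Gamma$ with $\gamma\tilde x_1=\tilde x_2$ such that $\xi_{y_1}$ and $\widetilde L_{\varphi(\gamma)^{-1}}\eta_{y_2}$ are the endpoints of a Hamiltonian arc of length $T$ that is relatively closed with respect to the action of $G$ on $Y$. (3) The set of lengths $T>0$ of Hamiltonian arcs that are relatively closed with respect to $\overline{\mathcal F}_{\mathcal S}$ equals the set of lengths $T>0$ of Hamiltonian arcs that are relatively closed with respect to the action of $G$ on $Y$. -/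

import Mathlib

open Set Function Topology Bundle
open scoped Manifold ContDiff Bundle

noncomputable section

set_option linter.unusedSectionVars false

namespace GWave

/-! ### Covectors, conormal spaces, Hamiltonian curves and holonomy on a manifold -/

section General

variable {E : Type*} [NormedAddCommGroup E] [NormedSpace ℝ E]
  {H : Type*} [TopologicalSpace H] (I : ModelWithCorners ℝ E H)
  {M : Type*} [TopologicalSpace M] [ChartedSpace H M]

/-- The set of all covectors `T*M`. -/
abbrev Cotangent (M : Type*) [TopologicalSpace M] [ChartedSpace H M] :=
  (x : M) × (TangentSpace I x →L[ℝ] ℝ)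

/-- Tangent vectors of a subset `A` of `M`: velocities of smooth curves that stay in `A`.
For a submanifold this is its tangent bundle. -/
def tangentVectors (A : Set M) : Set (TangentBundle I M) :=
  {v | ∃ c : ℝ → M, ContMDiff 𝓘(ℝ, ℝ) I ∞ c ∧ (∀ t, c t ∈ A) ∧
    v = ⟨c 0, mfderiv 𝓘(ℝ, ℝ) I c 0 (1 : ℝ)⟩}

/-- Given a partition of `M` into submanifolds, `L x` being the member through `x`, the set of all
covectors that vanish on the vectors tangent to the member through their base point. -/
def conormal (L : M → Set M) : Set (Cotangent I M) :=
  {ξ | ∀ v : TangentSpace I ξ.1,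
    (⟨ξ.1, v⟩ : TangentBundle I M) ∈ tangentVectors I (L ξ.1) → ξ.2 v = 0}

/-- The length `|ξ|` of a covector with respect to a metric `g`. -/
def covectorNorm (g : ∀ x : M, TangentSpace I x → TangentSpace I x → ℝ) (ξ : Cotangent I M) : ℝ :=
  sSup {r | ∃ v : TangentSpace I ξ.1, g ξ.1 v v ≤ 1 ∧ r = ξ.2 v}

/-- The canonical coordinates `(q, p)` of a covector in the chart of `M` around `x₀`. -/
def cotangentChart (x₀ : M) (ξ : Cotangent I M) : E × (E →L[ℝ] ℝ) :=
  (extChartAt I x₀ ξ.1,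
    ξ.2.comp (mfderiv 𝓘(ℝ, E) I (extChartAt I x₀).symm (extChartAt I x₀ ξ.1)))

/-- The covector with canonical coordinates `(q, p)` in the chart of `M` around `x₀`. -/
def cotangentChartSymm (x₀ : M) (q : E) (p : E →L[ℝ] ℝ) : Cotangent I M :=
  ⟨(extChartAt I x₀).symm q,
    p.comp (mfderiv I 𝓘(ℝ, E) (extChartAt I x₀) ((extChartAt I x₀).symm q))⟩

/-- Integral curves `ℝ → T*M ∖ 0` of the Hamiltonian vector field of `F`: the base curve is
continuous and at each time `t` Hamilton's equations `q' = ∂F/∂p`, `p' = -∂F/∂q` hold in the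
canonical coordinates of the chart around the base point at time `t`. The first equation is
tested against the linear functionals `ℓ` on `E`. -/
structure IsHamiltonianCurve (F : Cotangent I M → ℝ) (c : ℝ → Cotangent I M) : Prop where
  continuous_base : Continuous fun t => (c t).1
  ne_zero : ∀ t, (c t).2 ≠ 0
  position : ∀ t, ∀ ℓ : E →L[ℝ] ℝ,
    HasDerivAt (fun τ => ℓ (cotangentChart I (c t).1 (c τ)).1)
      (fderiv ℝ
        (fun p => F (cotangentChartSymm I (c t).1 (cotangentChart I (c t).1 (c t)).1 p))
        (cotangentChart I (c t).1 (c t)).2 ℓ) t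
  momentum : ∀ t,
    HasDerivAt (fun τ => (cotangentChart I (c t).1 (c τ)).2)
      (-(fderiv ℝ
        (fun q => F (cotangentChartSymm I (c t).1 q (cotangentChart I (c t).1 (c t)).2))
        (cotangentChart I (c t).1 (c t)).1)) t

/-- `η = Φ^T(ξ)` for the Hamiltonian flow `Φ` of the covector length `|·|` on `T*M ∖ 0`. -/
def FlowsTo (g : ∀ x : M, TangentSpace I x → TangentSpace I x → ℝ) (T : ℝ)
    (ξ η : Cotangent I M) : Prop :=
  ∃ c : ℝ → Cotangent I M, IsHamiltonianCurve I (covectorNorm I g) c ∧ c 0 = ξ ∧ c T = η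

/-- `h` slides a neighbourhood `U` of `α 0` along the curve `α` inside the members of the partition
`L`: it is a smooth family of local diffeomorphisms `h t`, `t ∈ [0, 1]`, starting at the identity,
with `h t (α 0) = α t`, and every point `z` stays in its own member `L z`. In particular `α` lies
in `L (α 0)`. If `L` is a regular foliation, `h 1` induces on transversals the holonomy map
of `α`. -/
structure IsSliding (L : M → Set M) (α : ℝ → M) (U : Set M) (h : ℝ → M → M) : Prop where
  isOpen : IsOpen U
  mem : α 0 ∈ U
  smooth : ContMDiffOn (𝓘(ℝ, ℝ).prod I) I ∞ (uncurry h) (Icc (0 : ℝ) 1 ×ˢ U)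
  zero : ∀ z ∈ U, h 0 z = z
  along : ∀ t ∈ Icc (0 : ℝ) 1, h t (α 0) = α t
  mem_leaf : ∀ t ∈ Icc (0 : ℝ) 1, ∀ z ∈ U, h t z ∈ L z
  bijective_mfderiv : ∀ t ∈ Icc (0 : ℝ) 1, ∀ z ∈ U, Bijective (mfderiv I I (h t) z)

/-- `η = (dh_α⁻¹)^* ξ` for the holonomy `h_α` along a smooth curve `α` in a member of `L`, that is
`η (dh_α v) = ξ v` for all `v`. -/
def HolonomyStep (L : M → Set M) (ξ η : Cotangent I M) : Prop :=
  ∃ (α : ℝ → M) (U : Set M) (h : ℝ → M → M), IsSliding I L α U h ∧ α 0 = ξ.1 ∧ α 1 = η.1 ∧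
    ∀ v : TangentSpace I ξ.1, η.2 (mfderiv I I (h 1) ξ.1 v) = ξ.2 v

/-- `η` is the image of `ξ` under the holonomy along a piecewise smooth curve in a member of
`L`. -/
def HolonomyRelated (L : M → Set M) : Cotangent I M → Cotangent I M → Prop :=
  Relation.TransGen (HolonomyStep I L)

end General

/-! ### Deck transformations -/

/-- The group of deck transformations of `p : Xt → X`. -/
def deckGroup {Xt X : Type*} [TopologicalSpace Xt] (p : Xt → X) : Subgroup (Xt ≃ₜ Xt) where
  carrier := {d | ∀ x, p (d x) = p x}
  mul_mem' {a b} ha hb x := (ha (b x)).trans (hb x)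
  one_mem' _ := rfl
  inv_mem' {a} ha x := by
    have h := ha (a⁻¹ x)
    have e : a (a⁻¹ x) = x := a.apply_symm_apply x
    rw [e] at h
    exact h.symm

/-! ### The suspension -/

variable {EX EG EY : Type*}
  [NormedAddCommGroup EX] [NormedSpace ℝ EX]
  [NormedAddCommGroup EG] [NormedSpace ℝ EG]
  [NormedAddCommGroup EY] [NormedSpace ℝ EY]
  (X Xt G Y : Type*)
  [TopologicalSpace X] [ChartedSpace EX X] [IsManifold 𝓘(ℝ, EX) ∞ X]
  [TopologicalSpace Xt] [ChartedSpace EX Xt] [IsManifold 𝓘(ℝ, EX) ∞ Xt]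
  [SimplyConnectedSpace Xt]
  [TopologicalSpace G] [ChartedSpace EG G] [Group G]
  [TopologicalSpace Y] [ChartedSpace EY Y] [IsManifold 𝓘(ℝ, EY) ∞ Y]
  [MulAction G Y]

/-- The data of the suspension construction: Riemannian metrics on `X` and `Y`, a smooth isometric
action of `G` on `Y`, the universal covering `p : Xt → X` (the space `Xt` being simply connected),
and a homomorphism `φ` from its group of deck transformations, which is `π₁(X)`, onto a dense
subgroup of `G`. -/
structure SuspensionData where
  gX : ContMDiffRiemannianMetric 𝓘(ℝ, EX) ∞ EX (fun x : X => TangentSpace 𝓘(ℝ, EX) x)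
  gY : ContMDiffRiemannianMetric 𝓘(ℝ, EY) ∞ EY (fun y : Y => TangentSpace 𝓘(ℝ, EY) y)
  smooth_smul : ContMDiff (𝓘(ℝ, EG).prod 𝓘(ℝ, EY)) 𝓘(ℝ, EY) ∞ fun z : G × Y => z.1 • z.2
  isometric : ∀ (a : G) (y : Y) (v w : TangentSpace 𝓘(ℝ, EY) y),
    gY.inner (a • y) (mfderiv 𝓘(ℝ, EY) 𝓘(ℝ, EY) (fun z : Y => a • z) y v)
      (mfderiv 𝓘(ℝ, EY) 𝓘(ℝ, EY) (fun z : Y => a • z) y w) = gY.inner y v w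
  p : Xt → X
  isCoveringMap : IsCoveringMap p
  isLocalDiffeomorph : IsLocalDiffeomorph 𝓘(ℝ, EX) 𝓘(ℝ, EX) ∞ p
  φ : deckGroup p →* G
  denseRange : DenseRange φ

namespace SuspensionData

variable {X Xt G Y}
variable (D : SuspensionData (EX := EX) (EG := EG) (EY := EY) X Xt G Y)

/-- The diagonal action of a deck transformation on `Xt × Y`. -/
def act (d : deckGroup D.p) (q : Xt × Y) : Xt × Y := (d.1 q.1, D.φ d • q.2)

lemma act_mul (d e : deckGroup D.p) (q : Xt × Y) : D.act (d * e) q = D.act d (D.act e q) := by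
  simp only [act, map_mul, mul_smul]
  rfl

lemma act_one (q : Xt × Y) : D.act 1 q = q := by
  simp only [act, map_one, one_smul]
  rfl

lemma act_inv_act (d : deckGroup D.p) (q : Xt × Y) : D.act d⁻¹ (D.act d q) = q := by
  rw [← act_mul, inv_mul_cancel, act_one]

/-- Orbit equivalence of the diagonal action. -/
def setoid : Setoid (Xt × Y) where
  r q q' := ∃ d, D.act d q = q'
  iseqv :=
    { refl := fun q => ⟨1, D.act_one q⟩
      symm := by
        rintro q _ ⟨d, rfl⟩
        exact ⟨d⁻¹, D.act_inv_act d q⟩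
      trans := by
        rintro q _ _ ⟨d, rfl⟩ ⟨e, rfl⟩
        exact ⟨e * d, D.act_mul e d q⟩ }

/-- The suspension `S = (Xt × Y) / ∼`. -/
def S : Type _ := Quotient D.setoid

instance : TopologicalSpace D.S := inferInstanceAs (TopologicalSpace (Quotient D.setoid))

/-- The quotient map `Xt × Y → S`. -/
def σ (q : Xt × Y) : D.S := Quotient.mk D.setoid q

/-- A choice of representatives. -/
def rep (s : D.S) : Xt × Y := Quotient.out s

lemma σ_rep (s : D.S) : D.σ (D.rep s) = s := Quotient.out_eq s

lemma σ_eq_iff {q q' : Xt × Y} : D.σ q = D.σ q' ↔ ∃ d, D.act d q = q' := Quotient.eq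

lemma continuous_act (d : deckGroup D.p) : Continuous (D.act d) :=
  (d.1.continuous.comp continuous_fst).prodMk
    ((D.smooth_smul.continuous.comp (continuous_const.prodMk continuous_id)).comp continuous_snd)

lemma continuous_σ : Continuous D.σ := continuous_quotient_mk'

lemma isOpenMap_σ : IsOpenMap D.σ := by
  intro U hU
  have h : IsOpen (D.σ ⁻¹' (D.σ '' U)) := by
    have : D.σ ⁻¹' (D.σ '' U) = ⋃ d : deckGroup D.p, D.act d ⁻¹' U := by
      ext q
      simp only [mem_preimage, mem_image, mem_iUnion]
      constructor
      · rintro ⟨q', hq', e⟩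
        obtain ⟨d, hd⟩ := D.σ_eq_iff.1 e.symm
        exact ⟨d, hd ▸ hq'⟩
      · rintro ⟨d, hd⟩
        exact ⟨_, hd, (D.σ_eq_iff.2 ⟨d, rfl⟩).symm⟩
    rw [this]
    exact isOpen_iUnion fun d => hU.preimage (D.continuous_act d)
  exact h

/-- Deck transformations act freely. -/
lemma deck_eq_one (d : deckGroup D.p) (x : Xt) (h : d.1 x = x) : d = 1 := by
  have := D.isCoveringMap.eq_of_comp_eq (g₁ := d.1) (g₂ := id) d.1.continuous continuous_id
    (funext fun z => d.2 z) x h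
  exact Subtype.ext (Homeomorph.ext fun z => congrFun this z)

lemma isLocalHomeomorph_σ : IsLocalHomeomorph D.σ := by
  rw [isLocalHomeomorph_iff_isOpenEmbedding_restrict]
  rintro ⟨x, y⟩
  obtain ⟨V, hV, hx, hinj⟩ := D.isCoveringMap.isLocalHomeomorph.isLocallyInjective x
  have hVo : IsOpen (V ×ˢ (univ : Set Y)) := hV.prod isOpen_univ
  refine ⟨V ×ˢ univ, hVo.mem_nhds ⟨hx, mem_univ _⟩,
    .of_continuous_injective_isOpenMap (D.continuous_σ.comp continuous_subtype_val) ?_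
      (D.isOpenMap_σ.comp hVo.isOpenMap_subtype_val)⟩
  rintro ⟨⟨a, b⟩, ha, hb⟩ ⟨⟨a', b'⟩, ha', hb'⟩ e
  obtain ⟨d, hd⟩ := D.σ_eq_iff.1 (show D.σ (a, b) = D.σ (a', b') from e)
  have h1 : d.1 a = a' := congrArg Prod.fst hd
  have h2 : a = a' := hinj ha ha' (by rw [← h1, d.2 a])
  have h3 : d = 1 := D.deck_eq_one d a (h1.trans h2.symm)
  subst h3
  rw [D.act_one] at hd
  exact Subtype.ext hd

/-- The manifold structure of `S`: the charts are the local inverses of `σ` followed by the product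
charts of `Xt × Y`. -/
instance : ChartedSpace (ModelProd EX EY) D.S :=
  D.isLocalHomeomorph_σ.chartedSpaceOfRightInverse D.σ_rep

/-- The model of `X × Y`, `Xt × Y` and `S`. -/
local notation "IS" => ModelWithCorners.prod 𝓘(ℝ, EX) 𝓘(ℝ, EY)

lemma contMDiff_deck (d : deckGroup D.p) : ContMDiff 𝓘(ℝ, EX) 𝓘(ℝ, EX) ∞ d.1 := by
  intro x
  have hl := D.isLocalDiffeomorph (d.1 x)
  have hp : ContMDiffAt 𝓘(ℝ, EX) 𝓘(ℝ, EX) ∞ D.p x := (D.isLocalDiffeomorph x).contMDiffAt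
  have hc : ContMDiffAt 𝓘(ℝ, EX) 𝓘(ℝ, EX) ∞ hl.localInverse (D.p x) := by
    have := hl.localInverse_contMDiffAt
    rwa [d.2 x] at this
  refine (hc.comp x hp).congr_of_eventuallyEq ?_
  filter_upwards [d.1.continuous.continuousAt.eventually hl.localInverse_eventuallyEq_left]
    with z hz
  have h1 : hl.localInverse (D.p (d.1 z)) = d.1 z := hz
  rw [d.2 z] at h1
  exact h1.symm

lemma contMDiff_act (d : deckGroup D.p) : ContMDiff IS IS ∞ (D.act d) :=
  ((D.contMDiff_deck d).comp contMDiff_fst).prodMk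
    (D.smooth_smul.comp (contMDiff_const.prodMk contMDiff_snd))

instance : IsManifold IS ∞ D.S := by
  refine isManifold_of_contDiffOn IS ∞ D.S ?_
  rintro _ _ ⟨s, rfl⟩ ⟨s', rfl⟩
  set hσ := D.isLocalHomeomorph_σ
  set q := D.rep s
  set q' := D.rep s'
  set e := (hσ.localInverseAt q).trans (chartAt (ModelProd EX EY) q) with he
  set e' := (hσ.localInverseAt q').trans (chartAt (ModelProd EX EY) q') with he'
  have key : ContMDiffOn IS IS ∞ (e.symm.trans e') (e.symm.trans e').source := by
    intro z hz
    have hz1 : z ∈ e.target := hz.1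
    have hz2 : e.symm z ∈ e'.source := hz.2
    have hzc : z ∈ (chartAt (ModelProd EX EY) q).target := hz1.1
    set w := (chartAt (ModelProd EX EY) q).symm z with hw
    have hes : ∀ u, e.symm u = D.σ ((chartAt (ModelProd EX EY) q).symm u) := fun u => by
      simp [he]
    have hσw : D.σ w ∈ (hσ.localInverseAt q').source := by
      have := hz2.1; rwa [hes] at this
    have hchart : hσ.localInverseAt q' (D.σ w) ∈ (chartAt (ModelProd EX EY) q').source := by
      have := hz2.2; rw [hes] at this; exact this
    obtain ⟨d, hd⟩ := D.σ_eq_iff.1 (hσ.apply_localInverseAt_of_mem hσw).symm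
    have hev : ∀ᶠ u in 𝓝 w, hσ.localInverseAt q' (D.σ u) = D.act d u := by
      have h1 : ∀ᶠ u in 𝓝 w, D.act d u ∈ (hσ.localInverseAt q').target :=
        (D.continuous_act d).continuousAt.eventually
          ((hσ.localInverseAt q').open_target.mem_nhds
            (by rw [hd]; exact (hσ.localInverseAt q').map_source hσw))
      filter_upwards [h1] with u hu
      have h2 := (hσ.localInverseAt q').right_inv hu
      rw [hσ.localInverseAt_symm q'] at h2
      rwa [← D.σ_eq_iff.2 ⟨d, rfl⟩] at h2
    have hsm : ContMDiffAt IS IS ∞ (chartAt (ModelProd EX EY) q).symm z :=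
      (contMDiffOn_chart_symm (n := ∞)).contMDiffAt
        ((chartAt (ModelProd EX EY) q).open_target.mem_nhds hzc)
    have hch : ContMDiffAt IS IS ∞ (chartAt (ModelProd EX EY) q') (D.act d w) :=
      (contMDiffOn_chart (n := ∞)).contMDiffAt
        ((chartAt (ModelProd EX EY) q').open_source.mem_nhds (by rw [hd]; exact hchart))
    have hcomp := (hch.comp w ((D.contMDiff_act d) w)).comp z hsm
    refine (hcomp.congr_of_eventuallyEq ?_).contMDiffWithinAt
    filter_upwards [hsm.continuousAt.eventually hev] with u hu
    change chartAt (ModelProd EX EY) q' (hσ.localInverseAt q' (e.symm u)) = _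
    rw [hes, hu]
    rfl
  rw [contMDiffOn_iff] at key
  obtain ⟨o⟩ : Nonempty (ModelProd EX EY) := ⟨((0 : EX), (0 : EY))⟩
  have h := key.2 o o
  rw [extChartAt_self_eq] at h
  simp only [extChartAt, chartAt_self_eq, mfld_simps, preimage_univ, univ_inter, inter_univ] at h
  exact h.mono fun z hz => ⟨hz.1.1, hz.1.2⟩

/-- The product metric on `Xt × Y`, where `Xt` carries the metric induced from `X`. -/
def productMetric (q : Xt × Y) (v w : TangentSpace IS q) : ℝ :=
  D.gX.inner (D.p q.1) (mfderiv 𝓘(ℝ, EX) 𝓘(ℝ, EX) D.p q.1 (v : EX × EY).1)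
      (mfderiv 𝓘(ℝ, EX) 𝓘(ℝ, EX) D.p q.1 (w : EX × EY).1)
    + D.gY.inner q.2 (v : EX × EY).2 (w : EX × EY).2

/-- The metric on `S` for which `σ` is a local isometry. -/
def metric (s : D.S) (v w : TangentSpace IS s) : ℝ :=
  D.productMetric (D.rep s) ((mfderiv IS IS D.σ (D.rep s)).inverse v)
    ((mfderiv IS IS D.σ (D.rep s)).inverse w)

/-- The leaf through `s = [(x, y)]`, consisting of all `[(x', y)]`. -/
def leaf (s : D.S) : Set D.S := {s' | ∃ x x' y, D.σ (x, y) = s ∧ D.σ (x', y) = s'}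

/-- The closure of the leaf through `s`. -/
def leafClosure (s : D.S) : Set D.S := closure (D.leaf s)

/-- The local identification `φ = (d(p × id)^*)⁻¹ ∘ dσ^*` of covectors of `S` at `σ q` with covectors
of `X × Y`, on the sheet determined by `q`. -/
def phi (q : Xt × Y) (ξ : TangentSpace IS (D.σ q) →L[ℝ] ℝ) :
    TangentSpace IS (Prod.map D.p id q) →L[ℝ] ℝ :=
  (ξ.comp (mfderiv IS IS D.σ q)).comp (mfderiv IS IS (Prod.map D.p (id : Y → Y)) q).inverse

/-- The pullback `dπ₂^* ξ` of a covector of `Y` to `X × Y` at the point below `q`. -/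
def pullbackSnd (q : Xt × Y) (ξ : TangentSpace 𝓘(ℝ, EY) q.2 →L[ℝ] ℝ) :
    TangentSpace IS (Prod.map D.p id q) →L[ℝ] ℝ :=
  ξ.comp (mfderiv IS 𝓘(ℝ, EY) (Prod.snd : X × Y → Y) (Prod.map D.p id q))

/-- The lifted action of `G` on covectors of `Y`: the covector `ξ` at `y` is sent to
`ξ ∘ d(L_{a⁻¹})` at `a • y`. -/
def liftedAction (a : G) (ξ : Cotangent 𝓘(ℝ, EY) Y) : Cotangent 𝓘(ℝ, EY) Y :=
  ⟨a • ξ.1, ContinuousLinearMap.comp (M₂ := EY) ξ.2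
    (mfderiv 𝓘(ℝ, EY) 𝓘(ℝ, EY) (fun z : Y => a⁻¹ • z) (a • ξ.1))⟩

/-- `ξ` and `η` are the endpoints of a Hamiltonian arc of length `T` in the conormal space of the
orbits that is relatively closed with respect to the action of `G` on `Y`. -/
def RelClosedAction (T : ℝ) (ξ η : Cotangent 𝓘(ℝ, EY) Y) : Prop :=
  ξ ∈ conormal 𝓘(ℝ, EY) (fun y : Y => MulAction.orbit G y) ∧
  η ∈ conormal 𝓘(ℝ, EY) (fun y : Y => MulAction.orbit G y) ∧
  FlowsTo 𝓘(ℝ, EY) (fun y v w => D.gY.inner y v w) T ξ η ∧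
  ∃ a : G, η = liftedAction a ξ

/-- `ξ` and `η` are the endpoints of a Hamiltonian arc of length `T` in the conormal space of the
leaf closures that is relatively closed with respect to the foliation of `S` by leaf closures. -/
def RelClosedFoliation (T : ℝ) (ξ η : Cotangent IS D.S) : Prop :=
  ξ ∈ conormal IS D.leafClosure ∧ η ∈ conormal IS D.leafClosure ∧
  FlowsTo IS D.metric T ξ η ∧ HolonomyRelated IS D.leafClosure ξ η

/-- The length spectrum with respect to the action of `G` on `Y`. -/
def lengthSpectrumAction : Set ℝ :=
  {T | 0 < T ∧ ∃ ξ η : Cotangent 𝓘(ℝ, EY) Y, D.RelClosedAction T ξ η}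

/-- The length spectrum with respect to the foliation of `S`. -/
def lengthSpectrumFoliation : Set ℝ :=
  {T | 0 < T ∧ ∃ ξ η : Cotangent IS D.S, D.RelClosedFoliation T ξ η}

end SuspensionData

end GWave

end

open Set Function Topology Bundle
open scoped Manifold ContDiff Bundle

noncomputable section

set_option linter.unusedSectionVars false

namespace GWave

/-! Shortcut instances, to be found before the ones for Riemannian bundles. -/

/-! Locally the suspension is the Riemannian product of `Xt` and `Y`, and by `mem_leafClosure_iff`
its leaf closures are the images of the sets `Xt × (G-orbit)`: orbits are compact, hence closed, and
the range of `φ` is dense. Hence a covector conormal to the leaf closures has no component along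
`Xt`. It is the suspension `susp x ξ` of a covector `ξ` of `Y`, and it is conormal exactly when `ξ`
is conormal to the orbits (`susp_mem_conormal_iff`).

Flows. In product charts the Hamiltonian is `√(N + N')`, with `N` and `N'` the squared lengths of
the two components. `N` is a first integral (`HamAt.hasDerivAt_fst`), so a curve that starts with `N
= 0` keeps `N = 0`. As `N` then vanishes to first order, the `Xt`-position does not move and the
`Y`-part solves Hamilton's equations of `√N'` (`hamAt_sqrt_add_iff`). Deck transformations act by
isometries, whose cotangent lifts are canonical (`HamAt.canonical`), so the local statements fit
together: Hamiltonian curves through `susp x ξ` are exactly `susp x` of Hamiltonian curves of `Y`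
(`isHamiltonianCurve_susp_iff`, `exists_eq_susp`).

Holonomies, from `G` to `S`. Translations in charts of `Xt` and short segments in `G` starting at
`1` give slidings inside leaf closures. Sliding from `d x` back to `x` realises `φ d`, and density
leaves only an element near `1`; so every lifted action is a holonomy
(`holonomyRelated_liftedAction`).

Holonomies, from `S` to `G`. A holonomy moves each point inside its orbit. Along a curve in the
direction `v` metrically dual to `ξ`, a compactness argument yields `a` such that the image of `v`
is `dL a v` modulo vectors tangent to the orbit (`exists_smul_of_mem_orbit`). The tangency of the
error rests on the constant rank of the orbit map (`mem_range_fderiv_of_tendsto`). This determines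
`η` on the single vector `dL a v`; since the flow preserves lengths, the equality case of
Cauchy–Schwarz then forces `η` to be the lifted action of `a` on `ξ`
(`exists_eq_liftedAction_of_holonomyRelated`).

These facts give the case of equal base points in `Xt`. The general case follows because an arc from
`x₁` stays over `x₁`, so its endpoint has lifts over `x₁` and over `x₂`, which differ by a deck
transformation. The spectra agree because all conormal covectors of `S` are suspended. -/

instance (priority := 2000) formNormedAddCommGroup {E : Type*} [NormedAddCommGroup E]
    [NormedSpace ℝ E] : NormedAddCommGroup (E →L[ℝ] E →L[ℝ] ℝ) :=
  ContinuousLinearMap.toNormedAddCommGroup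

instance (priority := 2000) formNormedSpace {E : Type*} [NormedAddCommGroup E]
    [NormedSpace ℝ E] : NormedSpace ℝ (E →L[ℝ] E →L[ℝ] ℝ) :=
  ContinuousLinearMap.toNormedSpace

/-! ### Hamilton's equations in a vector space and their canonical invariance -/

section LocalHamilton

variable {E' : Type*} [NormedAddCommGroup E'] [NormedSpace ℝ E']
  {E : Type*} [NormedAddCommGroup E] [NormedSpace ℝ E]

/-- Hamilton's equations at time `t` for a curve `z = (q, p)` and the Hamiltonian `K (q, p)`. -/
structure HamAt (K : E × (E →L[ℝ] ℝ) → ℝ) (z : ℝ → E × (E →L[ℝ] ℝ)) (t : ℝ) : Prop where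
  position : ∀ ℓ : E →L[ℝ] ℝ,
    HasDerivAt (fun τ => ℓ (z τ).1) (fderiv ℝ (fun p => K ((z t).1, p)) (z t).2 ℓ) t
  momentum : HasDerivAt (fun τ => (z τ).2) (-(fderiv ℝ (fun q => K (q, (z t).2)) (z t).1)) t

theorem HamAt.congr {K K' : E × (E →L[ℝ] ℝ) → ℝ} {z z' : ℝ → E × (E →L[ℝ] ℝ)} {t : ℝ}
    (h : HamAt K z t) (hK : K =ᶠ[𝓝 (z t)] K') (hz : z =ᶠ[𝓝 t] z') : HamAt K' z' t := by
  have e : z t = z' t := hz.eq_of_nhds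
  refine ⟨fun ℓ => ?_, ?_⟩
  · have h1 : (fun p => K ((z t).1, p)) =ᶠ[𝓝 (z t).2] fun p => K' ((z t).1, p) :=
      (Continuous.prodMk_right (z t).1).continuousAt.eventually hK
    have h2 := h.position ℓ
    rw [h1.fderiv_eq, e] at h2
    exact h2.congr_of_eventuallyEq (by filter_upwards [hz] with τ hτ; rw [hτ])
  · have h1 : (fun q => K (q, (z t).2)) =ᶠ[𝓝 (z t).1] fun q => K' (q, (z t).2) :=
      (Continuous.prodMk_left (z t).2).continuousAt.eventually hK
    have h2 := h.momentum
    rw [h1.fderiv_eq, e] at h2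
    exact h2.congr_of_eventuallyEq (by filter_upwards [hz] with τ hτ; rw [hτ])

/-- In finite dimension, Hamilton's equations tested against functionals are equivalent to the
usual ones. -/
theorem hamAt_iff [FiniteDimensional ℝ E] {K : E × (E →L[ℝ] ℝ) → ℝ}
    {z : ℝ → E × (E →L[ℝ] ℝ)} {t : ℝ} {K' : E × (E →L[ℝ] ℝ) →L[ℝ] ℝ}
    (hK : HasFDerivAt K K' (z t)) :
    HamAt K z t ↔ ∃ q' p', HasDerivAt z (q', p') t ∧ (∀ ℓ, ℓ q' = K' (0, ℓ)) ∧
      ∀ v, p' v = -K' (v, 0) := by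
  have h1 : fderiv ℝ (fun p => K ((z t).1, p)) (z t).2 = K'.comp (.inr ℝ E _) :=
    (HasFDerivAt.comp (f := fun p => ((z t).1, p)) (z t).2 hK
      (hasFDerivAt_prodMk_right (z t).1 (z t).2)).fderiv
  have h2 : fderiv ℝ (fun q => K (q, (z t).2)) (z t).1 = K'.comp (.inl ℝ E _) :=
    (HasFDerivAt.comp (f := fun q => (q, (z t).2)) (z t).1 hK
      (hasFDerivAt_prodMk_left (z t).1 (z t).2)).fderiv
  constructor
  · rintro ⟨hp, hm⟩
    rw [h2] at hm
    let b := Module.finBasis ℝ E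
    let L : E ≃L[ℝ] (Fin (Module.finrank ℝ E) → ℝ) := b.equivFun.toContinuousLinearEquiv
    -- Testing against the coordinate functionals of a basis gives differentiability of each
    -- coordinate, hence of the position itself.
    have hc : HasDerivAt (fun τ => L (z τ).1)
        (fun i => K' (0, (ContinuousLinearMap.proj i).comp
          (L : E →L[ℝ] (Fin (Module.finrank ℝ E) → ℝ)))) t := by
      rw [hasDerivAt_pi]
      intro i
      have := hp ((ContinuousLinearMap.proj i).comp
        (L : E →L[ℝ] (Fin (Module.finrank ℝ E) → ℝ)))
      rw [h1] at this
      exact this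
    have hq := (L.symm : _ →L[ℝ] E).hasFDerivAt.comp_hasDerivAt t hc
    have hq' : HasDerivAt (fun τ => (z τ).1) (L.symm
        (fun i => K' (0, (ContinuousLinearMap.proj i).comp
          (L : E →L[ℝ] (Fin (Module.finrank ℝ E) → ℝ))))) t :=
      hq.congr_of_eventuallyEq (.of_forall fun τ => (L.symm_apply_apply _).symm)
    refine ⟨_, _, hq'.prodMk hm, fun ℓ => ?_, fun v => by simp⟩
    have := hp ℓ
    rw [h1] at this
    exact (ℓ.hasFDerivAt.comp_hasDerivAt t hq').unique this
  · rintro ⟨q', p', hz, hq, hp⟩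
    refine ⟨fun ℓ => ?_, ?_⟩
    · rw [h1]
      have := ℓ.hasFDerivAt.comp_hasDerivAt t
        ((ContinuousLinearMap.fst ℝ E (E →L[ℝ] ℝ)).hasFDerivAt.comp_hasDerivAt t hz)
      convert! this using 1
      simp [hq]
    · rw [h2]
      have := (ContinuousLinearMap.snd ℝ E (E →L[ℝ] ℝ)).hasFDerivAt.comp_hasDerivAt t hz
      convert! this using 1
      ext v
      simp [hp]

/-- Conservation of energy. -/
theorem HamAt.energy [FiniteDimensional ℝ E] {K : E × (E →L[ℝ] ℝ) → ℝ}
    {z : ℝ → E × (E →L[ℝ] ℝ)} {t : ℝ} (h : HamAt K z t) (hK : DifferentiableAt ℝ K (z t)) :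
    HasDerivAt (fun τ => K (z τ)) 0 t := by
  obtain ⟨q', p', hz, hq, hp⟩ := (hamAt_iff hK.hasFDerivAt).1 h
  have := hK.hasFDerivAt.comp_hasDerivAt t hz
  convert! this using 1
  set K' := fderiv ℝ K (z t)
  have e : ((q', p') : E × (E →L[ℝ] ℝ)) = (q', 0) + (0, p') := by simp
  -- The position equation tested against the functional `p'` turns the `∂K/∂p` term into `p' q'`,
  -- which the momentum equation cancels against the `∂K/∂q` term.
  rw [e, map_add, ← hq p', hp]
  ring

/-- Hamilton's equations are invariant under the canonical transformation
`(q, p) ↦ (ψ q, p ∘ (dψ)⁻¹)`. -/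
theorem HamAt.canonical [FiniteDimensional ℝ E] [FiniteDimensional ℝ E']
    {K : E × (E →L[ℝ] ℝ) → ℝ} {z : ℝ → E × (E →L[ℝ] ℝ)} {t : ℝ}
    {Kb : E' × (E' →L[ℝ] ℝ) → ℝ} {zb : ℝ → E' × (E' →L[ℝ] ℝ)}
    {ψ : E → E'} {A : E → E' →L[ℝ] E}
    (h : HamAt K z t) (hK : DifferentiableAt ℝ K (z t)) (hKb : DifferentiableAt ℝ Kb (zb t))
    (hψ : ContDiffAt ℝ 2 ψ (z t).1) (hA : DifferentiableAt ℝ A (z t).1)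
    (hA1 : ∀ᶠ q in 𝓝 (z t).1, (fderiv ℝ ψ q).comp (A q) = .id ℝ E')
    (hA2 : ∀ᶠ q in 𝓝 (z t).1, (A q).comp (fderiv ℝ ψ q) = .id ℝ E)
    (hz1 : ∀ᶠ τ in 𝓝 t, (zb τ).1 = ψ (z τ).1)
    (hz2 : ∀ᶠ τ in 𝓝 t, (zb τ).2 = (z τ).2.comp (A (z τ).1))
    (hKK : ∀ᶠ w in 𝓝 ((z t).1, (zb t).2), K (w.1, w.2.comp (fderiv ℝ ψ w.1)) = Kb (ψ w.1, w.2)) :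
    HamAt Kb zb t := by
  obtain ⟨q', p', hz, hq, hp⟩ := (hamAt_iff hK.hasFDerivAt).1 h
  rw [hamAt_iff hKb.hasFDerivAt]
  set q := (z t).1 with hqdef
  set p := (z t).2 with hpdef
  set pb := (zb t).2 with hpbdef
  have hzq : HasDerivAt (fun τ => (z τ).1) q' t :=
    (ContinuousLinearMap.fst ℝ E (E →L[ℝ] ℝ)).hasFDerivAt.comp_hasDerivAt t hz
  have hzp : HasDerivAt (fun τ => (z τ).2) p' t :=
    (ContinuousLinearMap.snd ℝ E (E →L[ℝ] ℝ)).hasFDerivAt.comp_hasDerivAt t hz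
  have hψ1 : HasFDerivAt ψ (fderiv ℝ ψ q) q :=
    (hψ.differentiableAt (by norm_num)).hasFDerivAt
  have hψ2 : HasFDerivAt (fderiv ℝ ψ) (fderiv ℝ (fderiv ℝ ψ) q) q :=
    ((hψ.fderiv_right (m := 1) (by norm_num)).differentiableAt (by norm_num)).hasFDerivAt
  have hsymm : ∀ v w, fderiv ℝ (fderiv ℝ ψ) q v w = fderiv ℝ (fderiv ℝ ψ) q w v :=
    hψ.isSymmSndFDerivAt (by simp)
  set dψ := fderiv ℝ ψ q with hdψ
  set ddψ := fderiv ℝ (fderiv ℝ ψ) q with hddψ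
  set A' := fderiv ℝ A q with hA'
  have hAd : HasFDerivAt A A' q := hA.hasFDerivAt
  have eA1 : dψ.comp (A q) = .id ℝ E' := hA1.self_of_nhds
  have eA2 : (A q).comp dψ = .id ℝ E := hA2.self_of_nhds
  have hpb : pb = p.comp (A q) := hz2.self_of_nhds
  have hpp : p = pb.comp dψ := by
    rw [hpb, ContinuousLinearMap.comp_assoc, eA2, ContinuousLinearMap.comp_id]
  -- derivative of `dψ ∘ A = id`
  have hrel : ∀ v w, ddψ v (A q w) + dψ (A' v w) = 0 := by
    intro v w
    have h1 := hψ2.clm_comp hAd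
    have h2 : HasFDerivAt (fun y => (fderiv ℝ ψ y).comp (A y)) (0 : E →L[ℝ] E' →L[ℝ] E') q :=
      (hasFDerivAt_const (ContinuousLinearMap.id ℝ E') q).congr_of_eventuallyEq hA1
    have h3 := congrArg (fun L : E →L[ℝ] E' →L[ℝ] E' => L v w) (h1.unique h2)
    simpa [add_comm] using h3
  -- derivative of the relation between the Hamiltonians
  have hder : ∀ v δ, fderiv ℝ K (z t) (v, pb.comp (ddψ v) + δ.comp dψ) =
      fderiv ℝ Kb (zb t) (dψ v, δ) := by
    intro v δ
    have hf : HasFDerivAt (fun w : E × (E' →L[ℝ] ℝ) => fderiv ℝ ψ w.1)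
        (ddψ.comp (.fst ℝ E (E' →L[ℝ] ℝ))) (q, pb) :=
      HasFDerivAt.comp (g := fderiv ℝ ψ) (f := Prod.fst) (q, pb) hψ2 hasFDerivAt_fst
    have h1 : HasFDerivAt (fun w : E × (E' →L[ℝ] ℝ) => (w.1, w.2.comp (fderiv ℝ ψ w.1))) _
        (q, pb) := hasFDerivAt_fst.prodMk (hasFDerivAt_snd.clm_comp hf)
    have hKz : HasFDerivAt K (fderiv ℝ K (z t)) (q, pb.comp dψ) := by
      rw [← hpp]; exact hK.hasFDerivAt
    have h2 := HasFDerivAt.comp (q, pb) hKz h1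
    have h3 : HasFDerivAt (fun w : E × (E' →L[ℝ] ℝ) => (ψ w.1, w.2)) _ (q, pb) :=
      (HasFDerivAt.comp (g := ψ) (f := Prod.fst) (q, pb) hψ1 hasFDerivAt_fst).prodMk
        (hasFDerivAt_snd (p := (q, pb)))
    have hKz' : HasFDerivAt Kb (fderiv ℝ Kb (zb t)) (ψ q, pb) := by
      rw [← hz1.self_of_nhds]; exact hKb.hasFDerivAt
    have h4 := HasFDerivAt.comp (q, pb) hKz' h3
    have h5 := (h2.congr_of_eventuallyEq (hKK.mono fun w hw => hw.symm)).unique h4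
    have h6 := congrArg (fun L : E × (E' →L[ℝ] ℝ) →L[ℝ] ℝ => L (v, δ)) h5
    simpa using h6
  have hzb1 : HasDerivAt (fun τ => (zb τ).1) (dψ q') t :=
    (hψ1.comp_hasDerivAt t hzq).congr_of_eventuallyEq hz1
  have hzb2 : HasDerivAt (fun τ => (zb τ).2) (p.comp (A' q') + p'.comp (A q)) t := by
    have h1 : HasDerivAt (fun τ => A (z τ).1) (A' q') t := hAd.comp_hasDerivAt t hzq
    have := hzp.clm_comp h1
    rw [add_comm] at this
    exact this.congr_of_eventuallyEq hz2
  refine ⟨_, _, hzb1.prodMk hzb2, fun ℓ => ?_, fun w => ?_⟩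
  · have := hder 0 ℓ
    simp only [map_zero, ContinuousLinearMap.comp_zero, zero_add] at this
    rw [← this, ← hq]
    rfl
  -- The relation between the Hamiltonians is known along `dψ v` only, which is every direction
  -- because `dψ` is invertible.
  · obtain ⟨v, rfl⟩ : ∃ v, w = dψ v := ⟨A q w, (congrArg (fun L : E' →L[ℝ] E' => L w) eA1).symm⟩
    have hAv : A q (dψ v) = v := congrArg (fun L : E →L[ℝ] E => L v) eA2
    have h1 := hder v 0
    simp only [ContinuousLinearMap.zero_comp, add_zero] at h1
    have e : ((v, pb.comp (ddψ v)) : E × (E →L[ℝ] ℝ)) = (v, 0) + (0, pb.comp (ddψ v)) := by simp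
    rw [e, map_add, ← hq] at h1
    have h2 := hrel q' (dψ v)
    rw [hAv] at h2
    have h3 := congrArg pb h2
    rw [map_add, map_zero] at h3
    rw [← h1]
    simp only [add_apply, ContinuousLinearMap.comp_apply, hAv, hp]
    rw [hpp]
    simp only [ContinuousLinearMap.comp_apply]
    -- The one non-formal point: the two second-derivative terms, one from moving `A` along the
    -- curve and one from differentiating `p ∘ dψ`, cancel by the symmetry of `ddψ`.
    rw [hsymm v q']
    linarith

end LocalHamilton

/-! ### Hamiltonians of the form `√(N + N')` on a product -/

section ProductHamilton

variable {E' : Type*} [NormedAddCommGroup E'] [NormedSpace ℝ E'] [FiniteDimensional ℝ E']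
  {E : Type*} [NormedAddCommGroup E] [NormedSpace ℝ E] [FiniteDimensional ℝ E]

/-- The first component of a phase space point of a product. -/
def phaseFst (w : (E × E') × (E × E' →L[ℝ] ℝ)) : E × (E →L[ℝ] ℝ) :=
  (w.1.1, w.2.comp (.inl ℝ _ _))

/-- The second component of a phase space point of a product. -/
def phaseSnd (w : (E × E') × (E × E' →L[ℝ] ℝ)) : E' × (E' →L[ℝ] ℝ) :=
  (w.1.2, w.2.comp (.inr ℝ _ _))

/-- `phaseFst` as a continuous linear map. -/
def phaseFstL : (E × E') × (E × E' →L[ℝ] ℝ) →L[ℝ] E × (E →L[ℝ] ℝ) :=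
  ((ContinuousLinearMap.fst ℝ E E').comp (.fst ℝ _ _)).prod
    ((ContinuousLinearMap.precomp ℝ (ContinuousLinearMap.inl ℝ E E')).comp (.snd ℝ _ _))

/-- `phaseSnd` as a continuous linear map. -/
def phaseSndL : (E × E') × (E × E' →L[ℝ] ℝ) →L[ℝ] E' × (E' →L[ℝ] ℝ) :=
  ((ContinuousLinearMap.snd ℝ E E').comp (.fst ℝ _ _)).prod
    ((ContinuousLinearMap.precomp ℝ (ContinuousLinearMap.inr ℝ E E')).comp (.snd ℝ _ _))

theorem phaseFstL_apply (w : (E × E') × (E × E' →L[ℝ] ℝ)) : phaseFstL w = phaseFst w := rfl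

theorem phaseSndL_apply (w : (E × E') × (E × E' →L[ℝ] ℝ)) : phaseSndL w = phaseSnd w := rfl

theorem hasFDerivAt_phaseFst (w : (E × E') × (E × E' →L[ℝ] ℝ)) :
    HasFDerivAt phaseFst phaseFstL w :=
  (phaseFstL (E := E) (E' := E')).hasFDerivAt

theorem hasFDerivAt_phaseSnd (w : (E × E') × (E × E' →L[ℝ] ℝ)) :
    HasFDerivAt phaseSnd phaseSndL w :=
  (phaseSndL (E := E) (E' := E')).hasFDerivAt

variable {N : E × (E →L[ℝ] ℝ) → ℝ} {N' : E' × (E' →L[ℝ] ℝ) → ℝ}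
  {z : ℝ → (E × E') × (E × E' →L[ℝ] ℝ)} {t : ℝ}

theorem hasFDerivAt_sqrt_add {w : (E × E') × (E × E' →L[ℝ] ℝ)}
    (hN : DifferentiableAt ℝ N (phaseFst w)) (hN' : DifferentiableAt ℝ N' (phaseSnd w))
    (h0 : N (phaseFst w) + N' (phaseSnd w) ≠ 0) :
    HasFDerivAt (fun w => √(N (phaseFst w) + N' (phaseSnd w)))
      ((1 / (2 * √(N (phaseFst w) + N' (phaseSnd w)))) •
        ((fderiv ℝ N (phaseFst w)).comp phaseFstL + (fderiv ℝ N' (phaseSnd w)).comp phaseSndL)) w :=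
  ((HasFDerivAt.comp (g := N) (f := phaseFst) w hN.hasFDerivAt (hasFDerivAt_phaseFst w)).add
    (HasFDerivAt.comp (g := N') (f := phaseSnd) w hN'.hasFDerivAt (hasFDerivAt_phaseSnd w))).sqrt h0

/-- For a Hamiltonian `√(N + N')` on a product, `N` is a first integral. -/
theorem HamAt.hasDerivAt_fst (h : HamAt (fun w => √(N (phaseFst w) + N' (phaseSnd w))) z t)
    (hN : DifferentiableAt ℝ N (phaseFst (z t))) (hN' : DifferentiableAt ℝ N' (phaseSnd (z t)))
    (h0 : N (phaseFst (z t)) + N' (phaseSnd (z t)) ≠ 0) :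
    HasDerivAt (fun τ => N (phaseFst (z τ))) 0 t := by
  obtain ⟨q', p', hz, hq, hp⟩ := (hamAt_iff (hasFDerivAt_sqrt_add hN hN' h0)).1 h
  have h1 : HasDerivAt (fun τ => phaseFst (z τ)) (phaseFst (q', p')) t :=
    (hasFDerivAt_phaseFst (z t)).comp_hasDerivAt t hz
  have h2 := hN.hasFDerivAt.comp_hasDerivAt t h1
  convert! h2 using 1
  set N1 := fderiv ℝ N (phaseFst (z t))
  set c := (1 / (2 * √(N (phaseFst (z t)) + N' (phaseSnd (z t)))))
  -- The first component solves Hamilton's equations of `N` up to the factor `c` from the square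
  -- root, so the two halves of `dN` cancel as the Poisson bracket of `N` with itself.
  have e1 : phaseFst (q', p') = (q'.1, 0) + (0, p'.comp (.inl ℝ E E')) := by simp [phaseFst]
  rw [e1, map_add]
  -- the functional `∂N/∂q`
  have e2 := hq ((N1.comp (.inl ℝ E (E →L[ℝ] ℝ))).comp (.fst ℝ E E'))
  have e3 : p'.comp (.inl ℝ E E') = -(c • N1.comp (.inl ℝ E (E →L[ℝ] ℝ))) := by
    ext v
    have := hp (v, 0)
    simpa [phaseFstL_apply, phaseSndL_apply, phaseFst, phaseSnd, ← Prod.zero_eq_mk] using this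
  have e5 : phaseSnd (((0, (N1.comp (.inl ℝ E (E →L[ℝ] ℝ))).comp (.fst ℝ E E'))) :
      (E × E') × (E × E' →L[ℝ] ℝ)) = 0 := by
    ext v
    · rfl
    · simp [phaseSnd, ← Prod.zero_eq_mk]
  have e6 : phaseFst (((0, (N1.comp (.inl ℝ E (E →L[ℝ] ℝ))).comp (.fst ℝ E E'))) :
      (E × E') × (E × E' →L[ℝ] ℝ)) = (0, N1.comp (.inl ℝ E (E →L[ℝ] ℝ))) := by
    ext v
    · rfl
    · simp [phaseFst]
  have e4 : N1 (q'.1, 0) = c * N1 (0, N1.comp (.inl ℝ E (E →L[ℝ] ℝ))) := by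
    simpa [phaseFstL_apply, phaseSndL_apply, e5, e6] using e2
  have e7 : ((0 : E), -(c • N1.comp (.inl ℝ E (E →L[ℝ] ℝ)))) =
      -(c • ((0 : E), N1.comp (.inl ℝ E (E →L[ℝ] ℝ)))) := by simp
  rw [e4, e3, e7, map_neg, map_smul, smul_eq_mul]
  ring

/-- For a Hamiltonian `√(N + N')` on a product and a curve whose first momentum vanishes, where
`N` vanishes to first order, Hamilton's equations say that the first position is stationary and
the second component satisfies Hamilton's equations for `√N'`. -/
theorem hamAt_sqrt_add_iff
    (hN : DifferentiableAt ℝ N (phaseFst (z t))) (hN' : DifferentiableAt ℝ N' (phaseSnd (z t)))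
    (hpos : ∀ᶠ w in 𝓝 (phaseFst (z t)), 0 ≤ N w) (hzero : N (phaseFst (z t)) = 0)
    (h0 : N' (phaseSnd (z t)) ≠ 0)
    (hp0 : ∀ᶠ τ in 𝓝 t, (z τ).2.comp (.inl ℝ E E') = 0) :
    HamAt (fun w => √(N (phaseFst w) + N' (phaseSnd w))) z t ↔
      HasDerivAt (fun τ => (z τ).1.1) 0 t ∧
        HamAt (fun w => √(N' w)) (fun τ => phaseSnd (z τ)) t := by
  -- `N` is nonnegative near this point and zero at it, so the point is a local minimum.
  have hN0 : fderiv ℝ N (phaseFst (z t)) = 0 := by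
    refine IsLocalMin.fderiv_eq_zero ?_
    filter_upwards [hpos] with w hw
    rwa [hzero]
  have h00 : N (phaseFst (z t)) + N' (phaseSnd (z t)) ≠ 0 := by rwa [hzero, zero_add]
  have hd := hasFDerivAt_sqrt_add hN hN' h00
  rw [hN0, hzero, zero_add, ContinuousLinearMap.zero_comp, zero_add] at hd
  have hd' : HasFDerivAt (fun w => √(N' w)) _ (phaseSnd (z t)) := hN'.hasFDerivAt.sqrt h0
  rw [hamAt_iff hd, hamAt_iff (z := fun τ => phaseSnd (z τ)) hd']
  set N1 := fderiv ℝ N' (phaseSnd (z t))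
  set c := (1 / (2 * √(N' (phaseSnd (z t)))))
  constructor
  · rintro ⟨q', p', hz, hq, hp⟩
    have hz1 : HasDerivAt (fun τ => (z τ).1.1) q'.1 t :=
      ((ContinuousLinearMap.fst ℝ E E').comp (.fst ℝ _ (E × E' →L[ℝ] ℝ))).hasFDerivAt.comp_hasDerivAt t
        hz
    have hq1 : q'.1 = 0 := by
      by_contra hne
      -- With `dN = 0` every functional on the first factor vanishes on the first velocity; a
      -- norming functional then contradicts `q'.1 ≠ 0`.
      obtain ⟨f, -, hf⟩ := exists_dual_vector ℝ q'.1 (norm_ne_zero_iff.2 hne)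
      have := hq (f.comp (.fst ℝ E E'))
      have e : phaseSnd (((0, f.comp (.fst ℝ E E'))) : (E × E') × (E × E' →L[ℝ] ℝ)) = 0 := by
        ext v
        · rfl
        · simp [phaseSnd]
      simp [phaseSndL_apply, e] at this
      rw [this] at hf
      exact hne (norm_eq_zero.1 (by simpa using hf.symm))
    rw [hq1] at hz1
    refine ⟨hz1, q'.2, p'.comp (.inr ℝ E E'), (hasFDerivAt_phaseSnd (z t)).comp_hasDerivAt t hz,
      fun ℓ => ?_, fun v => ?_⟩
    · have := hq (ℓ.comp (.snd ℝ E E'))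
      have e : phaseSnd (((0, ℓ.comp (.snd ℝ E E'))) : (E × E') × (E × E' →L[ℝ] ℝ)) = (0, ℓ) := by
        ext v
        · rfl
        · simp [phaseSnd]
      simpa [phaseSndL_apply, e] using this
    · have := hp (0, v)
      simpa [phaseSndL_apply, phaseSnd] using this
  · rintro ⟨hz1, q', p', hz, hq, hp⟩
    have hz2 : HasDerivAt (fun τ => (z τ).1.2) q' t :=
      (ContinuousLinearMap.fst ℝ E' (E' →L[ℝ] ℝ)).hasFDerivAt.comp_hasDerivAt t hz
    have hz3 : HasDerivAt (fun τ => (z τ).2.comp (.inr ℝ E E')) p' t :=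
      (ContinuousLinearMap.snd ℝ E' (E' →L[ℝ] ℝ)).hasFDerivAt.comp_hasDerivAt t hz
    -- The first momentum vanishes for all nearby times, so the full momentum is the second one
    -- composed with the projection.
    have hz4 : HasDerivAt (fun τ => (z τ).2) (p'.comp (.snd ℝ E E')) t := by
      have := ((ContinuousLinearMap.precomp ℝ
        (ContinuousLinearMap.snd ℝ E E')).hasFDerivAt.comp_hasDerivAt t hz3)
      refine this.congr_of_eventuallyEq ?_
      filter_upwards [hp0] with τ hτ
      ext v
      · simpa [← Prod.zero_eq_mk] using congrArg (fun L : E →L[ℝ] ℝ => L v) hτ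
      · simp
    refine ⟨(0, q'), p'.comp (.snd ℝ E E'), (hz1.prodMk hz2).prodMk hz4, fun ℓ => ?_, fun v => ?_⟩
    · have := hq (ℓ.comp (.inr ℝ E E'))
      simpa [phaseSndL_apply, phaseSnd] using this
    · have := hp v.2
      simpa [phaseSndL_apply, phaseSnd] using this

end ProductHamilton

/-! ### Derivatives and covectors read in the model space -/

section Plain

variable {E : Type*} [NormedAddCommGroup E] [NormedSpace ℝ E]
  {H : Type*} [TopologicalSpace H] (I : ModelWithCorners ℝ E H)
  {M : Type*} [TopologicalSpace M] [ChartedSpace H M]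
  {E' : Type*} [NormedAddCommGroup E'] [NormedSpace ℝ E']
  {H' : Type*} [TopologicalSpace H'] (I' : ModelWithCorners ℝ E' H')
  {M' : Type*} [TopologicalSpace M'] [ChartedSpace H' M']
  {E₃ : Type*} [NormedAddCommGroup E₃] [NormedSpace ℝ E₃]
  {H₃ : Type*} [TopologicalSpace H₃] (I₃ : ModelWithCorners ℝ E₃ H₃)
  {M₃ : Type*} [TopologicalSpace M₃] [ChartedSpace H₃ M₃]

/-- The derivative of a map between manifolds as a linear map between the model spaces. -/
def tderiv (f : M → M') (x : M) : E →L[ℝ] E' := mfderiv I I' f x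

/-- The linear functional on the model space underlying a covector. -/
def Cotangent.fn {I : ModelWithCorners ℝ E H} (ξ : Cotangent I M) : E →L[ℝ] ℝ := ξ.2

/-- The covector at `x` with underlying functional `p`. -/
def covectorMk (x : M) (p : E →L[ℝ] ℝ) : Cotangent I M := ⟨x, p⟩

@[simp] theorem covectorMk_fst (x : M) (p : E →L[ℝ] ℝ) : (covectorMk I x p).1 = x := rfl

@[simp] theorem covectorMk_fn (x : M) (p : E →L[ℝ] ℝ) : (covectorMk I x p).fn = p := rfl

theorem covectorMk_eta (ξ : Cotangent I M) : covectorMk I ξ.1 ξ.fn = ξ := rfl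

variable {I I' I₃} in
theorem Cotangent.ext' {ξ η : Cotangent I M} (h : ξ.1 = η.1) (h' : ξ.fn = η.fn) : ξ = η := by
  rw [← covectorMk_eta I ξ, ← covectorMk_eta I η, h, h']

variable {I I' I₃}

theorem tderiv_comp {g : M' → M₃} {f : M → M'} {x : M} (hg : MDifferentiableAt I' I₃ g (f x))
    (hf : MDifferentiableAt I I' f x) :
    tderiv I I₃ (fun z => g (f z)) x = (tderiv I' I₃ g (f x)).comp (tderiv I I' f x) :=
  mfderiv_comp x hg hf

theorem tderiv_congr {f f' : M → M'} {x : M} (h : f =ᶠ[𝓝 x] f') :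
    tderiv I I' f x = tderiv I I' f' x := h.mfderiv_eq

theorem tderiv_id (x : M) : tderiv I I (fun z : M => z) x = .id ℝ E := mfderiv_id

theorem tderiv_comp_eq_id {g : M' → M} {f : M → M'} {x : M}
    (hg : MDifferentiableAt I' I g (f x)) (hf : MDifferentiableAt I I' f x)
    (h : ∀ᶠ z in 𝓝 x, g (f z) = z) :
    (tderiv I' I g (f x)).comp (tderiv I I' f x) = .id ℝ E := by
  rw [← tderiv_comp hg hf, ← tderiv_id (M := M) (I := I) x]
  exact tderiv_congr h

theorem tderiv_prodMk {f : M → M'} {g : M → M₃} {x : M} (hf : MDifferentiableAt I I' f x)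
    (hg : MDifferentiableAt I I₃ g x) :
    tderiv I (I'.prod I₃) (fun z => (f z, g z)) x = (tderiv I I' f x).prod (tderiv I I₃ g x) :=
  mfderiv_prodMk hf hg

theorem tderiv_fst (x : M × M') : tderiv (I.prod I') I Prod.fst x = .fst ℝ E E' := mfderiv_fst

theorem tderiv_snd (x : M × M') : tderiv (I.prod I') I' Prod.snd x = .snd ℝ E E' := mfderiv_snd

theorem tderiv_const (x : M) (c : M') : tderiv I I' (fun _ : M => c) x = 0 := mfderiv_const

theorem tderiv_prodMap {M₂ E₂ H₂ : Type*} [NormedAddCommGroup E₂] [NormedSpace ℝ E₂]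
    [TopologicalSpace H₂] {I₂ : ModelWithCorners ℝ E₂ H₂} [TopologicalSpace M₂] [ChartedSpace H₂ M₂]
    {f : M → M'} {g : M₂ → M₃} {x : M × M₂}
    (hf : MDifferentiableAt I I' f x.1) (hg : MDifferentiableAt I₂ I₃ g x.2) :
    tderiv (I.prod I₂) (I'.prod I₃) (fun z => (f z.1, g z.2)) x =
      (tderiv I I' f x.1).prodMap (tderiv I₂ I₃ g x.2) := by
  rw [tderiv_prodMk (f := fun z : M × M₂ => f z.1) (g := fun z : M × M₂ => g z.2)
      (hf.comp x mdifferentiableAt_fst) (hg.comp x mdifferentiableAt_snd),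
    tderiv_comp (f := Prod.fst) hf mdifferentiableAt_fst,
    tderiv_comp (f := Prod.snd) hg mdifferentiableAt_snd, tderiv_fst, tderiv_snd]
  rfl

variable [I.Boundaryless] [IsManifold I 1 M]

theorem mdifferentiableAt_extChartAt_symm {x : M} {q : E} (hq : q ∈ (extChartAt I x).target) :
    MDifferentiableAt 𝓘(ℝ, E) I (extChartAt I x).symm q := by
  have := mdifferentiableWithinAt_extChartAt_symm hq
  rwa [I.range_eq_univ, mdifferentiableWithinAt_univ] at this

theorem mdifferentiableAt_extChartAt' {x y : M} (hy : y ∈ (extChartAt I x).source) :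
    MDifferentiableAt I 𝓘(ℝ, E) (extChartAt I x) y :=
  mdifferentiableAt_extChartAt (by rwa [extChartAt_source] at hy)

theorem tderiv_extChartAt_comp_symm {x : M} {q : E} (hq : q ∈ (extChartAt I x).target) :
    (tderiv I 𝓘(ℝ, E) (extChartAt I x) ((extChartAt I x).symm q)).comp
      (tderiv 𝓘(ℝ, E) I (extChartAt I x).symm q) = .id ℝ E :=
  tderiv_comp_eq_id (mdifferentiableAt_extChartAt' ((extChartAt I x).map_target hq))
    (mdifferentiableAt_extChartAt_symm hq)
    (by
      filter_upwards [extChartAt_target_mem_nhds' hq] with z hz using (extChartAt I x).right_inv hz)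

theorem tderiv_extChartAt_symm_comp {x y : M} (hy : y ∈ (extChartAt I x).source) :
    (tderiv 𝓘(ℝ, E) I (extChartAt I x).symm (extChartAt I x y)).comp
      (tderiv I 𝓘(ℝ, E) (extChartAt I x) y) = .id ℝ E :=
  tderiv_comp_eq_id (mdifferentiableAt_extChartAt_symm ((extChartAt I x).map_source hy))
    (mdifferentiableAt_extChartAt' hy)
    (by
      filter_upwards [extChartAt_source_mem_nhds' hy] with z hz using (extChartAt I x).left_inv hz)

theorem cotangentChart_eq (x₀ : M) (ξ : Cotangent I M) : cotangentChart I x₀ ξ =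
    (extChartAt I x₀ ξ.1, ξ.fn.comp (tderiv 𝓘(ℝ, E) I (extChartAt I x₀).symm
      (extChartAt I x₀ ξ.1))) := rfl

theorem cotangentChartSymm_eq (x₀ : M) (q : E) (p : E →L[ℝ] ℝ) : cotangentChartSymm I x₀ q p =
    covectorMk I ((extChartAt I x₀).symm q)
      (p.comp (tderiv I 𝓘(ℝ, E) (extChartAt I x₀) ((extChartAt I x₀).symm q))) := rfl

theorem cotangentChartSymm_cotangentChart {x₀ : M} {ξ : Cotangent I M}
    (h : ξ.1 ∈ (extChartAt I x₀).source) :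
    cotangentChartSymm I x₀ (cotangentChart I x₀ ξ).1 (cotangentChart I x₀ ξ).2 = ξ := by
  refine Cotangent.ext' ((extChartAt I x₀).left_inv h) ?_
  rw [cotangentChartSymm_eq, covectorMk_fn, cotangentChart_eq]
  simp only [(extChartAt I x₀).left_inv h]
  rw [ContinuousLinearMap.comp_assoc, tderiv_extChartAt_symm_comp h, ContinuousLinearMap.comp_id]

/-- Hamiltonian curves in terms of `HamAt`. -/
theorem isHamiltonianCurve_iff (F : Cotangent I M → ℝ) (c : ℝ → Cotangent I M) :
    IsHamiltonianCurve I F c ↔ (Continuous fun t => (c t).1) ∧ (∀ t, (c t).fn ≠ 0) ∧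
      ∀ t, HamAt (fun w => F (cotangentChartSymm I (c t).1 w.1 w.2))
        (fun τ => cotangentChart I (c t).1 (c τ)) t :=
  ⟨fun h => ⟨h.1, h.2, fun t => ⟨h.3 t, h.4 t⟩⟩, fun h => ⟨h.1, h.2.1, fun t => (h.2.2 t).1,
    fun t => (h.2.2 t).2⟩⟩

end Plain

/-! ### The dual norm of an inner product -/

section DualNorm

variable {E' : Type*} [NormedAddCommGroup E'] [NormedSpace ℝ E']
  {E : Type*} [NormedAddCommGroup E] [NormedSpace ℝ E]

/-- `sup {p v | Q v ≤ 1}`. -/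
def dualNorm (Q : E → ℝ) (p : E →L[ℝ] ℝ) : ℝ := sSup {r | ∃ v, Q v ≤ 1 ∧ r = p v}

/-- `A` maps one unit ball onto the other and matches the values of the functionals, so both suprema
are over the same set of reals. All isometry invariance of covector lengths goes through this;
surjectivity is enough and linearity plays no role. -/
theorem dualNorm_congr {Q : E → ℝ} {Q' : E' → ℝ} {p : E →L[ℝ] ℝ} {p' : E' →L[ℝ] ℝ}
    (A : E → E') (hA : Surjective A) (hQ : ∀ v, Q' (A v) = Q v) (hp : ∀ v, p' (A v) = p v) :
    dualNorm Q p = dualNorm Q' p' := by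
  unfold dualNorm
  congr 1
  ext r
  constructor
  · rintro ⟨v, hv, rfl⟩
    exact ⟨A v, (hQ v).trans_le hv, (hp v).symm⟩
  · rintro ⟨w, hw, rfl⟩
    obtain ⟨v, rfl⟩ := hA w
    exact ⟨v, (hQ v).symm.trans_le hw, hp v⟩

/-- Positive definite symmetric bilinear forms. -/
structure IsInnerForm (B : E →L[ℝ] E →L[ℝ] ℝ) : Prop where
  symm : ∀ v w, B v w = B w v
  pos : ∀ v, v ≠ 0 → 0 < B v v

namespace IsInnerForm

variable {B : E →L[ℝ] E →L[ℝ] ℝ} (hB : IsInnerForm B)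

include hB

theorem nonneg (v : E) : 0 ≤ B v v := by
  rcases eq_or_ne v 0 with rfl | h
  · simp
  · exact (hB.pos v h).le

theorem eq_zero {v : E} (h : B v v = 0) : v = 0 := by
  by_contra hv
  exact (hB.pos v hv).ne' h

/-- Discriminant of the nonnegative quadratic polynomial `s ↦ B (v + s w) (v + s w)`. -/
theorem sq_le (v w : E) : (B v w) ^ 2 ≤ B v v * B w w := by
  have h : ∀ s : ℝ, 0 ≤ (B w w) * (s * s) + (2 * B v w) * s + B v v := fun s => by
    have := hB.nonneg (v + s • w)
    simp only [map_add, map_smul, add_apply, smul_apply, smul_eq_mul] at this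
    rw [hB.symm w v] at this
    linarith
  have := discrim_le_zero h
  unfold discrim at this
  linarith

theorem injective : Injective B := by
  refine (injective_iff_map_eq_zero B).2 fun v hv => hB.eq_zero ?_
  rw [hv]; rfl

/-- Cauchy–Schwarz gives the upper bound, and the normalised representing vector attains it. -/
theorem dualNorm_eq {p : E →L[ℝ] ℝ} {u : E} (hu : B u = p) :
    dualNorm (fun v => B v v) p = √(p u) := by
  have hpu : p u = B u u := by rw [hu]
  have hub : ∀ r ∈ {r | ∃ v, B v v ≤ 1 ∧ r = p v}, r ≤ √(p u) := by
    rintro r ⟨v, hv, rfl⟩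
    apply Real.le_sqrt_of_sq_le
    rw [hpu, ← hu]
    have := hB.sq_le u v
    nlinarith [hB.nonneg u, hB.nonneg v]
  have hmem : √(p u) ∈ {r | ∃ v, B v v ≤ 1 ∧ r = p v} := by
    rcases eq_or_ne u 0 with rfl | h
    · exact ⟨0, by simp, by simp⟩
    · have h0 := hB.pos u h
      have hs := Real.sqrt_pos.2 h0
      refine ⟨(√(B u u))⁻¹ • u, ?_, ?_⟩
      · simp only [map_smul, smul_apply, smul_eq_mul]
        rw [← mul_assoc, ← mul_inv, Real.mul_self_sqrt h0.le, inv_mul_cancel₀ h0.ne']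
      · rw [map_smul, smul_eq_mul, hpu]
        nth_rewrite 3 [← Real.mul_self_sqrt h0.le]
        field_simp
  exact (IsGreatest.csSup_eq ⟨hmem, fun r hr => hub r hr⟩)

theorem dualNorm_sq {p : E →L[ℝ] ℝ} {u : E} (hu : B u = p) :
    dualNorm (fun v => B v v) p ^ 2 = p u := by
  rw [hB.dualNorm_eq hu, Real.sq_sqrt]
  rw [← hu]
  exact hB.nonneg u

variable [FiniteDimensional ℝ E]

theorem bijective : Bijective B := by
  refine ⟨hB.injective, ?_⟩
  have e : Module.finrank ℝ E = Module.finrank ℝ (E →L[ℝ] ℝ) := by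
    rw [← (LinearMap.toContinuousLinearMap (𝕜 := ℝ) (E := E) (F' := ℝ)).finrank_eq]
    exact (Subspace.dual_finrank_eq).symm
  exact (LinearMap.injective_iff_surjective_of_finrank_eq_finrank (f := B.toLinearMap) e).1
    hB.injective

theorem exists_sharp (p : E →L[ℝ] ℝ) : ∃ u, B u = p := hB.bijective.2 p

theorem dualNorm_nonneg (p : E →L[ℝ] ℝ) : 0 ≤ dualNorm (fun v => B v v) p := by
  obtain ⟨u, hu⟩ := hB.exists_sharp p
  rw [hB.dualNorm_eq hu]
  exact Real.sqrt_nonneg _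

theorem dualNorm_eq_zero_iff {p : E →L[ℝ] ℝ} : dualNorm (fun v => B v v) p = 0 ↔ p = 0 := by
  obtain ⟨u, hu⟩ := hB.exists_sharp p
  rw [hB.dualNorm_eq hu, Real.sqrt_eq_zero (by rw [← hu]; exact hB.nonneg u)]
  constructor
  · intro h
    rw [← hu] at h ⊢
    rw [hB.eq_zero h, map_zero]
  · rintro rfl
    rfl

/-- Equality in the Cauchy–Schwarz inequality: a functional whose value at `w` is `B w w` and whose
dual norm is that of `w` is `B w`. -/
theorem eq_of_apply_eq {p : E →L[ℝ] ℝ} {w : E} (h1 : p w = B w w)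
    (h2 : dualNorm (fun v => B v v) p ^ 2 = B w w) : p = B w := by
  obtain ⟨u, hu⟩ := hB.exists_sharp p
  rw [hB.dualNorm_sq hu, ← hu] at h2
  rw [← hu] at h1 ⊢
  have : u - w = 0 := by
    apply hB.eq_zero
    simp only [map_sub, sub_apply]
    rw [hB.symm w u]
    linarith
  rw [sub_eq_zero.1 this]

/-- For the orthogonal sum `C` the vector representing `p` is the pair of vectors representing its
two restrictions, and the squared dual norm, being `p` of that vector, splits. This is what gives
the Hamiltonian of the suspension the shape `√(N + N')`. -/
theorem prod {B' : E' →L[ℝ] E' →L[ℝ] ℝ} (hB' : IsInnerForm B') [FiniteDimensional ℝ E']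
    (p : E × E' →L[ℝ] ℝ) :
    dualNorm (fun v : E × E' => B v.1 v.1 + B' v.2 v.2) p =
      √(dualNorm (fun v => B v v) (p.comp (.inl ℝ E E')) ^ 2 +
        dualNorm (fun v => B' v v) (p.comp (.inr ℝ E E')) ^ 2) := by
  let C : E × E' →L[ℝ] E × E' →L[ℝ] ℝ :=
    (((ContinuousLinearMap.precomp ℝ (ContinuousLinearMap.fst ℝ E E')).comp B).comp (.fst ℝ E E')) +
    (((ContinuousLinearMap.precomp ℝ (ContinuousLinearMap.snd ℝ E E')).comp B').comp (.snd ℝ E E'))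
  have hCa : ∀ v w, C v w = B v.1 w.1 + B' v.2 w.2 := fun v w => by simp [C]
  have hC : IsInnerForm C := by
    refine ⟨fun v w => by rw [hCa, hCa, hB.symm, hB'.symm], fun v hv => ?_⟩
    rw [hCa]
    rcases eq_or_ne v.1 0 with h | h
    · have h' : v.2 ≠ 0 := fun h' => hv (Prod.ext h h')
      linarith [hB.nonneg v.1, hB'.pos v.2 h']
    · linarith [hB.pos v.1 h, hB'.nonneg v.2]
  obtain ⟨u, hu⟩ := hB.exists_sharp (p.comp (.inl ℝ E E'))
  obtain ⟨u', hu'⟩ := hB'.exists_sharp (p.comp (.inr ℝ E E'))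
  have hCu : C (u, u') = p := by
    refine ContinuousLinearMap.ext fun v => ?_
    rw [hCa, hu, hu']
    simp only [ContinuousLinearMap.comp_apply, ContinuousLinearMap.inl_apply,
      ContinuousLinearMap.inr_apply]
    rw [← map_add]
    simp
  have := hC.dualNorm_eq hCu
  simp only [hCa] at this
  rw [this, hB.dualNorm_sq hu, hB'.dualNorm_sq hu']
  congr 1
  simp only [ContinuousLinearMap.comp_apply, ContinuousLinearMap.inl_apply,
      ContinuousLinearMap.inr_apply]
  rw [← map_add]
  simp

end IsInnerForm

theorem differentiableAt_comp_fst {F : Type*} [NormedAddCommGroup F] [NormedSpace ℝ F] {f : E → F}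
    {q : E} (hf : DifferentiableAt ℝ f q) (p : E') :
    DifferentiableAt ℝ (fun w : E × E' => f w.1) (q, p) :=
  DifferentiableAt.comp (g := f) (f := Prod.fst) (q, p) hf differentiableAt_fst

/-- The squared dual norm depends differentiably on the inner product and the functional. -/
theorem differentiableAt_dualNorm_sq [FiniteDimensional ℝ E] {B : E → E →L[ℝ] E →L[ℝ] ℝ} {q₀ : E}
    (hd : DifferentiableAt ℝ B q₀) (hB : ∀ᶠ q in 𝓝 q₀, IsInnerForm (B q)) (p₀ : E →L[ℝ] ℝ) :
    DifferentiableAt ℝ (fun w : E × (E →L[ℝ] ℝ) => dualNorm (fun v => B w.1 v v) w.2 ^ 2)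
      (q₀, p₀) := by
  let e : E ≃L[ℝ] (E →L[ℝ] ℝ) :=
    (LinearEquiv.ofBijective (B q₀).toLinearMap hB.self_of_nhds.bijective).toContinuousLinearEquiv
  have he : (e : E →L[ℝ] (E →L[ℝ] ℝ)) = B q₀ := rfl
  -- Near `q₀` the squared dual norm is `p (B⁻¹ p)`, and inversion is smooth at an invertible
  -- operator.
  have hinv : DifferentiableAt ℝ ContinuousLinearMap.inverse (B q₀) := by
    rw [← he]
    exact (contDiffAt_map_inverse (n := 1) e).differentiableAt (by norm_num)
  have h1 : DifferentiableAt ℝ (fun w : E × (E →L[ℝ] ℝ) => B w.1) (q₀, p₀) :=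
    differentiableAt_comp_fst hd p₀
  have h2 : DifferentiableAt ℝ (fun w : E × (E →L[ℝ] ℝ) => (B w.1).inverse) (q₀, p₀) :=
    DifferentiableAt.fun_comp' (𝕜 := ℝ) (g := ContinuousLinearMap.inverse)
      (f := fun w : E × (E →L[ℝ] ℝ) => B w.1) (q₀, p₀) hinv h1
  have h3 : DifferentiableAt ℝ (fun w : E × (E →L[ℝ] ℝ) => w.2 ((B w.1).inverse w.2)) (q₀, p₀) :=
    differentiableAt_snd.clm_apply (h2.clm_apply differentiableAt_snd)
  refine h3.congr_of_eventuallyEq ?_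
  have h4 : ∀ᶠ w : E × (E →L[ℝ] ℝ) in 𝓝 (q₀, p₀), IsInnerForm (B w.1) :=
    (continuous_fst.tendsto (q₀, p₀)).eventually hB
  filter_upwards [h4] with w hw
  refine hw.dualNorm_sq ?_
  let e' : E ≃L[ℝ] (E →L[ℝ] ℝ) :=
    (LinearEquiv.ofBijective (B w.1).toLinearMap hw.bijective).toContinuousLinearEquiv
  have he' : (e' : E →L[ℝ] (E →L[ℝ] ℝ)) = B w.1 := rfl
  rw [← he', ContinuousLinearMap.inverse_equiv]
  exact e'.apply_symm_apply w.2

end DualNorm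

/-! ### Riemannian metrics in charts -/

section Metric

variable {E : Type*} [NormedAddCommGroup E] [NormedSpace ℝ E] [FiniteDimensional ℝ E]
  {M : Type*} [TopologicalSpace M] [ChartedSpace E M] [IsManifold 𝓘(ℝ, E) ∞ M]
  {E' : Type*} [NormedAddCommGroup E'] [NormedSpace ℝ E']
  {N : Type*} [TopologicalSpace N] [ChartedSpace E' N] [IsManifold 𝓘(ℝ, E') ∞ N]
  (g : ContMDiffRiemannianMetric 𝓘(ℝ, E') ∞ E' (fun x : N => TangentSpace 𝓘(ℝ, E') x))

/-- The metric at a point as a bilinear form on the model space. -/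
def formAt (x : N) : E' →L[ℝ] E' →L[ℝ] ℝ := g.inner x

theorem isInnerForm_formAt (x : N) : IsInnerForm (formAt g x) := ⟨g.symm x, g.pos x⟩

/-- The bilinear form `B (A v) (A w)`. -/
def pullForm (B : E' →L[ℝ] E' →L[ℝ] ℝ) (A : E →L[ℝ] E') : E →L[ℝ] E →L[ℝ] ℝ :=
  (ContinuousLinearMap.precomp ℝ A).comp (B.comp A)

omit [FiniteDimensional ℝ E] in
@[simp] theorem pullForm_apply (B : E' →L[ℝ] E' →L[ℝ] ℝ) (A : E →L[ℝ] E') (v w : E) :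
    pullForm B A v w = B (A v) (A w) := rfl

omit [FiniteDimensional ℝ E] in
theorem IsInnerForm.pullForm {B : E' →L[ℝ] E' →L[ℝ] ℝ} (hB : IsInnerForm B) {A : E →L[ℝ] E'}
    (hA : Injective A) : IsInnerForm (pullForm B A) :=
  ⟨fun _ _ => hB.symm _ _, fun _ hv => hB.pos _ fun h => hv (hA (h.trans (map_zero A).symm))⟩

/-- An operator-valued map on a finite-dimensional space is `C¹` once all its evaluations at fixed
vectors are; each evaluation is the smooth metric applied to two `C¹` vector fields along `ρ`. -/
theorem differentiableAt_pullForm {ρ : E → N} {s : Set E} (hs : IsOpen s)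
    (hρ : ContMDiffOn 𝓘(ℝ, E) 𝓘(ℝ, E') ∞ ρ s) {q : E} (hq : q ∈ s) :
    DifferentiableAt ℝ (fun q => pullForm (formAt g (ρ q)) (tderiv 𝓘(ℝ, E) 𝓘(ℝ, E') ρ q)) q := by
  have key : ContDiffOn ℝ 1
      (fun q => pullForm (formAt g (ρ q)) (tderiv 𝓘(ℝ, E) 𝓘(ℝ, E') ρ q)) s := by
    rw [contDiffOn_clm_apply]
    intro v
    rw [contDiffOn_clm_apply]
    intro w
    -- The field `dρ v` along `ρ` is the tangent map of `ρ` applied to a constant section.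
    have hT : ∀ v : E, ContMDiffOn 𝓘(ℝ, E) 𝓘(ℝ, E').tangent 1
        (fun q => (⟨ρ q, mfderiv 𝓘(ℝ, E) 𝓘(ℝ, E') ρ q v⟩ : TangentBundle 𝓘(ℝ, E') N)) s := by
      intro v
      have h1 := hρ.contMDiffOn_tangentMapWithin (m := 1) (by
        rw [one_add_one_eq_two]; exact ENat.LEInfty.out)
        hs.uniqueMDiffOn
      have h2 : ContMDiff 𝓘(ℝ, E) 𝓘(ℝ, E).tangent 1
          (fun q : E => (⟨q, v⟩ : TangentBundle 𝓘(ℝ, E) E)) :=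
        contMDiff_vectorSpace_iff_contDiff.2 contDiff_const
      have h3 := h1.comp (h2.contMDiffOn (s := s)) (fun q hq => hq)
      refine h3.congr fun q hq => ?_
      simp only [comp_apply, tangentMapWithin, mfderivWithin_of_isOpen hs hq]
    have h : ContMDiffOn 𝓘(ℝ, E) 𝓘(ℝ, ℝ) 1 (fun q => g.inner (ρ q)
        (mfderiv 𝓘(ℝ, E) 𝓘(ℝ, E') ρ q v) (mfderiv 𝓘(ℝ, E) 𝓘(ℝ, E') ρ q w)) s := by
      intro x hx
      have : ContMDiffWithinAt 𝓘(ℝ, E) (𝓘(ℝ, E').prod 𝓘(ℝ, ℝ)) 1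
          (fun q => TotalSpace.mk' ℝ (E := Bundle.Trivial N ℝ) (ρ q) (g.inner (ρ q)
            (mfderiv 𝓘(ℝ, E) 𝓘(ℝ, E') ρ q v) (mfderiv 𝓘(ℝ, E) 𝓘(ℝ, E') ρ q w))) s x := by
        apply ContMDiffWithinAt.clm_bundle_apply₂ (F₁ := E') (F₂ := E')
        · exact ContMDiffAt.comp_contMDiffWithinAt x
            ((g.contMDiff.of_le ENat.LEInfty.out).contMDiffAt)
            ((hρ.of_le ENat.LEInfty.out) x hx)
        · exact hT v x hx
        · exact hT w x hx
      simp only [contMDiffWithinAt_totalSpace] at this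
      exact this.2
    exact contMDiffOn_iff_contDiffOn.1 h
  exact (key.contDiffAt (hs.mem_nhds hq)).differentiableAt (by norm_num)

end Metric

/-! ### Covector lengths in canonical coordinates -/

section NormChart

variable {E : Type*} [NormedAddCommGroup E] [NormedSpace ℝ E] [FiniteDimensional ℝ E]
  {M : Type*} [TopologicalSpace M] [ChartedSpace E M] [IsManifold 𝓘(ℝ, E) ∞ M]
  {E' : Type*} [NormedAddCommGroup E'] [NormedSpace ℝ E']
  {N : Type*} [TopologicalSpace N] [ChartedSpace E' N] [IsManifold 𝓘(ℝ, E') ∞ N]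
  (g : ContMDiffRiemannianMetric 𝓘(ℝ, E') ∞ E' (fun x : N => TangentSpace 𝓘(ℝ, E') x))

theorem tderiv_extChartAt_symm_bijective {x₀ : M} {q : E} (hq : q ∈ (extChartAt 𝓘(ℝ, E) x₀).target) :
    Bijective (tderiv 𝓘(ℝ, E) 𝓘(ℝ, E) (extChartAt 𝓘(ℝ, E) x₀).symm q) := by
  have h1 := tderiv_extChartAt_comp_symm (I := 𝓘(ℝ, E)) hq
  have h2 := tderiv_extChartAt_symm_comp (I := 𝓘(ℝ, E)) ((extChartAt 𝓘(ℝ, E) x₀).map_target hq)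
  rw [(extChartAt 𝓘(ℝ, E) x₀).right_inv hq] at h2
  exact ⟨LeftInverse.injective fun v => congrArg (fun L : E →L[ℝ] E => L v) h1,
    RightInverse.surjective fun v => congrArg (fun L : E →L[ℝ] E => L v) h2⟩

/-- The squared length of covectors with respect to the metric induced by an immersion `f` is a
differentiable function of the canonical coordinates. -/
theorem differentiableAt_dualNorm_chart {f : M → N} (hf : ContMDiff 𝓘(ℝ, E) 𝓘(ℝ, E') ∞ f)
    (hinj : ∀ x, Injective (tderiv 𝓘(ℝ, E) 𝓘(ℝ, E') f x)) (x₀ : M) {w : E × (E →L[ℝ] ℝ)}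
    (hw : w.1 ∈ (extChartAt 𝓘(ℝ, E) x₀).target) :
    DifferentiableAt ℝ (fun w : E × (E →L[ℝ] ℝ) =>
      dualNorm (fun v => pullForm (formAt g (f ((extChartAt 𝓘(ℝ, E) x₀).symm w.1)))
        (tderiv 𝓘(ℝ, E) 𝓘(ℝ, E') f ((extChartAt 𝓘(ℝ, E) x₀).symm w.1)) v v)
        (cotangentChartSymm 𝓘(ℝ, E) x₀ w.1 w.2).fn ^ 2) w := by
  set e := extChartAt 𝓘(ℝ, E) x₀ with he
  have ho : IsOpen e.target := isOpen_extChartAt_target x₀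
  set ρ : E → N := fun q => f (e.symm q) with hρ
  have hρs : ContMDiffOn 𝓘(ℝ, E) 𝓘(ℝ, E') ∞ ρ e.target :=
    hf.comp_contMDiffOn (contMDiffOn_extChartAt_symm x₀)
  have hρd : ∀ q ∈ e.target, tderiv 𝓘(ℝ, E) 𝓘(ℝ, E') ρ q =
      (tderiv 𝓘(ℝ, E) 𝓘(ℝ, E') f (e.symm q)).comp (tderiv 𝓘(ℝ, E) 𝓘(ℝ, E) e.symm q) :=
    fun q hq => tderiv_comp (hf.mdifferentiableAt (by simp)) (mdifferentiableAt_extChartAt_symm hq)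
  have hB : ∀ q ∈ e.target,
      IsInnerForm (pullForm (formAt g (ρ q)) (tderiv 𝓘(ℝ, E) 𝓘(ℝ, E') ρ q)) := by
    intro q hq
    refine (isInnerForm_formAt g _).pullForm ?_
    rw [hρd q hq]
    exact (hinj _).comp (tderiv_extChartAt_symm_bijective hq).1
  have h := differentiableAt_dualNorm_sq (differentiableAt_pullForm g ho hρs hw)
    (by filter_upwards [ho.mem_nhds hw] with q hq using hB q hq) w.2
  refine h.congr_of_eventuallyEq ?_
  have : ∀ᶠ w' : E × (E →L[ℝ] ℝ) in 𝓝 w, w'.1 ∈ e.target :=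
    (continuous_fst.tendsto w).eventually (ho.mem_nhds hw)
  filter_upwards [this] with w' hw'
  congr 1
  symm
  -- The derivative of the inverse chart carries the form pulled back to the model space to the form
  -- on the tangent space, and the momentum to the covector with these coordinates.
  refine dualNorm_congr (tderiv 𝓘(ℝ, E) 𝓘(ℝ, E) e.symm w'.1)
    (tderiv_extChartAt_symm_bijective hw').2 (fun v => ?_) (fun v => ?_)
  · rw [hρd _ hw']
    rfl
  · rw [cotangentChartSymm_eq, covectorMk_fn]
    exact congrArg w'.2 (congrArg (fun L : E →L[ℝ] E => L v) (tderiv_extChartAt_comp_symm hw'))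

end NormChart

/-! ### Derivatives of maps into vector spaces and their products -/

section ProdSpace

variable {E : Type*} [NormedAddCommGroup E] [NormedSpace ℝ E]
  {H : Type*} [TopologicalSpace H] {I : ModelWithCorners ℝ E H}
  {M : Type*} [TopologicalSpace M] [ChartedSpace H M]
  {E' : Type*} [NormedAddCommGroup E'] [NormedSpace ℝ E']
  {E₃ : Type*} [NormedAddCommGroup E₃] [NormedSpace ℝ E₃]

theorem tderiv_clm (L : E →L[ℝ] E') (x : E) : tderiv 𝓘(ℝ, E) 𝓘(ℝ, E') L x = L :=
  L.hasMFDerivAt.mfderiv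

theorem tderiv_eq_fderiv (f : E → E') (x : E) : tderiv 𝓘(ℝ, E) 𝓘(ℝ, E') f x = fderiv ℝ f x :=
  mfderiv_eq_fderiv

theorem tderiv_prodMk_space {f : M → E'} {g : M → E₃} {x : M}
    (hf : MDifferentiableAt I 𝓘(ℝ, E') f x) (hg : MDifferentiableAt I 𝓘(ℝ, E₃) g x) :
    tderiv I 𝓘(ℝ, E' × E₃) (fun z => (f z, g z)) x =
      (tderiv I 𝓘(ℝ, E') f x).prod (tderiv I 𝓘(ℝ, E₃) g x) := by
  have h1 := tderiv_comp (I := I) (I' := 𝓘(ℝ, E' × E₃)) (I₃ := 𝓘(ℝ, E'))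
    (g := ContinuousLinearMap.fst ℝ E' E₃) (f := fun z => (f z, g z)) (x := x)
    (ContinuousLinearMap.hasMFDerivAt _).mdifferentiableAt (hf.prodMk_space hg)
  have h2 := tderiv_comp (I := I) (I' := 𝓘(ℝ, E' × E₃)) (I₃ := 𝓘(ℝ, E₃))
    (g := ContinuousLinearMap.snd ℝ E' E₃) (f := fun z => (f z, g z)) (x := x)
    (ContinuousLinearMap.hasMFDerivAt _).mdifferentiableAt (hf.prodMk_space hg)
  rw [tderiv_clm] at h1 h2
  refine ContinuousLinearMap.ext fun v => Prod.ext ?_ ?_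
  · exact (congrArg (fun L : E →L[ℝ] E' => L v) h1).symm
  · exact (congrArg (fun L : E →L[ℝ] E₃ => L v) h2).symm

end ProdSpace

/-! ### Conormal covectors and curves -/

section Conormal

variable {E : Type*} [NormedAddCommGroup E] [NormedSpace ℝ E]
  {H : Type*} [TopologicalSpace H] {I : ModelWithCorners ℝ E H}
  {M : Type*} [TopologicalSpace M] [ChartedSpace H M]

/-- Removes the equality in the tangent bundle from the definition: the base points are identified
once, and afterwards only functionals on the model space occur. -/
theorem mem_conormal_iff {L : M → Set M} {ξ : Cotangent I M} : ξ ∈ conormal I L ↔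
    ∀ c : ℝ → M, ContMDiff 𝓘(ℝ, ℝ) I ∞ c → (∀ t, c t ∈ L ξ.1) → c 0 = ξ.1 →
      ξ.fn (tderiv 𝓘(ℝ, ℝ) I c 0 1) = 0 := by
  constructor
  · intro h c hc hcL h0
    refine h (tderiv 𝓘(ℝ, ℝ) I c 0 1) ⟨c, hc, hcL, ?_⟩
    obtain ⟨x, f⟩ := ξ
    change c 0 = x at h0
    subst h0
    rfl
  · rintro h v ⟨c, hc, hcL, hv⟩
    have h0 : ξ.1 = c 0 := congrArg (fun u : TangentBundle I M => u.1) hv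
    have h1 : (v : E) = tderiv 𝓘(ℝ, ℝ) I c 0 1 :=
      congrArg (fun u : TangentBundle I M => (u.2 : E)) hv
    have h2 := h c hc hcL h0.symm
    rw [← h1] at h2
    exact h2

/-- A smooth map of the line into `(-ε, ε)` that fixes `0` with derivative `1`. -/
theorem exists_contDiff_mapsTo_ball {ε : ℝ} (hε : 0 < ε) : ∃ r : ℝ → ℝ, ContDiff ℝ ∞ r ∧ r 0 = 0 ∧
    (∀ t, r t ∈ Metric.ball (0 : ℝ) ε) ∧ fderiv ℝ r 0 1 = 1 := by
  -- The sine is globally defined and bounded; amplitude `ε / 2` and frequency `2 / ε` give slope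
  -- `1` at `0`.
  refine ⟨fun t => ε / 2 * Real.sin (2 / ε * t),
    contDiff_const.mul (Real.contDiff_sin.comp (contDiff_const.mul contDiff_id)), by simp,
    fun t => ?_, ?_⟩
  · rw [mem_ball_zero_iff, Real.norm_eq_abs, abs_mul, abs_of_pos (half_pos hε)]
    nlinarith [Real.abs_sin_le_one (2 / ε * t), abs_nonneg (Real.sin (2 / ε * t))]
  · have h1 : HasDerivAt (fun t : ℝ => 2 / ε * t) (2 / ε) 0 := by
      simpa using (hasDerivAt_id (0 : ℝ)).const_mul (2 / ε)
    rw [((h1.sin).const_mul (ε / 2)).hasFDerivAt.fderiv]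
    simp
    field_simp

/-- Conormal covectors vanish on velocities of curves that are defined near `0` only. -/
theorem conormal_apply_eq_zero {L : M → Set M} {ξ : Cotangent I M} (hξ : ξ ∈ conormal I L)
    {c : ℝ → M} {ε : ℝ} (hε : 0 < ε) (hc : ContMDiffOn 𝓘(ℝ, ℝ) I ∞ c (Metric.ball 0 ε))
    (hcL : ∀ t ∈ Metric.ball (0 : ℝ) ε, c t ∈ L ξ.1) (h0 : c 0 = ξ.1) :
    ξ.fn (tderiv 𝓘(ℝ, ℝ) I c 0 1) = 0 := by
  obtain ⟨r, hrs, hr0, hrb, hrd⟩ := exists_contDiff_mapsTo_ball hε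
  have h := mem_conormal_iff.1 hξ (fun t => c (r t))
    (hc.comp_contMDiff hrs.contMDiff hrb) (fun t => hcL _ (hrb t)) (by simp only [hr0, h0])
  have hcd : MDifferentiableAt 𝓘(ℝ, ℝ) I c (r 0) := by
    rw [hr0]
    exact (hc.contMDiffAt (Metric.ball_mem_nhds 0 hε)).mdifferentiableAt (by simp)
  rw [tderiv_comp hcd (hrs.contMDiff.mdifferentiableAt (by simp)), hr0, tderiv_eq_fderiv,
    ContinuousLinearMap.comp_apply, hrd] at h
  exact h

end Conormal

/-- Every tangent vector is the velocity of a smooth curve. -/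
theorem exists_contMDiff_curve {E : Type*} [NormedAddCommGroup E] [NormedSpace ℝ E]
    [FiniteDimensional ℝ E]
    {M : Type*} [TopologicalSpace M] [ChartedSpace E M] [IsManifold 𝓘(ℝ, E) ∞ M] (x : M) (v : E) :
    ∃ c : ℝ → M, ContMDiff 𝓘(ℝ, ℝ) 𝓘(ℝ, E) ∞ c ∧ c 0 = x ∧
      tderiv 𝓘(ℝ, ℝ) 𝓘(ℝ, E) c 0 1 = v := by
  set e := extChartAt 𝓘(ℝ, E) x with he
  have hxs : x ∈ e.source := mem_extChartAt_source _
  obtain ⟨u, rfl⟩ := (tderiv_extChartAt_symm_bijective (e.map_source hxs)).2 v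
  set ℓ : ℝ → E := fun t => e x + t • u with hℓ
  have hℓ0 : ℓ 0 = e x := by simp [hℓ]
  have hℓs : ContDiff ℝ ∞ ℓ := contDiff_const.add (contDiff_id.smul contDiff_const)
  have hopen : IsOpen (ℓ ⁻¹' e.target) := (isOpen_extChartAt_target _).preimage hℓs.continuous
  obtain ⟨ε, hε, hball⟩ := Metric.isOpen_iff.1 hopen 0
    (by rw [mem_preimage, hℓ0]; exact e.map_source hxs)
  -- The straight line in the chart stays in the chart only for small times, so it is reparametrised
  -- to be defined on all of `ℝ` with the same initial velocity.
  obtain ⟨r, hrs, hr0, hrb, hrd⟩ := exists_contDiff_mapsTo_ball hε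
  have hr0' : ℓ (r 0) = e x := by rw [hr0, hℓ0]
  have hℓr : ContMDiff 𝓘(ℝ, ℝ) 𝓘(ℝ, E) ∞ (fun t => ℓ (r t)) := (hℓs.comp hrs).contMDiff
  refine ⟨fun t => e.symm (ℓ (r t)),
    (contMDiffOn_extChartAt_symm x).comp_contMDiff hℓr fun t => hball (hrb t), ?_, ?_⟩
  · simp only [hr0']
    exact e.left_inv hxs
  · have hℓd : fderiv ℝ ℓ (r 0) 1 = u := by
      have := ((hasDerivAt_id (r 0)).smul_const u).const_add (e x)
      rw [one_smul] at this
      rw [HasFDerivAt.fderiv (f := ℓ) this.hasFDerivAt]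
      simp
    rw [tderiv_comp (g := e.symm) (f := fun t => ℓ (r t))
      (by rw [hr0']; exact mdifferentiableAt_extChartAt_symm (e.map_source hxs))
      (hℓr.mdifferentiableAt (by simp)), hr0',
      tderiv_comp (g := ℓ) (hℓs.contMDiff.mdifferentiableAt (by simp))
        (hrs.contMDiff.mdifferentiableAt (by simp)), tderiv_eq_fderiv, tderiv_eq_fderiv]
    simp only [ContinuousLinearMap.comp_apply, hrd, hℓd]
    rfl

/-! ### Tangent cones of images of maps of constant rank -/

section ConstantRank

open Filter

variable {E F : Type*} [NormedAddCommGroup E] [NormedSpace ℝ E] [FiniteDimensional ℝ E]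
  [NormedAddCommGroup F] [NormedSpace ℝ F] [FiniteDimensional ℝ F]

/-- A continuous linear retraction onto a subspace of a finite-dimensional space. -/
theorem exists_clm_retraction (T : Submodule ℝ F) : ∃ ρ : F →L[ℝ] T, ∀ v : T, ρ v = v := by
  obtain ⟨ρ, hρ⟩ := T.subtype.exists_leftInverse_of_injective T.ker_subtype
  exact ⟨LinearMap.toContinuousLinearMap ρ, fun v => congrArg (fun L : T →ₗ[ℝ] T => L v) hρ⟩

/-- Composition cannot raise the rank. This compares the ranks of the orbit map at different points
and in different charts. -/
theorem finrank_range_comp_comp_le {E' F' : Type*} [NormedAddCommGroup E'] [NormedSpace ℝ E']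
    [NormedAddCommGroup F'] [NormedSpace ℝ F'] (A : F →L[ℝ] F') (B : E →L[ℝ] F) (C : E' →L[ℝ] E) :
    Module.finrank ℝ (A.comp (B.comp C)).range ≤ Module.finrank ℝ B.range := by
  have h : (A.comp (B.comp C)).range ≤ B.range.map (A : F →ₗ[ℝ] F') := by
    rintro _ ⟨u, rfl⟩
    exact ⟨B (C u), ⟨C u, rfl⟩, rfl⟩
  exact (Submodule.finrank_mono h).trans (Submodule.finrank_map_le _ _)

/-- If `f` has constant rank near `x₀`, then every limit of difference quotients of `f` at `x₀`
lies in the image of the derivative. -/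
theorem mem_range_fderiv_of_tendsto {f : E → F} {x₀ : E} (hf : ContDiffAt ℝ 1 f x₀)
    (hrank : ∀ᶠ x in 𝓝 x₀, Module.finrank ℝ (fderiv ℝ f x).range ≤
      Module.finrank ℝ (fderiv ℝ f x₀).range)
    {ι : Type*} {l : Filter ι} [l.NeBot] {b : ι → E} {c : ι → ℝ} {w : F}
    (hb : Tendsto b l (𝓝 x₀))
    (hw : Tendsto (fun i => c i • (f (b i) - f x₀)) l (𝓝 w)) :
    w ∈ (fderiv ℝ f x₀).range := by
  set A := fderiv ℝ f x₀ with hA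
  obtain ⟨ρ, hρ⟩ := exists_clm_retraction A.range
  obtain ⟨Q, hQ⟩ := exists_clm_retraction A.ker
  have hfd : HasFDerivAt f A x₀ := (hf.differentiableAt (by simp)).hasFDerivAt
  -- Coordinates adapted to `f`: its derivative at `x₀` is bijective by rank–nullity, so the inverse
  -- function theorem applies. The first coordinate is `ρ ∘ f`, the second runs along the kernel.
  set Φ : E → A.range × A.ker := fun x => (ρ (f x), Q x) with hΦ
  set Φ' : E →L[ℝ] A.range × A.ker := (ρ.comp A).prod Q with hΦ'
  have hinj : Injective Φ' := by
    rw [injective_iff_map_eq_zero]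
    intro u hu
    have h1 : ρ (A u) = 0 := congrArg Prod.fst hu
    have h2 : Q u = 0 := congrArg Prod.snd hu
    have h3 : ρ (A u) = ⟨A u, u, rfl⟩ := hρ ⟨A u, u, rfl⟩
    have h4 : A u = 0 := congrArg Subtype.val (h3.symm.trans h1)
    have h5 : Q u = ⟨u, h4⟩ := hQ ⟨u, h4⟩
    exact congrArg Subtype.val (h5.symm.trans h2)
  have hdim : Module.finrank ℝ E = Module.finrank ℝ (A.range × A.ker) := by
    rw [Module.finrank_prod]
    exact (LinearMap.finrank_range_add_finrank_ker (A : E →ₗ[ℝ] F)).symm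
  set L : E ≃L[ℝ] A.range × A.ker :=
    (LinearEquiv.ofInjectiveOfFinrankEq (Φ' : E →ₗ[ℝ] A.range × A.ker) hinj
      hdim).toContinuousLinearEquiv with hL
  have hLc : (L : E →L[ℝ] A.range × A.ker) = Φ' := by
    ext1 u
    rfl
  have hΦs : ContDiffAt ℝ 1 Φ x₀ := (ρ.contDiff.contDiffAt.comp x₀ hf).prodMk Q.contDiff.contDiffAt
  have hΦd : HasFDerivAt Φ (L : E →L[ℝ] A.range × A.ker) x₀ := by
    rw [hLc]
    exact (ρ.hasFDerivAt.comp x₀ hfd).prodMk Q.hasFDerivAt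
  set h := hΦs.toOpenPartialHomeomorph Φ hΦd (by simp) with hh
  have hhc : ⇑h = Φ := hΦs.toOpenPartialHomeomorph_coe hΦd (by simp)
  have hx₀ : x₀ ∈ h.source := hΦs.mem_toOpenPartialHomeomorph_source hΦd (by simp)
  have hsymm : ContDiffAt ℝ 1 h.symm (Φ x₀) := hΦs.to_localInverse hΦd (by simp)
  have hleft : h.symm (Φ x₀) = x₀ := by rw [← hhc]; exact h.left_inv hx₀
  have htgt : Φ x₀ ∈ h.target := by rw [← hhc]; exact h.map_source hx₀
  -- the fibres of `ρ ∘ f` near `x₀` are contained in the fibres of `f`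
  have hev : ∀ᶠ z in 𝓝 (Φ x₀), z ∈ h.target ∧ DifferentiableAt ℝ h.symm z ∧
      DifferentiableAt ℝ f (h.symm z) ∧
      Module.finrank ℝ (fderiv ℝ f (h.symm z)).range ≤ Module.finrank ℝ A.range := by
    have h1 : ∀ᶠ z in 𝓝 (Φ x₀), DifferentiableAt ℝ h.symm z :=
      (hsymm.eventually (by simp)).mono fun z hz => hz.differentiableAt (by simp)
    have h2 : ∀ᶠ x in 𝓝 x₀, DifferentiableAt ℝ f x :=
      (hf.eventually (by simp)).mono fun z hz => hz.differentiableAt (by simp)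
    have h3 := (hsymm.continuousAt.tendsto.congr (fun _ => rfl)).eventually
      (by rw [hleft]; exact h2.and hrank)
    filter_upwards [h.open_target.mem_nhds htgt, h1, h3] with z k1 k2 k3
    exact ⟨k1, k2, k3.1, k3.2⟩
  obtain ⟨r, hr, hball⟩ := Metric.eventually_nhds_iff_ball.1 hev
  -- Here the rank bound enters. `ρ ∘ B` maps onto the range of `A`, so rank `B` at most rank `A`
  -- forces `B` and `ρ ∘ B` to have the same kernel; the second coordinate directions are killed by
  -- `ρ ∘ B`, hence by `B`.
  have hker : ∀ z ∈ Metric.ball (Φ x₀) r, ∀ k : A.ker,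
      fderiv ℝ f (h.symm z) (fderiv ℝ h.symm z (0, k)) = 0 := by
    intro z hz k
    obtain ⟨k1, k2, k3, k4⟩ := hball z hz
    set B := fderiv ℝ f (h.symm z) with hB
    have hid : ((ρ.comp B).prod Q).comp (fderiv ℝ h.symm z) = .id ℝ _ := by
      have e1 : HasFDerivAt (fun z => Φ (h.symm z)) (((ρ.comp B).prod Q).comp (fderiv ℝ h.symm z)) z :=
        ((ρ.hasFDerivAt.comp _ k3.hasFDerivAt).prodMk Q.hasFDerivAt).comp z k2.hasFDerivAt
      have e2 : HasFDerivAt (fun z => Φ (h.symm z)) (.id ℝ _) z := by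
        refine (hasFDerivAt_id z).congr_of_eventuallyEq ?_
        filter_upwards [h.open_target.mem_nhds k1] with z' hz'
        rw [← hhc]
        exact h.right_inv hz'
      exact e1.unique e2
    have hsurj : (ρ.comp B).range = ⊤ := by
      rw [LinearMap.range_eq_top]
      intro τ
      exact ⟨fderiv ℝ h.symm z (τ, 0), congrArg (fun M : _ →L[ℝ] _ => (M (τ, 0)).1) hid⟩
    have hle : B.ker ≤ (ρ.comp B).ker := by
      intro u hu
      have : B u = 0 := hu
      change ρ (B u) = 0
      rw [this, map_zero]
    have heq : B.ker = (ρ.comp B).ker := by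
      refine Submodule.eq_of_le_of_finrank_le hle ?_
      have n1 := LinearMap.finrank_range_add_finrank_ker (B : E →ₗ[ℝ] F)
      have n2 := LinearMap.finrank_range_add_finrank_ker ((ρ.comp B : E →L[ℝ] A.range) : E →ₗ[ℝ] A.range)
      have n3 : Module.finrank ℝ (ρ.comp B).range = Module.finrank ℝ A.range := by
        rw [hsurj, finrank_top]
      have n4 : Module.finrank ℝ B.range ≤ Module.finrank ℝ A.range := k4
      change Module.finrank ℝ (ρ.comp B).ker ≤ Module.finrank ℝ B.ker
      change Module.finrank ℝ B.range + Module.finrank ℝ B.ker = _ at n1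
      change Module.finrank ℝ (ρ.comp B).range + Module.finrank ℝ (ρ.comp B).ker = _ at n2
      omega
    have : fderiv ℝ h.symm z (0, k) ∈ (ρ.comp B).ker :=
      congrArg (fun M : A.range × A.ker →L[ℝ] A.range × A.ker => (M (0, k)).1) hid
    rw [← heq] at this
    exact this
  -- `f` is constant along the slices with fixed first coordinate, so near `x₀` it is a function of
  -- `ρ ∘ f` alone. The sup norm makes the ball a product of balls, so each slice is convex.
  have hconst : ∀ x, Φ x ∈ Metric.ball (Φ x₀) r → x ∈ h.source →
      f x = f (h.symm (ρ (f x), Q x₀)) := by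
    intro x hx hxs
    have hx' : (ρ (f x), Q x) ∈ Metric.ball (ρ (f x₀)) r ×ˢ Metric.ball (Q x₀) r := by
      rw [ball_prod_same]; exact hx
    have hmem : ∀ k ∈ Metric.ball (Q x₀) r, (ρ (f x), k) ∈ Metric.ball (Φ x₀) r := by
      intro k hk
      have : (ρ (f x), k) ∈ Metric.ball (ρ (f x₀)) r ×ˢ Metric.ball (Q x₀) r := ⟨hx'.1, hk⟩
      rwa [ball_prod_same] at this
    have hd : ∀ k ∈ Metric.ball (Q x₀) r,
        HasFDerivAt (fun k => f (h.symm (ρ (f x), k))) (0 : A.ker →L[ℝ] F) k := by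
      intro k hk
      obtain ⟨k1, k2, k3, -⟩ := hball _ (hmem k hk)
      have := k3.hasFDerivAt.comp k (k2.hasFDerivAt.comp k (hasFDerivAt_prodMk_right (ρ (f x)) k))
      convert! this using 1
      ext1 u
      exact (hker _ (hmem k hk) u).symm
    have h1 := Metric.isOpen_ball.is_const_of_fderiv_eq_zero
      (convex_ball (Q x₀) r).isPreconnected
      (fun k hk => (hd k hk).differentiableAt.differentiableWithinAt)
      (fun k hk => (hd k hk).fderiv) hx'.2 (Metric.mem_ball_self hr)
    have h2 : h.symm (ρ (f x), Q x) = x := by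
      have := h.left_inv hxs
      rwa [hhc] at this
    simp only [h2] at h1
    exact h1
  obtain ⟨-, d1, d2, -⟩ := hball _ (Metric.mem_ball_self hr)
  have hH : HasFDerivAt (fun τ => f (h.symm (τ, Q x₀))) ((fderiv ℝ f (h.symm (Φ x₀))).comp
      ((fderiv ℝ h.symm (Φ x₀)).comp (.inl ℝ _ _))) (ρ (f x₀)) :=
    d2.hasFDerivAt.comp (ρ (f x₀)) (HasFDerivAt.comp (ρ (f x₀)) (g := h.symm)
      (f := fun τ => (τ, Q x₀)) d1.hasFDerivAt (hasFDerivAt_prodMk_left (ρ (f x₀)) (Q x₀)))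
  have hρw : Tendsto (fun i => c i • (ρ (f (b i)) - ρ (f x₀))) l (𝓝 (ρ w)) := by
    have := (ρ.continuous.tendsto w).comp hw
    refine this.congr fun i => ?_
    simp
  have hρ0 : Tendsto (fun i => ρ (f (b i)) - ρ (f x₀)) l (𝓝 0) := by
    have := ((ρ.continuous.continuousAt.comp hf.continuousAt).tendsto.comp hb).sub_const (ρ (f x₀))
    simpa using this
  -- Write `f = H ∘ (ρ ∘ f)` near `x₀`. The quotients of `ρ ∘ f` tend to `ρ w`, so those of `f` tend
  -- to `H' (ρ w)`, which lies in the range of `A`. No rate of convergence of `b` is needed.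
  have hlim := HasFDerivWithinAt.lim (hasFDerivWithinAt_univ.2 hH) hρ0 (by simp) hρw
  have hbev : ∀ᶠ i in l, f (b i) = f (h.symm (ρ (f (b i)), Q x₀)) := by
    have h1 : ∀ᶠ x in 𝓝 x₀, Φ x ∈ Metric.ball (Φ x₀) r :=
      hΦs.continuousAt.eventually (Metric.ball_mem_nhds _ hr)
    filter_upwards [hb.eventually h1, hb.eventually (h.open_source.mem_nhds hx₀)] with i h1 h2
    exact hconst _ h1 h2
  have hx₀' : h.symm (ρ (f x₀), Q x₀) = x₀ := hleft
  have heq := tendsto_nhds_unique (hlim.congr' (f₂ := fun i => c i • (f (b i) - f x₀)) (by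
    filter_upwards [hbev] with i hi
    simp only [add_sub_cancel]
    rw [← hi, hx₀'])) hw
  rw [← heq]
  refine ⟨fderiv ℝ h.symm (Φ x₀) (ρ w, 0), ?_⟩
  change fderiv ℝ f x₀ _ = fderiv ℝ f (h.symm (Φ x₀)) _
  rw [hleft]
  rfl

/-- If `P x₀ = id` near `q₀` and if `P (b t)` moves the curve `z` to the curve `k`, both starting at
`q₀`, with `b t` tending to `x₀`, then the difference quotients of `P (b t) q₀` converge to the
difference of the velocities. -/
theorem tendsto_smul_sub_of_hasStrictFDerivAt {P : E × F → F} {P' : E × F →L[ℝ] F} {x₀ : E} {q₀ : F}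
    (hP : HasStrictFDerivAt P P' (x₀, q₀)) (hid : ∀ᶠ q in 𝓝 q₀, P (x₀, q) = q)
    {l : Filter ℝ} (hl : l ≤ 𝓝[≠] 0) {b : ℝ → E} (hb : Tendsto b l (𝓝 x₀)) {z k : ℝ → F} {w u : F}
    (hz : HasDerivAt z w 0) (hz0 : z 0 = q₀) (hk : HasDerivAt k u 0) (hk0 : k 0 = q₀)
    (hbz : ∀ᶠ t in l, P (b t, z t) = k t) :
    Tendsto (fun t => t⁻¹ • (P (b t, q₀) - P (x₀, q₀))) l (𝓝 (u - w)) := by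
  -- The partial derivative in the second variable is the identity because `P (x₀, ·)` is the
  -- identity near `q₀`.
  have hPr : ∀ r, P' (0, r) = r := by
    intro r
    have h1 : HasFDerivAt (fun q => P (x₀, q)) (P'.comp (.inr ℝ E F)) q₀ :=
      hP.hasFDerivAt.comp q₀ (hasFDerivAt_prodMk_right x₀ q₀)
    have h2 : HasFDerivAt (fun q => P (x₀, q)) (.id ℝ F) q₀ :=
      (hasFDerivAt_id q₀).congr_of_eventuallyEq hid
    exact congrArg (fun M : F →L[ℝ] F => M r) (h1.unique h2)
  have slope : ∀ {c : ℝ → F} {v : F}, HasDerivAt c v 0 → c 0 = q₀ →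
      Tendsto (fun t => t⁻¹ • (c t - q₀)) l (𝓝 v) := by
    intro c v hc hc0
    have := (hasDerivAt_iff_tendsto_slope.1 hc).mono_left hl
    refine this.congr fun t => ?_
    rw [slope_def_module, sub_zero, hc0]
  have hzc : Tendsto z l (𝓝 q₀) := by
    have := hz.continuousAt.tendsto.mono_left (hl.trans nhdsWithin_le_nhds)
    rwa [hz0] at this
  have hpair : Tendsto (fun t => ((b t, z t), (b t, q₀))) l (𝓝 ((x₀, q₀), (x₀, q₀))) :=
    (hb.prodMk_nhds hzc).prodMk_nhds (hb.prodMk_nhds tendsto_const_nhds)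
  -- Strict differentiability compares `P` at two moving points with the same first entry `b t`. The
  -- unknown increment of `b` cancels, and the error is controlled by the increment of `z`, which is
  -- `O(t)`.
  have hlo := hP.isLittleO.comp_tendsto hpair
  have hO : (fun t => z t - q₀) =O[l] fun t : ℝ => t := by
    have := hz.differentiableAt.isBigO_sub.mono (hl.trans nhdsWithin_le_nhds)
    simpa [hz0] using this
  have hlo' : (fun t => P (b t, z t) - P (b t, q₀) - (z t - q₀)) =o[l] fun t : ℝ => t := by
    have hO' : ((fun p : (E × F) × (E × F) => p.1 - p.2) ∘ fun t => ((b t, z t), (b t, q₀)))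
        =O[l] fun t : ℝ => t := by
      refine (Asymptotics.IsBigO.of_bound 1 ?_).trans hO
      filter_upwards with t
      simp [Prod.norm_def]
    refine (hlo.trans_isBigO hO').congr_left fun t => ?_
    have e : P' ((b t, z t) - (b t, q₀)) = z t - q₀ := by
      rw [Prod.mk_sub_mk, sub_self, hPr]
    simp only [Function.comp_apply, e]
  have h0 := hlo'.tendsto_inv_smul_nhds_zero
  -- `P (b t, q₀) - q₀` is the increment of `k` minus that of `z`, up to `o(t)`.
  have h1 := ((slope hk hk0).sub (slope hz hz0)).sub h0
  rw [sub_zero] at h1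
  refine h1.congr' ?_
  filter_upwards [hbz] with t ht
  rw [ht, hid.self_of_nhds, ← smul_sub, ← smul_sub]
  congr 1
  abel

end ConstantRank

/-! ### The suspension: local sections of `σ` and changes of sheet -/

namespace SuspensionData

variable {EX EG EY X Xt G Y : Type*}
  [NormedAddCommGroup EX] [NormedSpace ℝ EX] [FiniteDimensional ℝ EX]
  [NormedAddCommGroup EG] [NormedSpace ℝ EG] [FiniteDimensional ℝ EG]
  [NormedAddCommGroup EY] [NormedSpace ℝ EY] [FiniteDimensional ℝ EY]
  [TopologicalSpace X] [ChartedSpace EX X] [IsManifold 𝓘(ℝ, EX) ∞ X]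
  [TopologicalSpace Xt] [ChartedSpace EX Xt] [IsManifold 𝓘(ℝ, EX) ∞ Xt]
  [SimplyConnectedSpace Xt]
  [TopologicalSpace G] [ChartedSpace EG G] [Group G]
  [TopologicalSpace Y] [ChartedSpace EY Y] [IsManifold 𝓘(ℝ, EY) ∞ Y] [MulAction G Y]
  (D : SuspensionData (EX := EX) (EG := EG) (EY := EY) X Xt G Y)

/-- The model of `Xt × Y` and of the suspension. -/
local notation "IS" => ModelWithCorners.prod 𝓘(ℝ, EX) 𝓘(ℝ, EY)

theorem σ_act (d : deckGroup D.p) (q : Xt × Y) : D.σ (D.act d q) = D.σ q :=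
  (D.σ_eq_iff.2 ⟨d, rfl⟩).symm

/-- The local inverse of `σ` at `q`. -/
abbrev loc (q : Xt × Y) : OpenPartialHomeomorph D.S (Xt × Y) :=
  D.isLocalHomeomorph_σ.localInverseAt q

theorem loc_symm (q : Xt × Y) : ⇑(D.loc q).symm = D.σ := D.isLocalHomeomorph_σ.localInverseAt_symm q

theorem σ_loc {q : Xt × Y} {s : D.S} (hs : s ∈ (D.loc q).source) : D.σ (D.loc q s) = s :=
  D.isLocalHomeomorph_σ.apply_localInverseAt_of_mem hs

theorem loc_σ {q w : Xt × Y} (hw : w ∈ (D.loc q).target) : D.loc q (D.σ w) = w := by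
  have := (D.loc q).right_inv hw
  rwa [D.loc_symm] at this

theorem σ_mem_source {q w : Xt × Y} (hw : w ∈ (D.loc q).target) : D.σ w ∈ (D.loc q).source := by
  have := (D.loc q).map_target hw
  rwa [D.loc_symm] at this

theorem self_mem_target (q : Xt × Y) : q ∈ (D.loc q).target :=
  D.isLocalHomeomorph_σ.self_mem_localInverseAt_target

/-- By continuity the translate by `d` stays in the target sheet, where the local section inverts
`σ`. So one fixed `d` describes the change of sheet on a whole neighbourhood. -/
theorem eventually_loc_σ {q w₀ : Xt × Y} {d : deckGroup D.p} (h : D.act d w₀ ∈ (D.loc q).target) :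
    ∀ᶠ w in 𝓝 w₀, D.loc q (D.σ w) = D.act d w := by
  filter_upwards [(D.continuous_act d).continuousAt.eventually ((D.loc q).open_target.mem_nhds h)]
    with w hw
  rw [← D.σ_act d w, D.loc_σ hw]

theorem exists_act_eq_rep (w : Xt × Y) : ∃ d, D.act d w = D.rep (D.σ w) :=
  D.σ_eq_iff.1 (D.σ_rep (D.σ w)).symm

/-! ### Charts of the suspension -/

theorem extChartAt_S (s s' : D.S) : extChartAt IS s s' =
    (extChartAt 𝓘(ℝ, EX) (D.rep s).1 (D.loc (D.rep s) s').1,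
      extChartAt 𝓘(ℝ, EY) (D.rep s).2 (D.loc (D.rep s) s').2) := rfl

theorem extChartAt_S_symm (s : D.S) (q : EX × EY) : (extChartAt IS s).symm q =
    D.σ ((extChartAt 𝓘(ℝ, EX) (D.rep s).1).symm q.1,
      (extChartAt 𝓘(ℝ, EY) (D.rep s).2).symm q.2) := by
  rw [← D.loc_symm (D.rep s)]
  rfl

theorem mem_extChartAt_S_source {s s' : D.S} : s' ∈ (extChartAt IS s).source ↔
    s' ∈ (D.loc (D.rep s)).source ∧
      (D.loc (D.rep s) s').1 ∈ (extChartAt 𝓘(ℝ, EX) (D.rep s).1).source ∧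
      (D.loc (D.rep s) s').2 ∈ (extChartAt 𝓘(ℝ, EY) (D.rep s).2).source := by
  simp only [extChartAt_source]
  rfl

theorem mem_extChartAt_S_target {s : D.S} {q : EX × EY} (hq : q ∈ (extChartAt IS s).target) :
    q.1 ∈ (extChartAt 𝓘(ℝ, EX) (D.rep s).1).target ∧
      q.2 ∈ (extChartAt 𝓘(ℝ, EY) (D.rep s).2).target := by
  have h1 := (extChartAt IS s).map_target hq
  have h2 := (extChartAt IS s).right_inv hq
  rw [D.extChartAt_S] at h2
  rw [D.mem_extChartAt_S_source] at h1
  rw [← h2]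
  exact ⟨(extChartAt 𝓘(ℝ, EX) (D.rep s).1).map_source h1.2.1,
    (extChartAt 𝓘(ℝ, EY) (D.rep s).2).map_source h1.2.2⟩

/-- The chart at `σ w` is built on the representative of `σ w`, which is a deck translate of `w`; in
that chart `σ` is the diagonal action followed by the product chart. -/
theorem contMDiff_σ : ContMDiff IS IS ∞ D.σ := by
  intro w
  rw [contMDiffAt_iff_target]
  refine ⟨D.continuous_σ.continuousAt, ?_⟩
  obtain ⟨d, hd⟩ := D.exists_act_eq_rep w
  have hev := D.eventually_loc_σ (q := D.rep (D.σ w)) (w₀ := w) (d := d)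
    (by rw [hd]; exact D.self_mem_target _)
  have h1 : ContMDiffAt IS 𝓘(ℝ, EX × EY) ∞ (extChartAt IS (D.rep (D.σ w))) (D.act d w) := by
    rw [hd]; exact contMDiffAt_extChartAt
  refine (h1.comp w (D.contMDiff_act d w)).congr_of_eventuallyEq ?_
  filter_upwards [hev] with u hu
  change _ = extChartAt IS (D.rep (D.σ w)) (D.act d u)
  rw [← hu]
  rfl

/-- The sheet of `q` differs near `s` from the sheet used by the atlas by one deck transformation,
which acts smoothly. -/
theorem contMDiffOn_loc (q : Xt × Y) : ContMDiffOn IS IS ∞ (D.loc q) (D.loc q).source := by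
  intro s hs
  apply ContMDiffAt.contMDiffWithinAt
  have h0 : D.σ (D.rep s) = D.σ (D.loc q s) := by rw [D.σ_rep, D.σ_loc hs]
  obtain ⟨d, hd⟩ := D.σ_eq_iff.1 h0
  have hev := D.eventually_loc_σ (q := q) (w₀ := D.rep s) (d := d)
    (by rw [hd]; exact (D.loc q).map_source hs)
  have h1 : ContMDiffAt IS 𝓘(ℝ, EX × EY) ∞ (extChartAt IS s) s := contMDiffAt_extChartAt
  have hq : extChartAt IS s s = extChartAt IS (D.rep s) (D.rep s) := by
    rw [D.extChartAt_S]
    have : D.loc (D.rep s) s = D.rep s := by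
      conv_lhs => rw [← D.σ_rep s]
      rw [D.loc_σ (by rw [D.σ_rep]; exact D.self_mem_target _)]
    rw [this]
    rfl
  have h2 : ContMDiffAt 𝓘(ℝ, EX × EY) IS ∞ (extChartAt IS (D.rep s)).symm (extChartAt IS s s) := by
    rw [hq]
    exact (contMDiffOn_extChartAt_symm (D.rep s)).contMDiffAt (extChartAt_target_mem_nhds _)
  have h3 : ContMDiffAt IS IS ∞
      (fun s' => (extChartAt IS (D.rep s)).symm (extChartAt IS s s')) s := h2.comp s h1
  have h3v : (extChartAt IS (D.rep s)).symm (extChartAt IS s s) = D.rep s := by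
    rw [hq]; exact extChartAt_to_inv _
  have h4 : ContMDiffAt IS IS ∞
      (fun s' => D.act d ((extChartAt IS (D.rep s)).symm (extChartAt IS s s'))) s :=
    (D.contMDiff_act d _).comp s h3
  refine h4.congr_of_eventuallyEq ?_
  rw [← h3v] at hev
  have h5 := h3.continuousAt.eventually hev
  filter_upwards [h5, extChartAt_source_mem_nhds (I := IS) s] with s' hs' hs''
  rw [← hs']
  congr 1
  have := (extChartAt IS s).left_inv hs''
  rw [D.extChartAt_S_symm] at this
  exact this.symm

/-! ### The derivative of `σ` -/

theorem mdifferentiableAt_σ (q : Xt × Y) : MDifferentiableAt IS IS D.σ q :=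
  D.contMDiff_σ.mdifferentiableAt (by simp)

theorem mdifferentiableAt_loc {q : Xt × Y} {s : D.S} (hs : s ∈ (D.loc q).source) :
    MDifferentiableAt IS IS (D.loc q) s :=
  ((D.contMDiffOn_loc q).contMDiffAt ((D.loc q).open_source.mem_nhds hs)).mdifferentiableAt (by simp)

/-- The derivative of `σ`. -/
def dσ (q : Xt × Y) : EX × EY →L[ℝ] EX × EY := tderiv IS IS D.σ q

/-- The inverse of the derivative of `σ`. -/
def dσInv (q : Xt × Y) : EX × EY →L[ℝ] EX × EY := tderiv IS IS (D.loc q) (D.σ q)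

theorem tderiv_loc_comp_dσ {q w : Xt × Y} (hw : w ∈ (D.loc q).target) :
    (tderiv IS IS (D.loc q) (D.σ w)).comp (D.dσ w) = .id ℝ (EX × EY) :=
  tderiv_comp_eq_id (D.mdifferentiableAt_loc (D.σ_mem_source hw)) (D.mdifferentiableAt_σ w) (by
    filter_upwards [(D.loc q).open_target.mem_nhds hw] with z hz using D.loc_σ hz)

theorem dσ_comp_tderiv_loc {q w : Xt × Y} (hw : w ∈ (D.loc q).target) :
    (D.dσ w).comp (tderiv IS IS (D.loc q) (D.σ w)) = .id ℝ (EX × EY) := by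
  have h := tderiv_comp_eq_id (I := IS) (I' := IS) (g := D.σ) (f := D.loc q) (x := D.σ w)
    (D.mdifferentiableAt_σ _) (D.mdifferentiableAt_loc (D.σ_mem_source hw)) (by
      filter_upwards [(D.loc q).open_source.mem_nhds (D.σ_mem_source hw)] with z hz using D.σ_loc hz)
  rwa [D.loc_σ hw] at h

theorem dσInv_dσ (q : Xt × Y) (v : EX × EY) : D.dσInv q (D.dσ q v) = v :=
  congrArg (fun L : EX × EY →L[ℝ] EX × EY => L v) (D.tderiv_loc_comp_dσ (D.self_mem_target q))

theorem dσ_dσInv (q : Xt × Y) (v : EX × EY) : D.dσ q (D.dσInv q v) = v :=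
  congrArg (fun L : EX × EY →L[ℝ] EX × EY => L v) (D.dσ_comp_tderiv_loc (D.self_mem_target q))

theorem dσ_surjective (q : Xt × Y) : Surjective (D.dσ q) := fun v => ⟨_, D.dσ_dσInv q v⟩

/-- Connects the abstract inverse in the definition of `metric` with the derivative of a local
section. -/
theorem inverse_mfderiv_σ (q : Xt × Y) (v : EX × EY) :
    ((mfderiv IS IS D.σ q).inverse : EX × EY →L[ℝ] EX × EY) v = D.dσInv q v := by
  have h1 : (D.dσ q).comp (D.dσInv q) = .id ℝ (EX × EY) :=
    D.dσ_comp_tderiv_loc (D.self_mem_target q)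
  have h2 : (D.dσInv q).comp (D.dσ q) = .id ℝ (EX × EY) :=
    D.tderiv_loc_comp_dσ (D.self_mem_target q)
  have h : (D.dσ q).inverse = D.dσInv q := ContinuousLinearMap.inverse_eq h1 h2
  exact congrArg (fun L : EX × EY →L[ℝ] EX × EY => L v) h

/-! ### Derivatives of the diagonal action -/

theorem mdifferentiableAt_deck (d : deckGroup D.p) (x : Xt) :
    MDifferentiableAt 𝓘(ℝ, EX) 𝓘(ℝ, EX) d.1 x := (D.contMDiff_deck d).mdifferentiableAt (by simp)

include D in
theorem contMDiff_smul (a : G) : ContMDiff 𝓘(ℝ, EY) 𝓘(ℝ, EY) ∞ (fun y : Y => a • y) :=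
  D.smooth_smul.comp (contMDiff_const.prodMk contMDiff_id)

include D in
theorem mdifferentiableAt_smul (a : G) (y : Y) :
    MDifferentiableAt 𝓘(ℝ, EY) 𝓘(ℝ, EY) (fun y : Y => a • y) y :=
  (D.contMDiff_smul a).mdifferentiableAt (by simp)

/-- The derivative of the action of `a`. -/
def dL (a : G) (y : Y) : EY →L[ℝ] EY := tderiv 𝓘(ℝ, EY) 𝓘(ℝ, EY) (fun y : Y => a • y) y

include D in
theorem dL_mul (a b : G) (y : Y) :
    (dL (EY := EY) a (b • y)).comp (dL b y) = dL (a * b) y := by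
  unfold dL
  rw [← tderiv_comp (f := fun y : Y => b • y) (D.mdifferentiableAt_smul a _)
    (D.mdifferentiableAt_smul b y)]
  simp only [mul_smul]

theorem dL_one (y : Y) : dL (EY := EY) (1 : G) y = .id ℝ EY := by
  unfold dL
  simp only [one_smul]
  exact tderiv_id y

include D in
theorem dL_inv_dL (a : G) (y : Y) (v : EY) : dL a⁻¹ (a • y) (dL a y v) = v := by
  have := D.dL_mul a⁻¹ a y
  rw [inv_mul_cancel, dL_one] at this
  exact congrArg (fun L : EY →L[ℝ] EY => L v) this

include D in
theorem dL_dL_inv (a : G) (y : Y) (v : EY) : dL a y (dL a⁻¹ (a • y) v) = v := by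
  have := D.dL_mul a a⁻¹ (a • y)
  rw [mul_inv_cancel, dL_one, inv_smul_smul] at this
  exact congrArg (fun L : EY →L[ℝ] EY => L v) this

/-- The derivative of a deck transformation. -/
def dDeck (d : deckGroup D.p) (x : Xt) : EX →L[ℝ] EX := tderiv 𝓘(ℝ, EX) 𝓘(ℝ, EX) d.1 x

theorem dDeck_inv_dDeck (d : deckGroup D.p) (x : Xt) (v : EX) :
    D.dDeck d⁻¹ (d.1 x) (D.dDeck d x v) = v := by
  have h := tderiv_comp_eq_id (I := 𝓘(ℝ, EX)) (I' := 𝓘(ℝ, EX)) (g := d⁻¹.1) (f := d.1) (x := x)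
    (D.mdifferentiableAt_deck _ _) (D.mdifferentiableAt_deck _ _)
    (.of_forall fun z => d.1.symm_apply_apply z)
  exact congrArg (fun L : EX →L[ℝ] EX => L v) h

theorem dDeck_dDeck_inv (d : deckGroup D.p) (x : Xt) (v : EX) :
    D.dDeck d x (D.dDeck d⁻¹ (d.1 x) v) = v := by
  have h := D.dDeck_inv_dDeck d⁻¹ (d.1 x) v
  have e : d⁻¹.1 (d.1 x) = x := d.1.symm_apply_apply x
  rwa [inv_inv, e] at h

theorem tderiv_act (d : deckGroup D.p) (q : Xt × Y) :
    tderiv IS IS (D.act d) q = (D.dDeck d q.1).prodMap (dL (D.φ d) q.2) :=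
  tderiv_prodMap (D.mdifferentiableAt_deck d q.1) (D.mdifferentiableAt_smul _ q.2)

/-- Chain rule for `σ ∘ act d = σ`; it governs how pulled back covectors change with the sheet. -/
theorem dσ_act (d : deckGroup D.p) (q : Xt × Y) (v : EX × EY) :
    D.dσ (D.act d q) (D.dDeck d q.1 v.1, dL (D.φ d) q.2 v.2) = D.dσ q v := by
  have h1 := tderiv_comp (I := IS) (I' := IS) (I₃ := IS) (g := D.σ) (f := D.act d) (x := q)
    (D.mdifferentiableAt_σ _) ((D.contMDiff_act d).mdifferentiableAt (by simp))
  simp only [D.σ_act] at h1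
  rw [D.tderiv_act] at h1
  exact (congrArg (fun L : EX × EY →L[ℝ] EX × EY => L v) h1).symm

/-! ### Metrics -/

/-- The induced metric on `Xt`. -/
def formX (x : Xt) : EX →L[ℝ] EX →L[ℝ] ℝ :=
  pullForm (formAt D.gX (D.p x)) (tderiv 𝓘(ℝ, EX) 𝓘(ℝ, EX) D.p x)

/-- The metric on `Y`. -/
def formY (y : Y) : EY →L[ℝ] EY →L[ℝ] ℝ := formAt D.gY y

theorem mdifferentiableAt_p (x : Xt) : MDifferentiableAt 𝓘(ℝ, EX) 𝓘(ℝ, EX) D.p x :=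
  (D.isLocalDiffeomorph x).contMDiffAt.mdifferentiableAt (by simp)

theorem tderiv_p_bijective (x : Xt) : Bijective (tderiv 𝓘(ℝ, EX) 𝓘(ℝ, EX) D.p x) :=
  ((D.isLocalDiffeomorph x).mfderivToContinuousLinearEquiv (by simp)).bijective

theorem isInnerForm_formX (x : Xt) : IsInnerForm (D.formX x) :=
  (isInnerForm_formAt D.gX _).pullForm (D.tderiv_p_bijective x).1

theorem isInnerForm_formY (y : Y) : IsInnerForm (D.formY y) := isInnerForm_formAt D.gY y

theorem formX_deck (d : deckGroup D.p) (x : Xt) (v w : EX) :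
    D.formX (d.1 x) (D.dDeck d x v) (D.dDeck d x w) = D.formX x v w := by
  have h := tderiv_comp (I := 𝓘(ℝ, EX)) (I' := 𝓘(ℝ, EX)) (I₃ := 𝓘(ℝ, EX)) (g := D.p) (f := d.1)
    (x := x) (D.mdifferentiableAt_p _) (D.mdifferentiableAt_deck _ _)
  have e : (fun z => D.p (d.1 z)) = D.p := funext d.2
  rw [e] at h
  unfold formX
  simp only [pullForm_apply]
  rw [h, d.2 x]
  rfl

theorem formY_smul (a : G) (y : Y) (v w : EY) :
    D.formY (a • y) (dL a y v) (dL a y w) = D.formY y v w := D.isometric a y v w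

/-- `σ` is a local isometry. -/
theorem metric_dσ (q : Xt × Y) (v w : EX × EY) :
    D.metric (D.σ q) (D.dσ q v) (D.dσ q w) = D.formX q.1 v.1 w.1 + D.formY q.2 v.2 w.2 := by
  have key : ∀ v w : EX × EY, D.metric (D.σ q) v w =
      D.formX (D.rep (D.σ q)).1 (D.dσInv (D.rep (D.σ q)) v).1 (D.dσInv (D.rep (D.σ q)) w).1 +
      D.formY (D.rep (D.σ q)).2 (D.dσInv (D.rep (D.σ q)) v).2 (D.dσInv (D.rep (D.σ q)) w).2 := by
    intro v w
    rw [← D.inverse_mfderiv_σ, ← D.inverse_mfderiv_σ]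
    rfl
  rw [key]
  -- The metric is defined through the chosen representative. Passing from `q` to it is the diagonal
  -- action of `d`, an isometry of both factors.
  obtain ⟨d, hd⟩ := D.exists_act_eq_rep q
  rw [← hd, ← D.dσ_act d q v, ← D.dσ_act d q w, D.dσInv_dσ, D.dσInv_dσ]
  exact congrArg₂ _ (D.formX_deck d q.1 v.1 w.1) (D.formY_smul (D.φ d) q.2 v.2 w.2)

/-- The length of a covector of the suspension. -/
theorem covectorNorm_S {ζ : Cotangent IS D.S} {q : Xt × Y} (h : ζ.1 = D.σ q) :
    covectorNorm IS D.metric ζ =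
      √(dualNorm (fun v => D.formX q.1 v v) ((ζ.fn.comp (D.dσ q)).comp (.inl ℝ EX EY)) ^ 2 +
        dualNorm (fun v => D.formY q.2 v v) ((ζ.fn.comp (D.dσ q)).comp (.inr ℝ EX EY)) ^ 2) := by
  rw [← (D.isInnerForm_formX q.1).prod (D.isInnerForm_formY q.2)]
  symm
  have e : covectorNorm IS D.metric ζ =
      dualNorm (fun v : EX × EY => D.metric ζ.1 v v) ζ.fn := rfl
  rw [e, h]
  exact dualNorm_congr (D.dσ q) (D.dσ_surjective q) (fun v => D.metric_dσ q v v) fun v => rfl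

theorem covectorNorm_Y (ξ : Cotangent 𝓘(ℝ, EY) Y) :
    covectorNorm 𝓘(ℝ, EY) (fun y v w => D.gY.inner y v w) ξ =
      dualNorm (fun v => D.formY ξ.1 v v) ξ.fn := rfl

/-! ### The Hamiltonian of the suspension in canonical coordinates -/

/-- The squared length of covectors of `Xt` in canonical coordinates. -/
def normSqX (x₀ : Xt) (w : EX × (EX →L[ℝ] ℝ)) : ℝ :=
  dualNorm (fun v => D.formX ((extChartAt 𝓘(ℝ, EX) x₀).symm w.1) v v)
    (cotangentChartSymm 𝓘(ℝ, EX) x₀ w.1 w.2).fn ^ 2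

/-- The squared length of covectors of `Y` in canonical coordinates. -/
def normSqY (y₀ : Y) (w : EY × (EY →L[ℝ] ℝ)) : ℝ :=
  dualNorm (fun v => D.formY ((extChartAt 𝓘(ℝ, EY) y₀).symm w.1) v v)
    (cotangentChartSymm 𝓘(ℝ, EY) y₀ w.1 w.2).fn ^ 2

theorem differentiableAt_normSqX (x₀ : Xt) {w : EX × (EX →L[ℝ] ℝ)}
    (hw : w.1 ∈ (extChartAt 𝓘(ℝ, EX) x₀).target) : DifferentiableAt ℝ (D.normSqX x₀) w :=
  differentiableAt_dualNorm_chart D.gX D.isLocalDiffeomorph.contMDiff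
    (fun x => (D.tderiv_p_bijective x).1) x₀ hw

theorem differentiableAt_normSqY (y₀ : Y) {w : EY × (EY →L[ℝ] ℝ)}
    (hw : w.1 ∈ (extChartAt 𝓘(ℝ, EY) y₀).target) : DifferentiableAt ℝ (D.normSqY y₀) w := by
  have h := differentiableAt_dualNorm_chart D.gY (f := fun y : Y => y) contMDiff_id
    (fun y => by rw [tderiv_id]; exact injective_id) y₀ hw
  simp only [tderiv_id] at h
  exact h

theorem sqrt_normSqY (y₀ : Y) (w : EY × (EY →L[ℝ] ℝ)) : √(D.normSqY y₀ w) =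
    covectorNorm 𝓘(ℝ, EY) (fun y v w => D.gY.inner y v w)
      (cotangentChartSymm 𝓘(ℝ, EY) y₀ w.1 w.2) :=
  Real.sqrt_sq ((D.isInnerForm_formY _).dualNorm_nonneg _)

theorem normSqY_ne_zero {y₀ : Y} {ξ : Cotangent 𝓘(ℝ, EY) Y}
    (h : ξ.1 ∈ (extChartAt 𝓘(ℝ, EY) y₀).source) (h0 : ξ.fn ≠ 0) :
    D.normSqY y₀ (cotangentChart 𝓘(ℝ, EY) y₀ ξ) ≠ 0 := by
  unfold normSqY
  rw [cotangentChartSymm_cotangentChart h]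
  exact pow_ne_zero 2 fun h1 => h0 ((D.isInnerForm_formY _).dualNorm_eq_zero_iff.1 h1)

/-- The component along `Xt` of the pullback of a covector of the suspension to `Xt × Y`. -/
def partX (ζ : Cotangent IS D.S) (w : Xt × Y) : Cotangent 𝓘(ℝ, EX) Xt :=
  covectorMk _ w.1 ((ζ.fn.comp (D.dσ w)).comp (.inl ℝ EX EY))

/-- The component along `Y` of the pullback of a covector of the suspension to `Xt × Y`. -/
def partY (ζ : Cotangent IS D.S) (w : Xt × Y) : Cotangent 𝓘(ℝ, EY) Y :=
  covectorMk _ w.2 ((ζ.fn.comp (D.dσ w)).comp (.inr ℝ EX EY))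

theorem partX_fn (ζ : Cotangent IS D.S) (w : Xt × Y) (v : EX) :
    (D.partX ζ w).fn v = ζ.fn (D.dσ w (v, 0)) := rfl

theorem partY_fn (ζ : Cotangent IS D.S) (w : Xt × Y) (v : EY) :
    (D.partY ζ w).fn v = ζ.fn (D.dσ w (0, v)) := rfl

theorem partX_add_partY (ζ : Cotangent IS D.S) (w : Xt × Y) (v : EX × EY) :
    (D.partX ζ w).fn v.1 + (D.partY ζ w).fn v.2 = ζ.fn (D.dσ w v) := by
  rw [partX_fn, partY_fn, ← map_add, ← map_add]
  simp

theorem fn_eq_zero {ζ : Cotangent IS D.S} {w : Xt × Y} (hX : (D.partX ζ w).fn = 0)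
    (hY : (D.partY ζ w).fn = 0) : ζ.fn = 0 := by
  refine ContinuousLinearMap.ext fun v => ?_
  obtain ⟨u, rfl⟩ := D.dσ_surjective w v
  rw [← partX_add_partY, hX, hY]
  simp

theorem symm_mem_loc_target {s : D.S} {q : EX × EY} (hq : q ∈ (extChartAt IS s).target) :
    ((extChartAt 𝓘(ℝ, EX) (D.rep s).1).symm q.1, (extChartAt 𝓘(ℝ, EY) (D.rep s).2).symm q.2) ∈
      (D.loc (D.rep s)).target := by
  have h1 := (extChartAt IS s).map_target hq
  have h2 := (extChartAt IS s).right_inv hq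
  rw [D.extChartAt_S] at h2
  rw [D.mem_extChartAt_S_source] at h1
  have h3 := (D.loc (D.rep s)).map_source h1.1
  rw [← h2]
  simp only
  rw [(extChartAt 𝓘(ℝ, EX) (D.rep s).1).left_inv h1.2.1,
    (extChartAt 𝓘(ℝ, EY) (D.rep s).2).left_inv h1.2.2]
  exact h3

/-- On the sheet that defines the chart, the chart composed with `σ` is the product chart, so its
derivative is block diagonal. -/
theorem tderiv_extChartAt_S {s : D.S} {w : Xt × Y} (hw : w ∈ (D.loc (D.rep s)).target)
    (hw1 : w.1 ∈ (extChartAt 𝓘(ℝ, EX) (D.rep s).1).source)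
    (hw2 : w.2 ∈ (extChartAt 𝓘(ℝ, EY) (D.rep s).2).source) :
    (tderiv IS 𝓘(ℝ, EX × EY) (extChartAt IS s) (D.σ w)).comp (D.dσ w) =
      (tderiv 𝓘(ℝ, EX) 𝓘(ℝ, EX) (extChartAt 𝓘(ℝ, EX) (D.rep s).1) w.1).prodMap
        (tderiv 𝓘(ℝ, EY) 𝓘(ℝ, EY) (extChartAt 𝓘(ℝ, EY) (D.rep s).2) w.2) := by
  have hs : D.σ w ∈ (extChartAt IS s).source := by
    rw [D.mem_extChartAt_S_source, D.loc_σ hw]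
    exact ⟨D.σ_mem_source hw, hw1, hw2⟩
  unfold dσ
  rw [← tderiv_comp (mdifferentiableAt_extChartAt' hs) (D.mdifferentiableAt_σ w)]
  have h1 : MDifferentiableAt IS 𝓘(ℝ, EX)
      (fun z : Xt × Y => extChartAt 𝓘(ℝ, EX) (D.rep s).1 z.1) w :=
    (mdifferentiableAt_extChartAt' hw1).comp w mdifferentiableAt_fst
  have h2 : MDifferentiableAt IS 𝓘(ℝ, EY)
      (fun z : Xt × Y => extChartAt 𝓘(ℝ, EY) (D.rep s).2 z.2) w :=
    (mdifferentiableAt_extChartAt' hw2).comp w mdifferentiableAt_snd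
  have h3 := tderiv_prodMk_space h1 h2
  rw [tderiv_comp (f := Prod.fst) (mdifferentiableAt_extChartAt' hw1) mdifferentiableAt_fst,
    tderiv_comp (f := Prod.snd) (mdifferentiableAt_extChartAt' hw2) mdifferentiableAt_snd,
    tderiv_fst, tderiv_snd] at h3
  refine Eq.trans (tderiv_congr ?_) h3
  filter_upwards [(D.loc (D.rep s)).open_target.mem_nhds hw] with z hz
  rw [D.extChartAt_S, D.loc_σ hz]

theorem tderiv_extChartAt_S_symm {s : D.S} {w : Xt × Y} (hw : w ∈ (D.loc (D.rep s)).target)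
    (hw1 : w.1 ∈ (extChartAt 𝓘(ℝ, EX) (D.rep s).1).source)
    (hw2 : w.2 ∈ (extChartAt 𝓘(ℝ, EY) (D.rep s).2).source) :
    tderiv 𝓘(ℝ, EX × EY) IS (extChartAt IS s).symm (extChartAt IS s (D.σ w)) =
      (D.dσ w).comp ((tderiv 𝓘(ℝ, EX) 𝓘(ℝ, EX) (extChartAt 𝓘(ℝ, EX) (D.rep s).1).symm
        (extChartAt 𝓘(ℝ, EX) (D.rep s).1 w.1)).prodMap
        (tderiv 𝓘(ℝ, EY) 𝓘(ℝ, EY) (extChartAt 𝓘(ℝ, EY) (D.rep s).2).symm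
          (extChartAt 𝓘(ℝ, EY) (D.rep s).2 w.2))) := by
  have hs : D.σ w ∈ (extChartAt IS s).source := by
    rw [D.mem_extChartAt_S_source, D.loc_σ hw]
    exact ⟨D.σ_mem_source hw, hw1, hw2⟩
  have h1 := tderiv_extChartAt_symm_comp (I := IS) hs
  have h2 := D.tderiv_extChartAt_S hw hw1 hw2
  have hX := tderiv_extChartAt_comp_symm (I := 𝓘(ℝ, EX))
    ((extChartAt 𝓘(ℝ, EX) (D.rep s).1).map_source hw1)
  have hY := tderiv_extChartAt_comp_symm (I := 𝓘(ℝ, EY))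
    ((extChartAt 𝓘(ℝ, EY) (D.rep s).2).map_source hw2)
  rw [(extChartAt 𝓘(ℝ, EX) (D.rep s).1).left_inv hw1] at hX
  rw [(extChartAt 𝓘(ℝ, EY) (D.rep s).2).left_inv hw2] at hY
  refine ContinuousLinearMap.ext fun v => ?_
  set a := tderiv 𝓘(ℝ, EX × EY) IS (extChartAt IS s).symm (extChartAt IS s (D.σ w))
  set b := tderiv IS 𝓘(ℝ, EX × EY) (extChartAt IS s) (D.σ w)
  set u := ((tderiv 𝓘(ℝ, EX) 𝓘(ℝ, EX) (extChartAt 𝓘(ℝ, EX) (D.rep s).1).symm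
        (extChartAt 𝓘(ℝ, EX) (D.rep s).1 w.1)).prodMap
        (tderiv 𝓘(ℝ, EY) 𝓘(ℝ, EY) (extChartAt 𝓘(ℝ, EY) (D.rep s).2).symm
          (extChartAt 𝓘(ℝ, EY) (D.rep s).2 w.2))) v with hu
  have e1 : b (D.dσ w u) = v := by
    have := congrArg (fun L : EX × EY →L[ℝ] EX × EY => L u) h2
    refine this.trans ?_
    refine Prod.ext ?_ ?_
    · exact congrArg (fun L : EX →L[ℝ] EX => L v.1) hX
    · exact congrArg (fun L : EY →L[ℝ] EY => L v.2) hY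
  have e2 : a (b (D.dσ w u)) = D.dσ w u :=
    congrArg (fun L : EX × EY →L[ℝ] EX × EY => L (D.dσ w u)) h1
  rw [e1] at e2
  exact e2

/-- Block-diagonal charts together with the Pythagorean formula for dual norms bring the Hamiltonian
into the form treated for products. -/
theorem covectorNorm_cotangentChartSymm_S {s : D.S} {w : (EX × EY) × (EX × EY →L[ℝ] ℝ)}
    (hw : w.1 ∈ (extChartAt IS s).target) :
    covectorNorm IS D.metric (cotangentChartSymm IS s w.1 w.2) =
      √(D.normSqX (D.rep s).1 (phaseFst w) + D.normSqY (D.rep s).2 (phaseSnd w)) := by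
  have ht := D.mem_extChartAt_S_target hw
  have hl := D.symm_mem_loc_target hw
  have h2 := D.tderiv_extChartAt_S hl ((extChartAt 𝓘(ℝ, EX) (D.rep s).1).map_target ht.1)
    ((extChartAt 𝓘(ℝ, EY) (D.rep s).2).map_target ht.2)
  rw [D.covectorNorm_S (D.extChartAt_S_symm s w.1), cotangentChartSymm_eq, covectorMk_fn,
    ContinuousLinearMap.comp_assoc w.2, D.extChartAt_S_symm, h2]
  congr 2
  · unfold normSqX
    congr 2
    ext v
    simp [phaseFst, cotangentChartSymm_eq]
  · unfold normSqY
    congr 2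
    ext v
    simp [phaseSnd, cotangentChartSymm_eq]

theorem phase_cotangentChart_S {s : D.S} {ζ : Cotangent IS D.S} {w : Xt × Y} (hζ : ζ.1 = D.σ w)
    (hw : w ∈ (D.loc (D.rep s)).target)
    (hw1 : w.1 ∈ (extChartAt 𝓘(ℝ, EX) (D.rep s).1).source)
    (hw2 : w.2 ∈ (extChartAt 𝓘(ℝ, EY) (D.rep s).2).source) :
    phaseFst (cotangentChart IS s ζ) = cotangentChart 𝓘(ℝ, EX) (D.rep s).1 (D.partX ζ w) ∧
    phaseSnd (cotangentChart IS s ζ) = cotangentChart 𝓘(ℝ, EY) (D.rep s).2 (D.partY ζ w) := by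
  rw [cotangentChart_eq, hζ, D.tderiv_extChartAt_S_symm hw hw1 hw2, D.extChartAt_S, D.loc_σ hw,
    cotangentChart_eq, cotangentChart_eq]
  constructor
  · refine Prod.ext rfl ?_
    ext v
    simp [phaseFst, partX]
  · refine Prod.ext rfl ?_
    ext v
    simp [phaseSnd, partY]

/-! ### The length of the component along `Xt` -/

theorem partX_act (ζ : Cotangent IS D.S) (d : deckGroup D.p) (w : Xt × Y) (v : EX) :
    (D.partX ζ (D.act d w)).fn (D.dDeck d w.1 v) = (D.partX ζ w).fn v := by
  rw [partX_fn, partX_fn, ← D.dσ_act d w]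
  simp

/-- Changing the sheet by `d` changes the `Y`-component by `φ d`. This is how the action of `G` on
covectors becomes visible on the suspension. -/
theorem partY_act (ζ : Cotangent IS D.S) (d : deckGroup D.p) (w : Xt × Y) :
    D.partY ζ (D.act d w) = liftedAction (D.φ d) (D.partY ζ w) := by
  refine Cotangent.ext' rfl ?_
  ext v
  have e : v = dL (D.φ d) w.2 (dL (D.φ d)⁻¹ (D.φ d • w.2) v) := (D.dL_dL_inv _ _ _).symm
  have h2 : (liftedAction (D.φ d) (D.partY ζ w)).fn v =
      (D.partY ζ w).fn (dL (D.φ d)⁻¹ (D.φ d • w.2) v) := rfl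
  rw [h2, partY_fn, partY_fn, ← D.dσ_act d w]
  simp only [map_zero]
  rw [← e]

/-- The length of the component of a covector along `Xt`. -/
def normX (ζ : Cotangent IS D.S) : ℝ :=
  dualNorm (fun v => D.formX (D.rep ζ.1).1 v v) (D.partX ζ (D.rep ζ.1)).fn

/-- Deck transformations are isometries of the induced metric, so the length along `Xt` does not
depend on the lift used to compute it. -/
theorem normX_eq {ζ : Cotangent IS D.S} {w : Xt × Y} (h : ζ.1 = D.σ w) :
    D.normX ζ = dualNorm (fun v => D.formX w.1 v v) (D.partX ζ w).fn := by
  obtain ⟨d, hd⟩ := D.exists_act_eq_rep w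
  unfold normX
  rw [h, ← hd]
  symm
  exact dualNorm_congr (D.dDeck d w.1) (fun v => ⟨_, D.dDeck_dDeck_inv d w.1 v⟩)
    (fun v => D.formX_deck d w.1 v v) (fun v => D.partX_act ζ d w v)

theorem normX_eq_zero_iff {ζ : Cotangent IS D.S} {w : Xt × Y} (h : ζ.1 = D.σ w) :
    D.normX ζ = 0 ↔ (D.partX ζ w).fn = 0 := by
  rw [D.normX_eq h]
  exact (D.isInnerForm_formX _).dualNorm_eq_zero_iff

variable {D} in
/-- A local lift of a curve in the suspension. -/
theorem eventually_lift {c : ℝ → Cotangent IS D.S} (hc : Continuous fun t => (c t).1) (t : ℝ) :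
    ∀ᶠ τ in 𝓝 t, (c τ).1 = D.σ (D.loc (D.rep (c t).1) (c τ).1) ∧
      D.loc (D.rep (c t).1) (c τ).1 ∈ (D.loc (D.rep (c t).1)).target ∧
      (D.loc (D.rep (c t).1) (c τ).1).1 ∈ (extChartAt 𝓘(ℝ, EX) (D.rep (c t).1).1).source ∧
      (D.loc (D.rep (c t).1) (c τ).1).2 ∈ (extChartAt 𝓘(ℝ, EY) (D.rep (c t).1).2).source := by
  filter_upwards [hc.continuousAt.eventually (extChartAt_source_mem_nhds (I := IS) (c t).1)]
    with τ hτ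
  replace hτ := D.mem_extChartAt_S_source.1 hτ
  exact ⟨(D.σ_loc hτ.1).symm, (D.loc _).map_source hτ.1, hτ.2.1, hτ.2.2⟩

theorem eventually_covectorNorm_S (ζ : Cotangent IS D.S) :
    (fun w : (EX × EY) × (EX × EY →L[ℝ] ℝ) =>
      covectorNorm IS D.metric (cotangentChartSymm IS ζ.1 w.1 w.2)) =ᶠ[𝓝 (cotangentChart IS ζ.1 ζ)]
    fun w => √(D.normSqX (D.rep ζ.1).1 (phaseFst w) + D.normSqY (D.rep ζ.1).2 (phaseSnd w)) := by
  have h : ∀ᶠ w : (EX × EY) × (EX × EY →L[ℝ] ℝ) in 𝓝 (cotangentChart IS ζ.1 ζ),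
      w.1 ∈ (extChartAt IS ζ.1).target :=
    (continuous_fst.tendsto (cotangentChart IS ζ.1 ζ)).eventually
      (extChartAt_target_mem_nhds (I := IS) ζ.1)
  filter_upwards [h] with w hw using D.covectorNorm_cotangentChartSymm_S hw

theorem normSqX_partX {s : D.S} {ζ : Cotangent IS D.S} {w : Xt × Y} (hζ : ζ.1 = D.σ w)
    (hw1 : w.1 ∈ (extChartAt 𝓘(ℝ, EX) (D.rep s).1).source) :
    D.normSqX (D.rep s).1 (cotangentChart 𝓘(ℝ, EX) (D.rep s).1 (D.partX ζ w)) = D.normX ζ ^ 2 := by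
  rw [D.normX_eq hζ]
  unfold normSqX
  rw [cotangentChartSymm_cotangentChart hw1]
  congr 3
  ext v
  congr 3
  exact (extChartAt 𝓘(ℝ, EX) (D.rep s).1).left_inv hw1

/-- The coordinates at a point of the curve itself. -/
theorem mem_target_phase {ζ : Cotangent IS D.S} :
    (phaseFst (cotangentChart IS ζ.1 ζ)).1 ∈ (extChartAt 𝓘(ℝ, EX) (D.rep ζ.1).1).target ∧
    (phaseSnd (cotangentChart IS ζ.1 ζ)).1 ∈ (extChartAt 𝓘(ℝ, EY) (D.rep ζ.1).2).target :=
  D.mem_extChartAt_S_target (mem_extChartAt_target (I := IS) ζ.1)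

/-- In the chart at time `t` this is the first integral `N` of `√(N + N')`; as `normX` is
independent of the lift, the local statements concern one global function. -/
theorem hasDerivAt_normX_sq {c : ℝ → Cotangent IS D.S}
    (hc : IsHamiltonianCurve IS (covectorNorm IS D.metric) c) (t : ℝ) :
    HasDerivAt (fun τ => D.normX (c τ) ^ 2) 0 t := by
  rw [isHamiltonianCurve_iff] at hc
  obtain ⟨hcont, hne, hham⟩ := hc
  have hl := eventually_lift hcont t
  have hh := (hham t).congr (D.eventually_covectorNorm_S (c t)) Filter.EventuallyEq.rfl
  have h0 := hl.self_of_nhds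
  obtain ⟨p1, p2⟩ := D.phase_cotangentChart_S h0.1 h0.2.1 h0.2.2.1 h0.2.2.2
  have hd := hh.hasDerivAt_fst (D.differentiableAt_normSqX _ D.mem_target_phase.1)
    (D.differentiableAt_normSqY _ D.mem_target_phase.2) (by
      -- The radicand cannot vanish: both components would be zero, while the curve avoids the zero
      -- section.
      intro hz
      rw [p1, p2] at hz
      have hz1 : D.normSqX _ _ = 0 := ((add_eq_zero_iff_of_nonneg (sq_nonneg _) (sq_nonneg _)).1 hz).1
      have hz2 : D.normSqY _ _ = 0 := ((add_eq_zero_iff_of_nonneg (sq_nonneg _) (sq_nonneg _)).1 hz).2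
      rw [D.normSqX_partX h0.1 h0.2.2.1] at hz1
      have hx := (D.normX_eq_zero_iff h0.1).1 (pow_eq_zero_iff (two_ne_zero)|>.1 hz1)
      by_cases hy : (D.partY (c t) (D.loc (D.rep (c t).1) (c t).1)).fn = 0
      · exact hne t (D.fn_eq_zero hx hy)
      · exact D.normSqY_ne_zero h0.2.2.2 hy hz2)
  refine hd.congr_of_eventuallyEq ?_
  filter_upwards [hl] with τ hτ
  rw [(D.phase_cotangentChart_S hτ.1 hτ.2.1 hτ.2.2.1 hτ.2.2.2).1, D.normSqX_partX hτ.1 hτ.2.2.1]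

theorem normX_eq_zero_of_isHamiltonianCurve {c : ℝ → Cotangent IS D.S}
    (hc : IsHamiltonianCurve IS (covectorNorm IS D.metric) c) {t₀ : ℝ} (h : D.normX (c t₀) = 0)
    (t : ℝ) : D.normX (c t) = 0 := by
  have h1 := is_const_of_deriv_eq_zero (f := fun τ => D.normX (c τ) ^ 2)
    (fun t => (D.hasDerivAt_normX_sq hc t).differentiableAt)
    (fun t => (D.hasDerivAt_normX_sq hc t).deriv) t t₀
  simp only [h] at h1
  exact pow_eq_zero_iff two_ne_zero |>.1 (h1.trans (by norm_num))

/-- Hamilton's equations for a curve of covectors that vanish along `Xt`. -/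
theorem hamAt_S_iff {c : ℝ → Cotangent IS D.S} (hcont : Continuous fun t => (c t).1)
    (hne : ∀ t, (c t).fn ≠ 0) (h0 : ∀ t, D.normX (c t) = 0)
    (t : ℝ) :
    HamAt (fun w => covectorNorm IS D.metric (cotangentChartSymm IS (c t).1 w.1 w.2))
        (fun τ => cotangentChart IS (c t).1 (c τ)) t ↔
      HasDerivAt (fun τ => extChartAt 𝓘(ℝ, EX) (D.rep (c t).1).1
        (D.loc (D.rep (c t).1) (c τ).1).1) 0 t ∧
      HamAt (fun w => √(D.normSqY (D.rep (c t).1).2 w))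
        (fun τ => cotangentChart 𝓘(ℝ, EY) (D.rep (c t).1).2
          (D.partY (c τ) (D.loc (D.rep (c t).1) (c τ).1))) t := by
  have hl := eventually_lift hcont t
  have hl0 := hl.self_of_nhds
  obtain ⟨p1, p2⟩ := D.phase_cotangentChart_S hl0.1 hl0.2.1 hl0.2.2.1 hl0.2.2.2
  have e1 := D.eventually_covectorNorm_S (c t)
  have hx := (D.normX_eq_zero_iff hl0.1).1 (h0 t)
  have hy : (D.partY (c t) (D.loc (D.rep (c t).1) (c t).1)).fn ≠ 0 := fun hy =>
    hne t (D.fn_eq_zero hx hy)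
  have key := hamAt_sqrt_add_iff (N := D.normSqX (D.rep (c t).1).1)
    (N' := D.normSqY (D.rep (c t).1).2) (z := fun τ => cotangentChart IS (c t).1 (c τ)) (t := t)
    (D.differentiableAt_normSqX _ D.mem_target_phase.1)
    (D.differentiableAt_normSqY _ D.mem_target_phase.2)
    (.of_forall fun w => sq_nonneg _)
    (by rw [p1, D.normSqX_partX hl0.1 hl0.2.2.1, h0 t]; norm_num)
    (by rw [p2]; exact D.normSqY_ne_zero hl0.2.2.2 hy)
    (by
      filter_upwards [hl] with τ hτ
      have := (D.phase_cotangentChart_S hτ.1 hτ.2.1 hτ.2.2.1 hτ.2.2.2).1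
      have h2 := congrArg Prod.snd this
      refine h2.trans ?_
      rw [cotangentChart_eq, (D.normX_eq_zero_iff hτ.1).1 (h0 τ)]
      exact ContinuousLinearMap.zero_comp _)
  have e2 : (fun τ => phaseSnd (cotangentChart IS (c t).1 (c τ))) =ᶠ[𝓝 t]
      fun τ => cotangentChart 𝓘(ℝ, EY) (D.rep (c t).1).2
          (D.partY (c τ) (D.loc (D.rep (c t).1) (c τ).1)) := by
    filter_upwards [hl] with τ hτ
    exact (D.phase_cotangentChart_S hτ.1 hτ.2.1 hτ.2.2.1 hτ.2.2.2).2
  constructor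
  · intro h
    obtain ⟨h1, h2⟩ := key.1 (h.congr e1 Filter.EventuallyEq.rfl)
    exact ⟨h1, h2.congr Filter.EventuallyEq.rfl e2⟩
  · rintro ⟨h1, h2⟩
    exact (key.2 ⟨h1, h2.congr Filter.EventuallyEq.rfl e2.symm⟩).congr e1.symm
      Filter.EventuallyEq.rfl

/-! ### Invariance of Hamiltonian curves under the lifted action -/

theorem liftedAction_fn (a : G) (ξ : Cotangent 𝓘(ℝ, EY) Y) :
    (liftedAction a ξ).fn = ξ.fn.comp (dL a⁻¹ (a • ξ.1)) := rfl

include D in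
theorem liftedAction_mul (a b : G) (ξ : Cotangent 𝓘(ℝ, EY) Y) :
    liftedAction (a * b) ξ = liftedAction a (liftedAction b ξ) := by
  refine Cotangent.ext' (mul_smul a b ξ.1) ?_
  rw [liftedAction_fn, liftedAction_fn, liftedAction_fn, ContinuousLinearMap.comp_assoc]
  congr 1
  have h := D.dL_mul b⁻¹ a⁻¹ ((a * b) • ξ.1)
  rw [← mul_inv_rev] at h
  rw [← h, ← mul_smul, inv_mul_cancel_left, mul_smul]
  rfl

theorem liftedAction_one (ξ : Cotangent 𝓘(ℝ, EY) Y) : liftedAction (1 : G) ξ = ξ := by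
  refine Cotangent.ext' (one_smul G ξ.1) ?_
  rw [liftedAction_fn, inv_one, dL_one, ContinuousLinearMap.comp_id]

include D in
theorem liftedAction_inv_liftedAction (a : G) (ξ : Cotangent 𝓘(ℝ, EY) Y) :
    liftedAction a⁻¹ (liftedAction a ξ) = ξ := by
  rw [← D.liftedAction_mul, inv_mul_cancel, liftedAction_one]

include D in
theorem liftedAction_fn_ne_zero (a : G) {ξ : Cotangent 𝓘(ℝ, EY) Y} (h : ξ.fn ≠ 0) :
    (liftedAction a ξ).fn ≠ 0 := by
  intro h0
  apply h
  rw [← D.liftedAction_inv_liftedAction a ξ, liftedAction_fn, h0, ContinuousLinearMap.zero_comp]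

/-- In charts the lifted action is the canonical transformation induced by `ψ`, the action of `a`
read between two charts, and isometry makes the Hamiltonians correspond. The charts are arbitrary,
so this covers changes of chart as well. -/
theorem hamAt_liftedAction {b : ℝ → Cotangent 𝓘(ℝ, EY) Y} {t : ℝ} (a : G) {y₀ y₁ : Y}
    (hb : ContinuousAt (fun τ => (b τ).1) t) (hne : (b t).fn ≠ 0)
    (h0 : (b t).1 ∈ (extChartAt 𝓘(ℝ, EY) y₀).source)
    (h1 : a • (b t).1 ∈ (extChartAt 𝓘(ℝ, EY) y₁).source)
    (h : HamAt (fun w => √(D.normSqY y₀ w)) (fun τ => cotangentChart 𝓘(ℝ, EY) y₀ (b τ)) t) :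
    HamAt (fun w => √(D.normSqY y₁ w))
      (fun τ => cotangentChart 𝓘(ℝ, EY) y₁ (liftedAction a (b τ))) t := by
  set e := extChartAt 𝓘(ℝ, EY) y₀ with he
  set e' := extChartAt 𝓘(ℝ, EY) y₁ with he'
  have hes : IsOpen e.source := isOpen_extChartAt_source y₀
  have hes' : IsOpen e'.source := isOpen_extChartAt_source y₁
  have het : IsOpen e.target := isOpen_extChartAt_target y₀
  have het' : IsOpen e'.target := isOpen_extChartAt_target y₁
  have hsm := D.contMDiff_smul a
  have hsm' := D.contMDiff_smul a⁻¹
  have md := D.mdifferentiableAt_smul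
  set ψ : EY → EY := fun q => e' (a • e.symm q) with hψ
  set χ : EY → EY := fun q => e (a⁻¹ • e'.symm q) with hχ
  -- the points where `ψ` is a chart transition
  have hO : ∀ q, q ∈ e.target → a • e.symm q ∈ e'.source → ContDiffAt ℝ ∞ ψ q ∧
      ContDiffAt ℝ ∞ χ (ψ q) ∧ χ (ψ q) = q ∧ e'.symm (ψ q) = a • e.symm q ∧
      fderiv ℝ ψ q = (tderiv 𝓘(ℝ, EY) 𝓘(ℝ, EY) e' (a • e.symm q)).comp
        ((dL a (e.symm q)).comp (tderiv 𝓘(ℝ, EY) 𝓘(ℝ, EY) e.symm q)) ∧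
      fderiv ℝ χ (ψ q) = (tderiv 𝓘(ℝ, EY) 𝓘(ℝ, EY) e (e.symm q)).comp
        ((dL a⁻¹ (a • e.symm q)).comp (tderiv 𝓘(ℝ, EY) 𝓘(ℝ, EY) e'.symm (ψ q))) := by
    intro q hq hq'
    have hψt : ψ q ∈ e'.target := e'.map_source hq'
    have hs : e'.symm (ψ q) = a • e.symm q := e'.left_inv hq'
    have hb1 : a⁻¹ • e'.symm (ψ q) = e.symm q := by rw [hs, inv_smul_smul]
    have hqs : e.symm q ∈ e.source := e.map_target hq
    have c1 : ContMDiffAt 𝓘(ℝ, EY) 𝓘(ℝ, EY) ∞ e.symm q :=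
      (contMDiffOn_extChartAt_symm y₀).contMDiffAt (het.mem_nhds hq)
    have c2 : ContMDiffAt 𝓘(ℝ, EY) 𝓘(ℝ, EY) ∞ e' (a • e.symm q) :=
      contMDiffAt_extChartAt' (by rwa [he', extChartAt_source] at hq')
    have c3 : ContMDiffAt 𝓘(ℝ, EY) 𝓘(ℝ, EY) ∞ e'.symm (ψ q) :=
      (contMDiffOn_extChartAt_symm y₁).contMDiffAt (het'.mem_nhds hψt)
    have c4 : ContMDiffAt 𝓘(ℝ, EY) 𝓘(ℝ, EY) ∞ e (a⁻¹ • e'.symm (ψ q)) := by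
      rw [hb1]
      exact contMDiffAt_extChartAt' (by rwa [he, extChartAt_source] at hqs)
    refine ⟨?_, ?_, ?_, hs, ?_, ?_⟩
    · exact (c2.comp q ((hsm _).comp q c1)).contDiffAt
    · exact (c4.comp (ψ q) ((hsm' _).comp (ψ q) c3)).contDiffAt
    · change e (a⁻¹ • e'.symm (ψ q)) = q
      rw [hb1]; exact e.right_inv hq
    · rw [← tderiv_eq_fderiv]
      have m1 : MDifferentiableAt 𝓘(ℝ, EY) 𝓘(ℝ, EY) e.symm q := mdifferentiableAt_extChartAt_symm hq
      have m2 : MDifferentiableAt 𝓘(ℝ, EY) 𝓘(ℝ, EY) (fun q => a • e.symm q) q := (md a _).comp q m1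
      rw [hψ, tderiv_comp (f := fun q => a • e.symm q) (mdifferentiableAt_extChartAt' hq') m2,
        tderiv_comp (g := fun y : Y => a • y) (md a _) m1]
      rfl
    · rw [← tderiv_eq_fderiv]
      have m1 : MDifferentiableAt 𝓘(ℝ, EY) 𝓘(ℝ, EY) e'.symm (ψ q) :=
        mdifferentiableAt_extChartAt_symm hψt
      have m2 : MDifferentiableAt 𝓘(ℝ, EY) 𝓘(ℝ, EY) (fun q => a⁻¹ • e'.symm q) (ψ q) :=
        (md a⁻¹ _).comp (ψ q) m1
      have m3 : MDifferentiableAt 𝓘(ℝ, EY) 𝓘(ℝ, EY) e (a⁻¹ • e'.symm (ψ q)) := by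
        rw [hb1]; exact mdifferentiableAt_extChartAt' hqs
      rw [hχ, tderiv_comp (f := fun q => a⁻¹ • e'.symm q) m3 m2,
        tderiv_comp (g := fun y : Y => a⁻¹ • y) (md a⁻¹ _) m1, hb1, hs]
      rfl
  set q₀ := e (b t).1 with hq₀
  have hq₀t : q₀ ∈ e.target := e.map_source h0
  have hq₀s : e.symm q₀ = (b t).1 := e.left_inv h0
  have hq₀' : a • e.symm q₀ ∈ e'.source := by rwa [hq₀s]
  have hev : ∀ᶠ q in 𝓝 q₀, q ∈ e.target ∧ a • e.symm q ∈ e'.source := by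
    have c1 : ContinuousAt e.symm q₀ := (continuousOn_extChartAt_symm y₀).continuousAt
      (het.mem_nhds hq₀t)
    have c2 : ContinuousAt (fun q => a • e.symm q) q₀ :=
      hsm.continuous.continuousAt.comp c1
    exact (het.eventually_mem hq₀t).and (c2.eventually (hes'.mem_nhds hq₀'))
  have hbev : ∀ᶠ τ in 𝓝 t, (b τ).1 ∈ e.source ∧ a • (b τ).1 ∈ e'.source :=
    (hb.eventually (hes.mem_nhds h0)).and
      ((hsm.continuous.continuousAt.comp hb).eventually (hes'.mem_nhds h1))
  obtain ⟨o1, o2, o3, o4, -, -⟩ := hO q₀ hq₀t hq₀'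
  have hdL1 : ∀ y v, dL a⁻¹ (a • y) (dL (EY := EY) a y v) = v := D.dL_inv_dL a
  have hdL2 : ∀ y v, dL (EY := EY) a y (dL a⁻¹ (a • y) v) = v := D.dL_dL_inv a
  have ee1 : ∀ q ∈ e.target, ∀ v, tderiv 𝓘(ℝ, EY) 𝓘(ℝ, EY) e (e.symm q)
      (tderiv 𝓘(ℝ, EY) 𝓘(ℝ, EY) e.symm q v) = v := fun q hq v =>
    congrArg (fun L : EY →L[ℝ] EY => L v) (tderiv_extChartAt_comp_symm hq)
  have ee2 : ∀ q ∈ e.target, ∀ v, tderiv 𝓘(ℝ, EY) 𝓘(ℝ, EY) e.symm q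
      (tderiv 𝓘(ℝ, EY) 𝓘(ℝ, EY) e (e.symm q) v) = v := fun q hq v => by
    have := congrArg (fun L : EY →L[ℝ] EY => L v) (tderiv_extChartAt_symm_comp (e.map_target hq))
    rw [← he, e.right_inv hq] at this
    exact this
  have ee1' : ∀ q ∈ e'.target, ∀ v, tderiv 𝓘(ℝ, EY) 𝓘(ℝ, EY) e' (e'.symm q)
      (tderiv 𝓘(ℝ, EY) 𝓘(ℝ, EY) e'.symm q v) = v := fun q hq v =>
    congrArg (fun L : EY →L[ℝ] EY => L v) (tderiv_extChartAt_comp_symm hq)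
  have ee2' : ∀ q ∈ e'.target, ∀ v, tderiv 𝓘(ℝ, EY) 𝓘(ℝ, EY) e'.symm q
      (tderiv 𝓘(ℝ, EY) 𝓘(ℝ, EY) e' (e'.symm q) v) = v := fun q hq v => by
    have := congrArg (fun L : EY →L[ℝ] EY => L v) (tderiv_extChartAt_symm_comp (e'.map_target hq))
    rw [← he', e'.right_inv hq] at this
    exact this
  -- The inverse of `dψ` is written as the derivative of the inverse transition `χ`, so that its
  -- differentiability comes from the smoothness of `χ`.
  refine h.canonical (ψ := ψ) (A := fun q => fderiv ℝ χ (ψ q)) ?_ ?_ ?_ ?_ ?_ ?_ ?_ ?_ ?_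
  · exact (D.differentiableAt_normSqY y₀ hq₀t).sqrt (D.normSqY_ne_zero h0 hne)
  · exact (D.differentiableAt_normSqY y₁ (e'.map_source h1)).sqrt
      (D.normSqY_ne_zero h1 (D.liftedAction_fn_ne_zero a hne))
  · exact o1.of_le ENat.LEInfty.out
  · have d1 : DifferentiableAt ℝ (fderiv ℝ χ) (ψ q₀) :=
      (o2.fderiv_right (m := 1) (by rw [one_add_one_eq_two]; exact ENat.LEInfty.out)).differentiableAt
        (by norm_num)
    exact DifferentiableAt.fun_comp' (𝕜 := ℝ) q₀ d1 (o1.differentiableAt (by simp))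
  · filter_upwards [hev] with q hq
    obtain ⟨-, -, -, p4, p5, p6⟩ := hO q hq.1 hq.2
    rw [p5, p6]
    refine ContinuousLinearMap.ext fun v => ?_
    simp only [ContinuousLinearMap.comp_apply, ContinuousLinearMap.id_apply]
    rw [ee2 q hq.1, hdL2, ← p4, ee1' _ (e'.map_source hq.2)]
  · filter_upwards [hev] with q hq
    obtain ⟨-, -, -, p4, p5, p6⟩ := hO q hq.1 hq.2
    rw [p5, p6]
    refine ContinuousLinearMap.ext fun v => ?_
    simp only [ContinuousLinearMap.comp_apply, ContinuousLinearMap.id_apply]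
    rw [← p4, ee2' _ (e'.map_source hq.2), p4, hdL1, ee1 q hq.1]
  · filter_upwards [hbev] with τ hτ
    change e' (a • (b τ).1) = e' (a • e.symm (e (b τ).1))
    rw [e.left_inv hτ.1]
  · filter_upwards [hbev] with τ hτ
    have hl : e.symm (e (b τ).1) = (b τ).1 := e.left_inv hτ.1
    obtain ⟨-, -, -, p4, p5, p6⟩ := hO (e (b τ).1) (e.map_source hτ.1) (by rw [hl]; exact hτ.2)
    change ((b τ).fn.comp (dL a⁻¹ (a • (b τ).1))).comp
      (tderiv 𝓘(ℝ, EY) 𝓘(ℝ, EY) e'.symm (e' (a • (b τ).1))) =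
      ((b τ).fn.comp (tderiv 𝓘(ℝ, EY) 𝓘(ℝ, EY) e.symm (e (b τ).1))).comp
        (fderiv ℝ χ (ψ (e (b τ).1)))
    rw [p6]
    refine ContinuousLinearMap.ext fun v => ?_
    simp only [ContinuousLinearMap.comp_apply]
    rw [ee2 _ (e.map_source hτ.1)]
    simp only [hψ, hl]
  · have hev2 : ∀ᶠ w : EY × (EY →L[ℝ] ℝ) in 𝓝 (q₀,
        (cotangentChart 𝓘(ℝ, EY) y₁ (liftedAction a (b t))).2),
        w.1 ∈ e.target ∧ a • e.symm w.1 ∈ e'.source :=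
      (continuous_fst.tendsto (q₀, _)).eventually hev
    filter_upwards [hev2] with w hw
    obtain ⟨-, -, -, p4, p5, p6⟩ := hO w.1 hw.1 hw.2
    congr 1
    unfold normSqY
    congr 1
    refine dualNorm_congr (dL a (e.symm w.1)) (fun v => ⟨_, hdL2 _ v⟩) (fun v => ?_) (fun v => ?_)
    · simp only
      rw [← he', p4, D.formY_smul]
    · rw [cotangentChartSymm_eq, cotangentChartSymm_eq, covectorMk_fn, covectorMk_fn]
      simp only
      rw [← he', ← he, p4, p5]
      simp only [ContinuousLinearMap.comp_apply]
      rw [ee2 _ hw.1]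

/-! ### Suspended curves -/

/-- The covector of the suspension at `σ (x, y)` that pulls back to `(0, ξ)`. -/
def susp (x : Xt) (ξ : Cotangent 𝓘(ℝ, EY) Y) : Cotangent IS D.S :=
  covectorMk IS (D.σ (x, ξ.1)) ((ξ.fn.comp (.snd ℝ EX EY)).comp (D.dσInv (x, ξ.1)))

theorem susp_fn_dσ (x : Xt) (ξ : Cotangent 𝓘(ℝ, EY) Y) (v : EX × EY) :
    (D.susp x ξ).fn (D.dσ (x, ξ.1) v) = ξ.fn v.2 := by
  unfold susp
  rw [covectorMk_fn]
  simp only [ContinuousLinearMap.comp_apply]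
  rw [D.dσInv_dσ]
  rfl

theorem partX_susp (x : Xt) (ξ : Cotangent 𝓘(ℝ, EY) Y) :
    (D.partX (D.susp x ξ) (x, ξ.1)).fn = 0 := by
  ext v
  rw [partX_fn, susp_fn_dσ]
  simp

theorem partY_susp (x : Xt) (ξ : Cotangent 𝓘(ℝ, EY) Y) : D.partY (D.susp x ξ) (x, ξ.1) = ξ := by
  refine Cotangent.ext' rfl ?_
  ext v
  rw [partY_fn, susp_fn_dσ]

/-- `dσ` is onto, so a covector is determined by its two components on any sheet. -/
theorem eq_susp {ζ : Cotangent IS D.S} {w : Xt × Y} (h : ζ.1 = D.σ w)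
    (h0 : (D.partX ζ w).fn = 0) : ζ = D.susp w.1 (D.partY ζ w) := by
  refine Cotangent.ext' h ?_
  refine ContinuousLinearMap.ext fun v => ?_
  obtain ⟨u, rfl⟩ := D.dσ_surjective w v
  rw [← partX_add_partY, h0]
  have : (D.susp w.1 (D.partY ζ w)).fn (D.dσ w u) = (D.partY ζ w).fn u.2 :=
    D.susp_fn_dσ w.1 (D.partY ζ w) u
  rw [this]
  simp

theorem normX_susp (x : Xt) (ξ : Cotangent 𝓘(ℝ, EY) Y) : D.normX (D.susp x ξ) = 0 :=
  (D.normX_eq_zero_iff (w := (x, ξ.1)) rfl).2 (D.partX_susp x ξ)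

theorem susp_fn_ne_zero {x : Xt} {ξ : Cotangent 𝓘(ℝ, EY) Y} (h : ξ.fn ≠ 0) :
    (D.susp x ξ).fn ≠ 0 := by
  intro h0
  apply h
  ext v
  rw [← D.susp_fn_dσ x ξ (0, v), h0]
  simp

theorem fn_ne_zero_of_susp {x : Xt} {ξ : Cotangent 𝓘(ℝ, EY) Y} (h : (D.susp x ξ).fn ≠ 0) :
    ξ.fn ≠ 0 := by
  intro h0
  apply h
  unfold susp
  rw [covectorMk_fn, h0, ContinuousLinearMap.zero_comp, ContinuousLinearMap.zero_comp]

/-- Hamiltonian curves of `Y` correspond to Hamiltonian curves of the suspension. -/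
theorem isHamiltonianCurve_susp_iff (x : Xt) {b : ℝ → Cotangent 𝓘(ℝ, EY) Y}
    (hb : Continuous fun t => (b t).1) :
    IsHamiltonianCurve IS (covectorNorm IS D.metric) (fun t => D.susp x (b t)) ↔
      IsHamiltonianCurve 𝓘(ℝ, EY)
        (covectorNorm 𝓘(ℝ, EY) (fun y v w => D.gY.inner y v w)) b := by
  rw [isHamiltonianCurve_iff, isHamiltonianCurve_iff]
  have hcont : Continuous fun t => (D.susp x (b t)).1 :=
    D.continuous_σ.comp (continuous_const.prodMk hb)
  by_cases hne : ∀ t, (b t).fn ≠ 0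
  swap
  · constructor
    · exact fun h => absurd (fun t => D.fn_ne_zero_of_susp (h.2.1 t)) hne
    · exact fun h => absurd h.2.1 hne
  have hne' : ∀ t, (D.susp x (b t)).fn ≠ 0 := fun t => D.susp_fn_ne_zero (hne t)
  simp only [hcont, hb, hne, hne', true_and, ne_eq, not_false_eq_true, implies_true]
  refine forall_congr' fun t => ?_
  rw [D.hamAt_S_iff hcont hne' (fun t => D.normX_susp x (b t)) t]
  set s := (D.susp x (b t)).1 with hs
  obtain ⟨d, hd⟩ := D.exists_act_eq_rep (x, (b t).1)
  have hd' : D.act d (x, (b t).1) = D.rep s := hd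
  -- The chart at time `t` sees the curve on the sheet of the representative of `s`, that is,
  -- translated by one deck transformation `d`.
  have hev : ∀ᶠ τ in 𝓝 t, D.loc (D.rep s) (D.susp x (b τ)).1 = D.act d (x, (b τ).1) := by
    have h1 := D.eventually_loc_σ (q := D.rep s) (w₀ := (x, (b t).1)) (d := d)
      (by rw [hd']; exact D.self_mem_target _)
    exact (continuous_const.prodMk hb).continuousAt.eventually h1
  have hX : HasDerivAt (fun τ => extChartAt 𝓘(ℝ, EX) (D.rep s).1
        (D.loc (D.rep s) (D.susp x (b τ)).1).1) 0 t := by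
    refine (hasDerivAt_const t (extChartAt 𝓘(ℝ, EX) (D.rep s).1 (d.1 x))).congr_of_eventuallyEq ?_
    filter_upwards [hev] with τ hτ
    rw [hτ]
    rfl
  have hY : (fun τ => cotangentChart 𝓘(ℝ, EY) (D.rep s).2
      (D.partY (D.susp x (b τ)) (D.loc (D.rep s) (D.susp x (b τ)).1))) =ᶠ[𝓝 t]
      fun τ => cotangentChart 𝓘(ℝ, EY) (D.rep s).2 (liftedAction (D.φ d) (b τ)) := by
    filter_upwards [hev] with τ hτ
    rw [hτ, D.partY_act, D.partY_susp]
  have hrep : D.φ d • (b t).1 = (D.rep s).2 := congrArg Prod.snd hd'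
  simp only [hX, true_and, ← D.sqrt_normSqY]
  constructor
  · intro h
    have h1 := h.congr Filter.EventuallyEq.rfl hY
    -- Undoing the translation by `φ d` returns to the chart of `Y` at the base point of `b t`.
    have h2 := D.hamAt_liftedAction (b := fun τ => liftedAction (D.φ d) (b τ)) (D.φ d)⁻¹
      (y₁ := (b t).1)
      ((D.contMDiff_smul (D.φ d)).continuous.comp hb).continuousAt
      (D.liftedAction_fn_ne_zero _ (hne t))
      (by change D.φ d • (b t).1 ∈ _; rw [hrep]; exact mem_extChartAt_source _)
      (by
        change (D.φ d)⁻¹ • D.φ d • (b t).1 ∈ _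
        rw [inv_smul_smul]; exact mem_extChartAt_source _) h1
    simp only [D.liftedAction_inv_liftedAction] at h2
    exact h2
  · intro h
    have h1 := D.hamAt_liftedAction (D.φ d) (y₁ := (D.rep s).2) hb.continuousAt (hne t)
      (mem_extChartAt_source _) (by rw [hrep]; exact mem_extChartAt_source _) h
    exact h1.congr Filter.EventuallyEq.rfl hY.symm

/-! ### Hamiltonian curves that vanish along `Xt` -/

/-- A deck transformation that fixes `x` is trivial. -/
theorem σ_injective_right {x : Xt} {y y' : Y} (h : D.σ (x, y) = D.σ (x, y')) : y = y' := by
  obtain ⟨d, hd⟩ := D.σ_eq_iff.1 h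
  have h1 : d = 1 := D.deck_eq_one d x (congrArg Prod.fst hd)
  rw [h1, D.act_one] at hd
  exact congrArg Prod.snd hd

/-- The lift to `Xt` of a Hamiltonian curve of covectors vanishing along `Xt` is locally
constant. -/
theorem exists_eventually_eq_σ {c : ℝ → Cotangent IS D.S}
    (hc : IsHamiltonianCurve IS (covectorNorm IS D.metric) c) (h0 : ∀ t, D.normX (c t) = 0)
    (t : ℝ) :
    ∃ (x : Xt) (y : ℝ → Y), ContinuousAt y t ∧ ∀ᶠ τ in 𝓝 t, (c τ).1 = D.σ (x, y τ) := by
  rw [isHamiltonianCurve_iff] at hc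
  obtain ⟨hcont, hne, hham⟩ := hc
  have hder : ∀ t, HasDerivAt (fun τ => extChartAt 𝓘(ℝ, EX) (D.rep (c t).1).1
        (D.loc (D.rep (c t).1) (c τ).1).1) 0 t := fun t =>
    ((D.hamAt_S_iff hcont hne h0 t).1 (hham t)).1
  set w : ℝ → Xt × Y := fun τ => D.loc (D.rep (c t).1) (c τ).1 with hw
  set e := extChartAt 𝓘(ℝ, EX) (D.rep (c t).1).1 with he
  have hsrc : ∀ τ, (c τ).1 ∈ (extChartAt IS (c t).1).source →
      (c τ).1 = D.σ (w τ) ∧ ContinuousAt w τ ∧ (w τ).1 ∈ e.source := by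
    intro τ hτ
    rw [D.mem_extChartAt_S_source] at hτ
    refine ⟨(D.σ_loc hτ.1).symm, ?_, hτ.2.1⟩
    exact ContinuousAt.comp (g := D.loc (D.rep (c t).1)) (f := fun τ => (c τ).1)
      ((D.loc (D.rep (c t).1)).continuousAt hτ.1) hcont.continuousAt
  have hopen : IsOpen {τ | (c τ).1 ∈ (extChartAt IS (c t).1).source} :=
    (isOpen_extChartAt_source (I := IS) (c t).1).preimage hcont
  obtain ⟨ε, hε, hball⟩ := Metric.isOpen_iff.1 hopen t (mem_extChartAt_source (I := IS) _)
  -- At each `τ₀` the vanishing velocity is known only in the chart belonging to `τ₀`. It is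
  -- transported to the fixed chart at `t` by the transition `e ∘ d⁻¹ ∘ e₀.symm`.
  have hderw : ∀ τ₀ ∈ Metric.ball t ε, HasDerivAt (fun τ => e (w τ).1) 0 τ₀ := by
    intro τ₀ hτ₀
    obtain ⟨k1, k2, k3⟩ := hsrc τ₀ (hball hτ₀)
    obtain ⟨d, hd⟩ := D.exists_act_eq_rep (w τ₀)
    rw [← k1] at hd
    set e₀ := extChartAt 𝓘(ℝ, EX) (D.rep (c τ₀).1).1 with he₀
    have hd1 : d.1 (w τ₀).1 = (D.rep (c τ₀).1).1 := congrArg Prod.fst hd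
    have hev : ∀ᶠ τ in 𝓝 τ₀, D.loc (D.rep (c τ₀).1) (c τ).1 = D.act d (w τ) := by
      have h1 := D.eventually_loc_σ (q := D.rep (c τ₀).1) (w₀ := w τ₀) (d := d)
        (by rw [hd]; exact D.self_mem_target _)
      filter_upwards [k2.eventually h1, Metric.isOpen_ball.mem_nhds hτ₀] with τ hτ hτ'
      rw [← hτ, ← (hsrc τ (hball hτ')).1]
    have hg : HasDerivAt (fun τ => e₀ (d.1 (w τ).1)) 0 τ₀ := by
      refine (hder τ₀).congr_of_eventuallyEq ?_
      filter_upwards [hev] with τ hτ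
      rw [hτ]
      rfl
    have hθ : DifferentiableAt ℝ (fun q => e (d⁻¹.1 (e₀.symm q))) (e₀ (d.1 (w τ₀).1)) := by
      have m0 : d.1 (w τ₀).1 ∈ e₀.source := by rw [hd1]; exact mem_extChartAt_source _
      have m1 : MDifferentiableAt 𝓘(ℝ, EX) 𝓘(ℝ, EX) e₀.symm (e₀ (d.1 (w τ₀).1)) :=
        mdifferentiableAt_extChartAt_symm (e₀.map_source m0)
      have m2 : MDifferentiableAt 𝓘(ℝ, EX) 𝓘(ℝ, EX) (fun q => d⁻¹.1 (e₀.symm q))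
          (e₀ (d.1 (w τ₀).1)) := (D.mdifferentiableAt_deck d⁻¹ _).comp _ m1
      have e1 : d⁻¹.1 (e₀.symm (e₀ (d.1 (w τ₀).1))) = (w τ₀).1 := by
        rw [e₀.left_inv m0]
        exact d.1.symm_apply_apply _
      have m3 : MDifferentiableAt 𝓘(ℝ, EX) 𝓘(ℝ, EX) e (d⁻¹.1 (e₀.symm (e₀ (d.1 (w τ₀).1)))) := by
        rw [e1]; exact mdifferentiableAt_extChartAt' k3
      exact (MDifferentiableAt.comp (f := fun q => d⁻¹.1 (e₀.symm q)) _ m3 m2).differentiableAt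
    have hcomp := hθ.hasFDerivAt.comp_hasDerivAt τ₀ hg
    rw [map_zero] at hcomp
    refine hcomp.congr_of_eventuallyEq ?_
    have hev2 : ∀ᶠ τ in 𝓝 τ₀, d.1 (w τ).1 ∈ e₀.source :=
      Filter.Tendsto.eventually (f := fun τ => d.1 (w τ).1)
        (d.1.continuous.continuousAt.comp (continuousAt_fst.comp k2))
        ((isOpen_extChartAt_source _).mem_nhds (by
          change d.1 (w τ₀).1 ∈ _; rw [hd1]; exact mem_extChartAt_source _))
    filter_upwards [hev2] with τ hτ
    change e (w τ).1 = e (d⁻¹.1 (e₀.symm (e₀ (d.1 (w τ).1))))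
    rw [e₀.left_inv hτ]
    congr 1
    exact (d.1.symm_apply_apply _).symm
  refine ⟨(w t).1, fun τ => (w τ).2,
    continuousAt_snd.comp (hsrc t (mem_extChartAt_source (I := IS) _)).2.1, ?_⟩
  filter_upwards [Metric.ball_mem_nhds t hε] with τ hτ
  obtain ⟨k1, -, k3⟩ := hsrc τ (hball hτ)
  obtain ⟨-, -, k3'⟩ := hsrc t (mem_extChartAt_source (I := IS) _)
  have heq : e (w τ).1 = e (w t).1 :=
    Metric.isOpen_ball.is_const_of_deriv_eq_zero (convex_ball t ε).isPreconnected
      (fun τ hτ => (hderw τ hτ).differentiableAt.differentiableWithinAt)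
      (fun τ hτ => (hderw τ hτ).deriv) hτ (Metric.mem_ball_self hε)
  have := e.injOn k3 k3' heq
  rw [k1, ← this]

/-- A Hamiltonian curve on the suspension that starts with a covector vanishing along `Xt` is
suspended from a Hamiltonian curve on `Y`. -/
theorem exists_eq_susp {c : ℝ → Cotangent IS D.S}
    (hc : IsHamiltonianCurve IS (covectorNorm IS D.metric) c) {x : Xt}
    {ξ : Cotangent 𝓘(ℝ, EY) Y} {t₀ : ℝ} (h : c t₀ = D.susp x ξ) :
    ∃ b : ℝ → Cotangent 𝓘(ℝ, EY) Y, b t₀ = ξ ∧ (∀ t, c t = D.susp x (b t)) ∧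
      IsHamiltonianCurve 𝓘(ℝ, EY)
        (covectorNorm 𝓘(ℝ, EY) (fun y v w => D.gY.inner y v w)) b := by
  have h0 : ∀ t, D.normX (c t) = 0 :=
    D.normX_eq_zero_of_isHamiltonianCurve hc (t₀ := t₀) (by rw [h]; exact D.normX_susp x ξ)
  have hloc := D.exists_eventually_eq_σ hc h0
  -- The points of `Xt` under which `c t` has a lift form a single deck orbit. It is locally
  -- constant in `t`, hence constant on the connected line, so the curve can be lifted over the
  -- given `x` for all times.
  have hconst : IsLocallyConstant fun t => {x' : Xt | ∃ y, D.σ (x', y) = (c t).1} := by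
    rw [IsLocallyConstant.iff_eventually_eq]
    intro t
    obtain ⟨x₁, y, -, hy⟩ := hloc t
    have key : ∀ τ, (c τ).1 = D.σ (x₁, y τ) →
        {x' : Xt | ∃ y, D.σ (x', y) = (c τ).1} = {x' | ∃ d : deckGroup D.p, d.1 x₁ = x'} := by
      intro τ hτ
      ext x'
      constructor
      · rintro ⟨y', hy'⟩
        rw [hτ] at hy'
        obtain ⟨d, hd⟩ := D.σ_eq_iff.1 hy'.symm
        exact ⟨d, congrArg Prod.fst hd⟩
      · rintro ⟨d, rfl⟩
        exact ⟨D.φ d • y τ, by rw [hτ]; exact D.σ_act d (x₁, y τ)⟩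
    filter_upwards [hy] with τ hτ
    rw [key τ hτ, key t hy.self_of_nhds]
  have hex : ∀ t, ∃ y, D.σ (x, y) = (c t).1 := by
    intro t
    have h1 : x ∈ {x' : Xt | ∃ y, D.σ (x', y) = (c t₀).1} := ⟨ξ.1, by rw [h]; rfl⟩
    rw [hconst.apply_eq_of_isPreconnected isPreconnected_univ (mem_univ t₀) (mem_univ t)] at h1
    exact h1
  choose y hy using hex
  -- The lift over `x` is unique, so near `t` it is a fixed translate of the continuous local lift.
  have hycont : Continuous y := by
    rw [continuous_iff_continuousAt]
    intro t
    obtain ⟨x₁, y₁, hy₁, hev⟩ := hloc t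
    obtain ⟨d, hd⟩ := D.σ_eq_iff.1 ((hy t).trans hev.self_of_nhds).symm
    have hd1 : d.1 x₁ = x := congrArg Prod.fst hd
    have hcont : ContinuousAt (fun τ => D.φ d • y₁ τ) t :=
      (D.contMDiff_smul (D.φ d)).continuous.continuousAt.comp hy₁
    refine hcont.congr ?_
    filter_upwards [hev] with τ hτ
    apply D.σ_injective_right (x := x)
    rw [hy τ, hτ, ← D.σ_act d (x₁, y₁ τ), ← hd1]
    rfl
  have hsusp : ∀ t, c t = D.susp x (D.partY (c t) (x, y t)) := fun t =>
    D.eq_susp (w := (x, y t)) (hy t).symm ((D.normX_eq_zero_iff (hy t).symm).1 (h0 t))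
  refine ⟨fun t => D.partY (c t) (x, y t), ?_, hsusp, ?_⟩
  · have hy0 : y t₀ = ξ.1 := by
      apply D.σ_injective_right (x := x)
      rw [hy t₀, h]
      rfl
    simp only
    rw [hy0, h, D.partY_susp]
  · rw [← D.isHamiltonianCurve_susp_iff x (b := fun t => D.partY (c t) (x, y t)) hycont]
    simp only [← hsusp]
    exact hc

/-- The length of a covector is constant along Hamiltonian curves of `Y`. -/
theorem covectorNorm_eq_of_isHamiltonianCurve {b : ℝ → Cotangent 𝓘(ℝ, EY) Y}
    (hb : IsHamiltonianCurve 𝓘(ℝ, EY)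
      (covectorNorm 𝓘(ℝ, EY) (fun y v w => D.gY.inner y v w)) b) (t t' : ℝ) :
    covectorNorm 𝓘(ℝ, EY) (fun y v w => D.gY.inner y v w) (b t) =
      covectorNorm 𝓘(ℝ, EY) (fun y v w => D.gY.inner y v w) (b t') := by
  rw [isHamiltonianCurve_iff] at hb
  obtain ⟨hcont, hne, hham⟩ := hb
  have hder : ∀ t, HasDerivAt
      (fun τ => covectorNorm 𝓘(ℝ, EY) (fun y v w => D.gY.inner y v w) (b τ)) 0 t := by
    intro t
    have h1 := hham t
    simp only [← D.sqrt_normSqY] at h1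
    have h2 := h1.energy ((D.differentiableAt_normSqY _ (mem_extChartAt_target _)).sqrt
      (D.normSqY_ne_zero (mem_extChartAt_source _) (hne t)))
    refine h2.congr_of_eventuallyEq ?_
    filter_upwards [hcont.continuousAt.eventually (extChartAt_source_mem_nhds (I := 𝓘(ℝ, EY)) (b t).1)] with τ hτ
    rw [D.sqrt_normSqY, cotangentChartSymm_cotangentChart hτ]
  exact is_const_of_deriv_eq_zero (fun t => (hder t).differentiableAt) (fun t => (hder t).deriv) t t'

variable [LieGroup 𝓘(ℝ, EG) ∞ G] [CompactSpace G] [T2Space Y]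

/-! ### Leaf closures -/

include D in
theorem continuous_smul_left (y : Y) : Continuous fun a : G => a • y :=
  D.smooth_smul.continuous.comp (continuous_id.prodMk continuous_const)

/-- Orbits are compact, hence closed in the Hausdorff space `Y`, and invariant under `φ`; so the
image of `Xt × orbit` is closed and contains the leaf. Conversely the points of the leaf over a
fixed `x'` include all `σ (x', φ d • y)`, and these approach every `σ (x', a • y)` by density. -/
theorem mem_leafClosure_iff {w w' : Xt × Y} :
    D.σ w' ∈ D.leafClosure (D.σ w) ↔ w'.2 ∈ MulAction.orbit G w.2 := by
  constructor
  · intro h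
    have horb : IsClosed (MulAction.orbit G w.2) :=
      (isCompact_range (D.continuous_smul_left w.2)).isClosed
    -- The set upstairs is saturated, so the complement downstairs is the image of an open set under
    -- the open map `σ`.
    have hcl : IsClosed {s : D.S | ∃ u, D.σ u = s ∧ u.2 ∈ MulAction.orbit G w.2} := by
      rw [← isOpen_compl_iff]
      have : {s : D.S | ∃ u, D.σ u = s ∧ u.2 ∈ MulAction.orbit G w.2}ᶜ =
          D.σ '' (Prod.snd ⁻¹' (MulAction.orbit G w.2)ᶜ) := by
        ext s
        obtain ⟨u, rfl⟩ : ∃ u, D.σ u = s := ⟨_, D.σ_rep s⟩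
        constructor
        · intro hs
          exact ⟨u, fun hu => hs ⟨u, rfl, hu⟩, rfl⟩
        · rintro ⟨u', hu', he⟩ ⟨u'', he', hu''⟩
          obtain ⟨d, hd⟩ := D.σ_eq_iff.1 (he'.trans he.symm)
          refine hu' ?_
          rw [← hd]
          exact MulAction.mapsTo_smul_orbit (D.φ d) w.2 hu''
      rw [this]
      exact D.isOpenMap_σ _ (horb.isOpen_compl.preimage continuous_snd)
    have hsub : D.leaf (D.σ w) ⊆ {s : D.S | ∃ u, D.σ u = s ∧ u.2 ∈ MulAction.orbit G w.2} := by
      rintro s ⟨x, x', y, h1, h2⟩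
      refine ⟨(x', y), h2, ?_⟩
      obtain ⟨d, hd⟩ := D.σ_eq_iff.1 h1.symm
      exact ⟨D.φ d, congrArg Prod.snd hd⟩
    obtain ⟨u, hu, hu'⟩ := closure_minimal hsub hcl h
    obtain ⟨d, hd⟩ := D.σ_eq_iff.1 hu
    rw [← hd]
    exact MulAction.mapsTo_smul_orbit (D.φ d) w.2 hu'
  · rintro ⟨a, ha⟩
    have hcont : Continuous fun a : G => D.σ (w'.1, a • w.2) :=
      D.continuous_σ.comp (continuous_const.prodMk (D.continuous_smul_left w.2))
    have h1 := image_closure_subset_closure_image hcont (mem_image_of_mem _ (D.denseRange a))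
    have h2 : (fun a : G => D.σ (w'.1, a • w.2)) '' range D.φ ⊆ D.leaf (D.σ w) := by
      rintro _ ⟨_, ⟨d, rfl⟩, rfl⟩
      refine ⟨w.1, d⁻¹.1 w'.1, w.2, rfl, ?_⟩
      rw [← D.σ_act d]
      congr 1
      exact Prod.ext (d.1.apply_symm_apply w'.1) rfl
    have h3 := closure_mono h2 h1
    have e : D.σ w' = D.σ (w'.1, a • w.2) := by rw [show a • w.2 = w'.2 from ha]
    rw [e]
    exact h3

/-! ### Conormal covectors of the suspension -/

/-- A curve in an orbit gives a curve in the leaf closure with constant first coordinate.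
Conversely, a curve in the leaf closure lifts near time `0`, its `Y`-part stays in the orbit, and a
suspended covector sees only that part. -/
theorem susp_mem_conormal_iff {x : Xt} {ξ : Cotangent 𝓘(ℝ, EY) Y} :
    D.susp x ξ ∈ conormal IS D.leafClosure ↔
      ξ ∈ conormal 𝓘(ℝ, EY) (fun y : Y => MulAction.orbit G y) := by
  constructor
  · intro h
    rw [mem_conormal_iff]
    intro c hc hcL h0
    have hxc : ContMDiff 𝓘(ℝ, ℝ) IS ∞ (fun t => (x, c t)) := contMDiff_const.prodMk hc
    have h1 := mem_conormal_iff.1 h (fun t => D.σ (x, c t)) (D.contMDiff_σ.comp hxc)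
      (fun t => D.mem_leafClosure_iff.2 (hcL t)) (by simp only [h0]; rfl)
    rw [tderiv_comp (D.mdifferentiableAt_σ _) (hxc.mdifferentiableAt (by simp)),
      tderiv_prodMk mdifferentiableAt_const (hc.mdifferentiableAt (by simp)), h0] at h1
    have h2 := D.susp_fn_dσ x ξ ((((tderiv 𝓘(ℝ, ℝ) 𝓘(ℝ, EX) (fun _ : ℝ => x) 0).prod
      (tderiv 𝓘(ℝ, ℝ) 𝓘(ℝ, EY) c 0)) : ℝ →L[ℝ] EX × EY) 1)
    exact h2.symm.trans h1
  · intro h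
    rw [mem_conormal_iff]
    intro c hc hcL h0
    set l := D.loc (x, ξ.1) with hl
    have hsrc : D.σ (x, ξ.1) ∈ l.source := D.σ_mem_source (D.self_mem_target _)
    have h0' : c 0 = D.σ (x, ξ.1) := h0
    have hopen : IsOpen (c ⁻¹' l.source) := l.open_source.preimage hc.continuous
    obtain ⟨ε, hε, hball⟩ := Metric.isOpen_iff.1 hopen 0 (by rw [mem_preimage, h0']; exact hsrc)
    have hlc : ContMDiffOn 𝓘(ℝ, ℝ) IS ∞ (fun t => l (c t)) (Metric.ball 0 ε) :=
      (D.contMDiffOn_loc _).comp hc.contMDiffOn hball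
    have h1 := conormal_apply_eq_zero h hε (c := fun t => (l (c t)).2)
      (contMDiff_snd.comp_contMDiffOn hlc)
      (fun t ht => by
        have := hcL t
        rw [← D.σ_loc (hball ht)] at this
        exact D.mem_leafClosure_iff.1 this)
      (by
        simp only [h0']
        rw [D.loc_σ (D.self_mem_target _)])
    have hlm : MDifferentiableAt 𝓘(ℝ, ℝ) IS (fun t => l (c t)) 0 :=
      (hlc.contMDiffAt (Metric.ball_mem_nhds 0 hε)).mdifferentiableAt (by simp)
    rw [tderiv_comp (f := fun t => l (c t)) mdifferentiableAt_snd hlm, tderiv_snd,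
      tderiv_comp (g := l) (by rw [h0']; exact D.mdifferentiableAt_loc hsrc)
        (hc.mdifferentiableAt (by simp)), h0'] at h1
    exact h1

/-- The leaf itself lies in its closure, and every vector along `Xt` is the velocity of a curve in
the leaf. -/
theorem partX_eq_zero_of_mem_conormal {ζ : Cotangent IS D.S} (hζ : ζ ∈ conormal IS D.leafClosure)
    {w : Xt × Y} (hw : ζ.1 = D.σ w) : (D.partX ζ w).fn = 0 := by
  ext v
  obtain ⟨c, hc, hc0, rfl⟩ := exists_contMDiff_curve w.1 v
  have hcw : ContMDiff 𝓘(ℝ, ℝ) IS ∞ (fun t => (c t, w.2)) := hc.prodMk contMDiff_const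
  have h := mem_conormal_iff.1 hζ (fun t => D.σ (c t, w.2)) (D.contMDiff_σ.comp hcw)
    (fun t => by rw [hw]; exact D.mem_leafClosure_iff.2 (MulAction.mem_orbit_self w.2))
    (by simp only [hc0, hw])
  rw [tderiv_comp (D.mdifferentiableAt_σ _) (hcw.mdifferentiableAt (by simp)),
    tderiv_prodMk (hc.mdifferentiableAt (by simp)) mdifferentiableAt_const, tderiv_const, hc0] at h
  rw [partX_fn]
  exact h

theorem exists_eq_susp_of_mem_conormal {ζ : Cotangent IS D.S}
    (hζ : ζ ∈ conormal IS D.leafClosure) {w : Xt × Y} (hw : ζ.1 = D.σ w) :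
    ζ = D.susp w.1 (D.partY ζ w) := D.eq_susp hw (D.partX_eq_zero_of_mem_conormal hζ hw)

/-! ### Construction of holonomies -/

/-- A family on `Xt × Y` that keeps the second coordinate in its orbit, started on one sheet and
projected by `σ`, is a sliding. It does not have to remain on the sheet, because only the initial
point passes through the local section. -/
theorem holonomyStep_of_lift {w : Xt × Y} {O : Set (Xt × Y)} {h : ℝ → Xt × Y → Xt × Y}
    (hO : IsOpen O) (hw : w ∈ O) (hOt : O ⊆ (D.loc w).target)
    (hsm : ContMDiffOn (𝓘(ℝ, ℝ).prod IS) IS ∞ (uncurry h) (Icc (0 : ℝ) 1 ×ˢ O))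
    (hzero : ∀ z ∈ O, h 0 z = z)
    (horb : ∀ t ∈ Icc (0 : ℝ) 1, ∀ z ∈ O, (h t z).2 ∈ MulAction.orbit G z.2)
    (hbij : ∀ t ∈ Icc (0 : ℝ) 1, ∀ z ∈ O, MDifferentiableAt IS IS (h t) z ∧
      Bijective (tderiv IS IS (h t) z))
    {ζ η : Cotangent IS D.S} (hζ : ζ.1 = D.σ w) (hη : η.1 = D.σ (h 1 w))
    (hζη : ∀ v, η.fn (D.dσ (h 1 w) (tderiv IS IS (h 1) w v)) = ζ.fn (D.dσ w v)) :
    HolonomyStep IS D.leafClosure ζ η := by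
  have hloc : ∀ z ∈ O, D.loc w (D.σ z) = z := fun z hz => D.loc_σ (hOt hz)
  have hmaps : MapsTo (D.loc w) (D.σ '' O) O := by
    rintro _ ⟨z, hz, rfl⟩
    rwa [hloc z hz]
  have hder : ∀ t ∈ Icc (0 : ℝ) 1, ∀ z ∈ O,
      tderiv IS IS (fun s => D.σ (h t (D.loc w s))) (D.σ z) =
        (D.dσ (h t z)).comp ((tderiv IS IS (h t) z).comp (tderiv IS IS (D.loc w) (D.σ z))) := by
    intro t ht z hz
    have m1 : MDifferentiableAt IS IS (D.loc w) (D.σ z) :=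
      D.mdifferentiableAt_loc (D.σ_mem_source (hOt hz))
    have m2 : MDifferentiableAt IS IS (h t) (D.loc w (D.σ z)) := by
      rw [hloc z hz]; exact (hbij t ht z hz).1
    rw [tderiv_comp (g := D.σ) (f := fun s => h t (D.loc w s)) (D.mdifferentiableAt_σ _)
      (m2.comp _ m1), tderiv_comp (g := h t) m2 m1, hloc z hz]
    rfl
  refine ⟨fun t => D.σ (h t w), D.σ '' O, fun t s => D.σ (h t (D.loc w s)), ?_, ?_, hη.symm, ?_⟩
  · refine ⟨D.isOpenMap_σ O hO, ?_, ?_, ?_, ?_, ?_, ?_⟩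
    · simp only [hzero w hw]
      exact mem_image_of_mem _ hw
    · refine D.contMDiff_σ.comp_contMDiffOn (f := fun u : ℝ × D.S => h u.1 (D.loc w u.2)) ?_
      have h1 : ContMDiffOn (𝓘(ℝ, ℝ).prod IS) (𝓘(ℝ, ℝ).prod IS) ∞
          (fun u : ℝ × D.S => (u.1, D.loc w u.2)) (Icc (0 : ℝ) 1 ×ˢ (D.σ '' O)) := by
        refine contMDiffOn_fst.prodMk ((D.contMDiffOn_loc w).comp contMDiffOn_snd ?_)
        rintro ⟨t, s⟩ ⟨-, z, hz, rfl⟩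
        exact D.σ_mem_source (hOt hz)
      exact hsm.comp h1 fun u hu => ⟨hu.1, hmaps hu.2⟩
    · rintro _ ⟨z, hz, rfl⟩
      simp only [hloc z hz, hzero z hz]
    · intro t _
      simp only [hzero w hw, hloc w hw]
    · rintro t ht _ ⟨z, hz, rfl⟩
      simp only [hloc z hz]
      exact D.mem_leafClosure_iff.2 (horb t ht z hz)
    · rintro t ht _ ⟨z, hz, rfl⟩
      change Bijective (tderiv IS IS (fun s => D.σ (h t (D.loc w s))) (D.σ z))
      rw [hder t ht z hz]
      have b1 : Bijective (tderiv IS IS (D.loc w) (D.σ z)) :=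
        ⟨LeftInverse.injective (g := D.dσ z) fun v =>
            congrArg (fun L : EX × EY →L[ℝ] EX × EY => L v) (D.dσ_comp_tderiv_loc (hOt hz)),
          RightInverse.surjective (g := D.dσ z) fun v =>
            congrArg (fun L : EX × EY →L[ℝ] EX × EY => L v) (D.tderiv_loc_comp_dσ (hOt hz))⟩
      have b2 : Bijective (D.dσ (h t z)) :=
        ⟨LeftInverse.injective (D.dσInv_dσ _), RightInverse.surjective (D.dσ_dσInv _)⟩
      exact b2.comp ((hbij t ht z hz).2.comp b1)
  · simp only [hzero w hw, hζ]
  · intro v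
    change η.fn (tderiv IS IS (fun s => D.σ (h 1 (D.loc w s))) ζ.1 v) = ζ.fn v
    rw [hζ, hder 1 (right_mem_Icc.2 zero_le_one) w hw]
    obtain ⟨u, rfl⟩ := D.dσ_surjective w v
    simp only [ContinuousLinearMap.comp_apply]
    rw [← hζη u]
    congr 3
    exact D.dσInv_dσ w u

/-- Moving a conormal covector along `Xt` inside a chart. -/
theorem eventually_holonomyStep_X (x₀ : Xt) : ∃ N ∈ 𝓝 x₀, ∀ a ∈ N, ∀ b ∈ N,
    ∀ ξ : Cotangent 𝓘(ℝ, EY) Y, HolonomyStep IS D.leafClosure (D.susp a ξ) (D.susp b ξ) := by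
  set e := extChartAt 𝓘(ℝ, EX) x₀ with he
  have het : IsOpen e.target := isOpen_extChartAt_target x₀
  obtain ⟨r, hr, hball⟩ := Metric.isOpen_iff.1 het (e x₀) (mem_extChartAt_target x₀)
  -- Radius `r / 3`: the sliding is translation by `t (e b - e a)`, of norm below `2 r / 3`, so
  -- points of the small ball stay in the ball of radius `r` inside the chart.
  have hN : IsOpen (e.source ∩ e ⁻¹' Metric.ball (e x₀) (r / 3)) :=
    isOpen_extChartAt_preimage' (I := 𝓘(ℝ, EX)) x₀ Metric.isOpen_ball
  refine ⟨e.source ∩ e ⁻¹' Metric.ball (e x₀) (r / 3), hN.mem_nhds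
    ⟨mem_extChartAt_source x₀, Metric.mem_ball_self (by positivity)⟩, ?_⟩
  rintro a ⟨has, ha⟩ b ⟨hbs, hb⟩ ξ
  have hline : ∀ t ∈ Icc (0 : ℝ) 1, ∀ q ∈ Metric.ball (e x₀) (r / 3),
      q + t • (e b - e a) ∈ e.target := by
    intro t ht q hq
    apply hball
    rw [mem_preimage, mem_ball_iff_norm] at ha hb
    rw [mem_ball_iff_norm] at hq ⊢
    have h1 : ‖t • (e b - e a)‖ ≤ ‖e b - e x₀‖ + ‖e a - e x₀‖ := by
      rw [norm_smul, Real.norm_eq_abs, abs_of_nonneg ht.1]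
      have h2 : ‖e b - e a‖ ≤ ‖e b - e x₀‖ + ‖e a - e x₀‖ := by
        have : e b - e a = (e b - e x₀) - (e a - e x₀) := by abel
        rw [this]; exact norm_sub_le _ _
      nlinarith [norm_nonneg (e b - e a), ht.2]
    have h3 : q + t • (e b - e a) - e x₀ = (q - e x₀) + t • (e b - e a) := by abel
    rw [h3]
    linarith [norm_add_le (q - e x₀) (t • (e b - e a))]
  set T : ℝ → EX → EX := fun t q => q + t • (e b - e a) with hT
  have hTd : ∀ t q, fderiv ℝ (T t) q = .id ℝ EX := fun t q =>
    ((hasFDerivAt_id q).add_const _).fderiv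
  have hk : ∀ t ∈ Icc (0 : ℝ) 1, ∀ x ∈ e.source ∩ e ⁻¹' Metric.ball (e x₀) (r / 3),
      MDifferentiableAt 𝓘(ℝ, EX) 𝓘(ℝ, EX) (fun x => e.symm (T t (e x))) x ∧
      Bijective (tderiv 𝓘(ℝ, EX) 𝓘(ℝ, EX) (fun x => e.symm (T t (e x))) x) := by
    rintro t ht x ⟨hx1, hx2⟩
    have m1 : MDifferentiableAt 𝓘(ℝ, EX) 𝓘(ℝ, EX) e x := mdifferentiableAt_extChartAt' hx1
    have m2 : MDifferentiableAt 𝓘(ℝ, EX) 𝓘(ℝ, EX) (T t) (e x) :=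
      ((hasFDerivAt_id _).add_const _).differentiableAt.mdifferentiableAt
    have m3 : MDifferentiableAt 𝓘(ℝ, EX) 𝓘(ℝ, EX) e.symm (T t (e x)) :=
      mdifferentiableAt_extChartAt_symm (hline t ht _ hx2)
    have m4 : MDifferentiableAt 𝓘(ℝ, EX) 𝓘(ℝ, EX) (fun x => T t (e x)) x := m2.comp x m1
    refine ⟨m3.comp x m4, ?_⟩
    rw [tderiv_comp (g := e.symm) (f := fun x => T t (e x)) m3 m4, tderiv_comp (g := T t) m2 m1,
      tderiv_eq_fderiv, hTd, ContinuousLinearMap.id_comp]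
    refine (tderiv_extChartAt_symm_bijective (hline t ht _ hx2)).comp ?_
    exact ⟨LeftInverse.injective (g := tderiv 𝓘(ℝ, EX) 𝓘(ℝ, EX) e.symm (e x)) fun v =>
        congrArg (fun L : EX →L[ℝ] EX => L v) (tderiv_extChartAt_symm_comp hx1),
      RightInverse.surjective (g := tderiv 𝓘(ℝ, EX) 𝓘(ℝ, EX) e.symm (e x)) fun v => by
        have := congrArg (fun L : EX →L[ℝ] EX => L v)
          (tderiv_extChartAt_comp_symm (e.map_source hx1))
        rw [← he, e.left_inv hx1] at this
        exact this⟩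
  have hb1 : e.symm (T 1 (e a)) = b := by
    simp only [hT, one_smul, add_sub_cancel]
    exact e.left_inv hbs
  have hder : ∀ t ∈ Icc (0 : ℝ) 1, ∀ z : Xt × Y,
      z.1 ∈ e.source ∩ e ⁻¹' Metric.ball (e x₀) (r / 3) →
      MDifferentiableAt IS IS (fun z : Xt × Y => (e.symm (T t (e z.1)), z.2)) z ∧
      tderiv IS IS (fun z : Xt × Y => (e.symm (T t (e z.1)), z.2)) z =
        (tderiv 𝓘(ℝ, EX) 𝓘(ℝ, EX) (fun x => e.symm (T t (e x))) z.1).prodMap (.id ℝ EY) := by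
    intro t ht z hz
    have m1 := (hk t ht z.1 hz).1
    refine ⟨MDifferentiableAt.prodMk (f := fun z : Xt × Y => e.symm (T t (e z.1)))
      (m1.comp z mdifferentiableAt_fst) mdifferentiableAt_snd, ?_⟩
    have := tderiv_prodMap (x := z) (g := fun y : Y => y) m1 (mdifferentiableAt_id (I := 𝓘(ℝ, EY)))
    rw [this, tderiv_id]
  refine D.holonomyStep_of_lift (w := (a, ξ.1))
    (O := (Prod.fst ⁻¹' (e.source ∩ e ⁻¹' Metric.ball (e x₀) (r / 3))) ∩ (D.loc (a, ξ.1)).target)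
    (h := fun t z => (e.symm (T t (e z.1)), z.2))
    ((hN.preimage continuous_fst).inter (D.loc _).open_target)
    ⟨⟨has, ha⟩, D.self_mem_target _⟩ inter_subset_right ?_ ?_ ?_ ?_ rfl ?_ ?_
  · refine ContMDiffOn.prodMk (f := fun u : ℝ × (Xt × Y) => e.symm (T u.1 (e u.2.1)))
      (g := fun u : ℝ × (Xt × Y) => u.2.2) ?_ (contMDiff_snd.comp contMDiff_snd).contMDiffOn
    have c1 : ContMDiffOn (𝓘(ℝ, ℝ).prod IS) 𝓘(ℝ, EX) ∞ (fun u : ℝ × (Xt × Y) => e u.2.1)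
        (Icc (0 : ℝ) 1 ×ˢ ((Prod.fst ⁻¹' (e.source ∩ e ⁻¹' Metric.ball (e x₀) (r / 3))) ∩
          (D.loc (a, ξ.1)).target)) := by
      refine (contMDiffOn_extChartAt (x := x₀)).comp
        (contMDiff_fst.comp contMDiff_snd).contMDiffOn ?_
      rintro u ⟨-, hu, -⟩
      have := hu.1
      rwa [he, extChartAt_source] at this
    have c2 : ContMDiffOn (𝓘(ℝ, ℝ).prod IS) 𝓘(ℝ, EX) ∞
        (fun u : ℝ × (Xt × Y) => u.1 • (e b - e a))
        (Icc (0 : ℝ) 1 ×ˢ ((Prod.fst ⁻¹' (e.source ∩ e ⁻¹' Metric.ball (e x₀) (r / 3))) ∩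
          (D.loc (a, ξ.1)).target)) :=
      contMDiffOn_fst.smul contMDiffOn_const
    refine (contMDiffOn_extChartAt_symm x₀).comp (c1.add c2) ?_
    rintro u ⟨ht, hu, -⟩
    exact hline u.1 ht _ hu.2
  · rintro z ⟨hz, -⟩
    refine Prod.ext ?_ rfl
    simp only [hT, zero_smul, add_zero]
    exact e.left_inv hz.1
  · intro t _ z _
    exact MulAction.mem_orbit_self z.2
  · rintro t ht z ⟨hz, -⟩
    obtain ⟨k1, k2⟩ := hder t ht z hz
    refine ⟨k1, ?_⟩
    rw [k2]
    exact (hk t ht z.1 hz).2.prodMap bijective_id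
  · simp only [hb1]
    rfl
  · intro v
    obtain ⟨-, k2⟩ := hder 1 (right_mem_Icc.2 zero_le_one) (a, ξ.1) ⟨has, ha⟩
    rw [k2, D.susp_fn_dσ]
    simp only [hb1]
    rw [D.susp_fn_dσ]
    rfl

/-- `Xt` is connected, and the relation is transitive and holds both ways between a point and its
neighbours. So the local slidings chain together. -/
theorem holonomyRelated_X (a b : Xt) (ξ : Cotangent 𝓘(ℝ, EY) Y) :
    HolonomyRelated IS D.leafClosure (D.susp a ξ) (D.susp b ξ) := by
  refine PreconnectedSpace.induction₂'
    (fun a b : Xt => HolonomyRelated IS D.leafClosure (D.susp a ξ) (D.susp b ξ))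
    (fun x => ?_) ⟨fun _ _ _ => Relation.TransGen.trans⟩ a b
  obtain ⟨N, hN, h⟩ := D.eventually_holonomyStep_X x
  filter_upwards [hN] with y hy
  exact ⟨.single (h x (mem_of_mem_nhds hN) y hy ξ), .single (h y hy x (mem_of_mem_nhds hN) ξ)⟩

/-- Moving a conormal covector by an element of `G` close to `1`. -/
theorem exists_nhds_holonomyStep_smul : ∃ N ∈ 𝓝 (1 : G), ∀ a ∈ N, ∀ (x : Xt)
    (ξ : Cotangent 𝓘(ℝ, EY) Y),
    HolonomyStep IS D.leafClosure (D.susp x ξ) (D.susp x (liftedAction a ξ)) := by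
  have : IsManifold 𝓘(ℝ, EG) ∞ G := (inferInstance : ContMDiffMul 𝓘(ℝ, EG) ∞ G).toIsManifold
  set e := extChartAt 𝓘(ℝ, EG) (1 : G) with he
  have het : IsOpen e.target := isOpen_extChartAt_target 1
  obtain ⟨r, hr, hball⟩ := Metric.isOpen_iff.1 het (e 1) (mem_extChartAt_target 1)
  have hN : IsOpen (e.source ∩ e ⁻¹' Metric.ball (e 1) r) :=
    isOpen_extChartAt_preimage' (I := 𝓘(ℝ, EG)) 1 Metric.isOpen_ball
  refine ⟨e.source ∩ e ⁻¹' Metric.ball (e 1) r, hN.mem_nhds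
    ⟨mem_extChartAt_source 1, Metric.mem_ball_self hr⟩, ?_⟩
  rintro a ⟨has, ha⟩ x ξ
  -- The segment from `1` to `a` in a chart of `G`. It acts on all of `Y`, so one neighbourhood of
  -- `1` serves every `x` and `ξ`.
  set β : ℝ → G := fun t => e.symm (e 1 + t • (e a - e 1)) with hβ
  have hβs : ContMDiffOn 𝓘(ℝ, ℝ) 𝓘(ℝ, EG) ∞ β (Icc 0 1) := by
    have c1 : ContDiff ℝ ∞ (fun t : ℝ => e 1 + t • (e a - e 1)) :=
      contDiff_const.add (contDiff_id.smul contDiff_const)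
    refine (contMDiffOn_extChartAt_symm (1 : G)).comp c1.contMDiff.contMDiffOn ?_
    intro t ht
    exact hball ((convex_ball (e 1) r).add_smul_sub_mem (Metric.mem_ball_self hr) ha ht)
  have hβ0 : β 0 = 1 := by
    simp only [hβ, zero_smul, add_zero]
    exact e.left_inv (mem_extChartAt_source 1)
  have hβ1 : β 1 = a := by
    simp only [hβ, one_smul, add_sub_cancel]
    exact e.left_inv has
  have hder : ∀ (t : ℝ) (z : Xt × Y),
      MDifferentiableAt IS IS (fun z : Xt × Y => (z.1, β t • z.2)) z ∧
      tderiv IS IS (fun z : Xt × Y => (z.1, β t • z.2)) z =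
        (ContinuousLinearMap.id ℝ EX).prodMap (dL (β t) z.2) := by
    intro t z
    have m1 := D.mdifferentiableAt_smul (β t) z.2
    refine ⟨MDifferentiableAt.prodMk (g := fun z : Xt × Y => β t • z.2)
      mdifferentiableAt_fst (m1.comp z mdifferentiableAt_snd), ?_⟩
    have := tderiv_prodMap (x := z) (f := fun x : Xt => x) (mdifferentiableAt_id (I := 𝓘(ℝ, EX))) m1
    rw [this, tderiv_id]
    rfl
  refine D.holonomyStep_of_lift (w := (x, ξ.1)) (O := (D.loc (x, ξ.1)).target)
    (h := fun t z => (z.1, β t • z.2)) (D.loc _).open_target (D.self_mem_target _) le_rfl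
    ?_ ?_ ?_ ?_ rfl ?_ ?_
  · refine ContMDiffOn.prodMk (f := fun u : ℝ × (Xt × Y) => u.2.1)
      (g := fun u : ℝ × (Xt × Y) => β u.1 • u.2.2)
      (contMDiff_fst.comp contMDiff_snd).contMDiffOn ?_
    have c1 : ContMDiffOn (𝓘(ℝ, ℝ).prod IS) 𝓘(ℝ, EG) ∞ (fun u : ℝ × (Xt × Y) => β u.1)
        (Icc (0 : ℝ) 1 ×ˢ (D.loc (x, ξ.1)).target) :=
      hβs.comp contMDiffOn_fst fun u hu => hu.1
    have c2 : ContMDiffOn (𝓘(ℝ, ℝ).prod IS) 𝓘(ℝ, EY) ∞ (fun u : ℝ × (Xt × Y) => u.2.2)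
        (Icc (0 : ℝ) 1 ×ˢ (D.loc (x, ξ.1)).target) :=
      (contMDiff_snd.comp contMDiff_snd).contMDiffOn
    exact D.smooth_smul.comp_contMDiffOn (c1.prodMk c2)
  · intro z _
    simp only [hβ0, one_smul]
  · intro t _ z _
    exact MulAction.mem_orbit z.2 (β t)
  · intro t _ z _
    obtain ⟨k1, k2⟩ := hder t z
    refine ⟨k1, ?_⟩
    rw [k2]
    exact bijective_id.prodMap ⟨LeftInverse.injective (D.dL_inv_dL (β t) z.2),
      RightInverse.surjective (D.dL_dL_inv (β t) z.2)⟩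
  · simp only [hβ1]
    rfl
  · intro v
    rw [(hder 1 (x, ξ.1)).2, D.susp_fn_dσ]
    simp only [hβ1]
    have h1 := D.susp_fn_dσ x (liftedAction a ξ)
      (((ContinuousLinearMap.id ℝ EX).prodMap (dL a ξ.1)) v)
    refine h1.trans ?_
    rw [liftedAction_fn]
    exact congrArg ξ.fn (D.dL_inv_dL a ξ.1 v.2)

/-- One covector of the suspension written on two sheets; this exchanges moves along `Xt` for
elements of the range of `φ`. -/
theorem susp_deck (d : deckGroup D.p) (x : Xt) (ξ : Cotangent 𝓘(ℝ, EY) Y) :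
    D.susp (d.1 x) (liftedAction (D.φ d) ξ) = D.susp x ξ := by
  refine Cotangent.ext' (D.σ_act d (x, ξ.1)) ?_
  refine ContinuousLinearMap.ext fun v => ?_
  obtain ⟨u, rfl⟩ := D.dσ_surjective (x, ξ.1) v
  rw [D.susp_fn_dσ, ← D.dσ_act d]
  have h1 := D.susp_fn_dσ (d.1 x) (liftedAction (D.φ d) ξ)
    (D.dDeck d x u.1, dL (D.φ d) ξ.1 u.2)
  refine h1.trans ?_
  rw [liftedAction_fn]
  exact congrArg ξ.fn (D.dL_inv_dL (D.φ d) ξ.1 u.2)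

/-- Every element of `G` is realised by a holonomy. -/
theorem holonomyRelated_liftedAction (a : G) (x : Xt) (ξ : Cotangent 𝓘(ℝ, EY) Y) :
    HolonomyRelated IS D.leafClosure (D.susp x ξ) (D.susp x (liftedAction a ξ)) := by
  have : IsTopologicalGroup G := topologicalGroup_of_lieGroup 𝓘(ℝ, EG) ∞
  obtain ⟨N, hN, h⟩ := D.exists_nhds_holonomyStep_smul
  have hcont : Continuous fun c : G => a * c⁻¹ := continuous_const.mul continuous_inv
  have hN' : (fun c : G => a * c⁻¹) ⁻¹' N ∈ 𝓝 a :=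
    hcont.continuousAt.preimage_mem_nhds (by simpa using hN)
  -- By density `a * (φ d)⁻¹` lies in `N` for some `d`. Sliding from `d x` to `x` realises `φ d`,
  -- and one step near the identity supplies the remaining factor.
  obtain ⟨c, hc, d, rfl⟩ := mem_closure_iff_nhds.1 (D.denseRange a) _ hN'
  have h1 := D.holonomyRelated_X (d.1 x) x (liftedAction (D.φ d) ξ)
  rw [D.susp_deck] at h1
  have h2 := h _ hc x (liftedAction (D.φ d) ξ)
  rw [← D.liftedAction_mul, inv_mul_cancel_right] at h2
  exact h1.tail h2

/-! ### Orbits -/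


include D in
theorem contMDiff_smul_left (y : Y) : ContMDiff 𝓘(ℝ, EG) 𝓘(ℝ, EY) ∞ (fun a : G => a • y) :=
  D.smooth_smul.comp (contMDiff_id.prodMk contMDiff_const)

/-- The derivative at `a` of the orbit map of `y`. -/
def dOrbit (a : G) (y : Y) : EG →L[ℝ] EY := tderiv 𝓘(ℝ, EG) 𝓘(ℝ, EY) (fun a : G => a • y) a

include D in
theorem mdifferentiableAt_smul_left (a : G) (y : Y) :
    MDifferentiableAt 𝓘(ℝ, EG) 𝓘(ℝ, EY) (fun a : G => a • y) a :=
  (D.contMDiff_smul_left y).mdifferentiableAt (by simp)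

-- Equivariance of the orbit map: moving `a` back to `1` shows that its rank at `a` is at most its
-- rank at `1`, as the constant rank argument requires.
include D in
theorem dOrbit_eq (a : G) (y : Y) : dOrbit (EG := EG) (EY := EY) a y =
    (dL a y).comp ((dOrbit (1 : G) y).comp (tderiv 𝓘(ℝ, EG) 𝓘(ℝ, EG) (fun g : G => a⁻¹ * g) a)) := by
  have m1 : MDifferentiableAt 𝓘(ℝ, EG) 𝓘(ℝ, EG) (fun g : G => a⁻¹ * g) a :=
    (contMDiff_mul_left (n := ∞)).mdifferentiableAt (by simp)
  have m2 : MDifferentiableAt 𝓘(ℝ, EG) 𝓘(ℝ, EY) (fun g : G => (a⁻¹ * g) • y) a :=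
    (D.mdifferentiableAt_smul_left (a⁻¹ * a) y).comp a m1
  have e : (fun g : G => g • y) = fun g => a • ((a⁻¹ * g) • y) := by
    funext g
    rw [smul_smul, mul_inv_cancel_left]
  have h : dOrbit (EG := EG) (EY := EY) a y = _ :=
    (congrArg (fun f => tderiv 𝓘(ℝ, EG) 𝓘(ℝ, EY) f a) e).trans
      (tderiv_comp (g := fun z : Y => a • z) (D.mdifferentiableAt_smul a _) m2)
  rw [h, tderiv_comp (g := fun g : G => g • y) (D.mdifferentiableAt_smul_left _ y) m1,
    inv_mul_cancel, one_smul]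
  rfl

include D in
/-- Conormal covectors of the orbits vanish on the image of the derivative of the orbit map. -/
theorem conormal_apply_dOrbit {η : Cotangent 𝓘(ℝ, EY) Y}
    (hη : η ∈ conormal 𝓘(ℝ, EY) (fun y : Y => MulAction.orbit G y)) (v : EG) :
    η.fn (dOrbit (1 : G) η.1 v) = 0 := by
  have : IsManifold 𝓘(ℝ, EG) ∞ G := (inferInstance : ContMDiffMul 𝓘(ℝ, EG) ∞ G).toIsManifold
  obtain ⟨c, hc, hc0, rfl⟩ := exists_contMDiff_curve (1 : G) v
  have h := mem_conormal_iff.1 hη (fun t => c t • η.1) ((D.contMDiff_smul_left η.1).comp hc)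
    (fun t => MulAction.mem_orbit η.1 (c t)) (by simp only [hc0, one_smul])
  rw [tderiv_comp (g := fun a : G => a • η.1) (D.mdifferentiableAt_smul_left _ _)
    (hc.mdifferentiableAt (by simp)), hc0] at h
  exact h

include D in
theorem fderiv_orbit_chart {y : Y} {x : EG} (hx : x ∈ (extChartAt 𝓘(ℝ, EG) (1 : G)).target)
    (hy : (extChartAt 𝓘(ℝ, EG) (1 : G)).symm x • y ∈ (extChartAt 𝓘(ℝ, EY) y).source) :
    fderiv ℝ (fun x => extChartAt 𝓘(ℝ, EY) y ((extChartAt 𝓘(ℝ, EG) (1 : G)).symm x • y)) x =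
      (tderiv 𝓘(ℝ, EY) 𝓘(ℝ, EY) (extChartAt 𝓘(ℝ, EY) y)
        ((extChartAt 𝓘(ℝ, EG) (1 : G)).symm x • y)).comp
      ((dOrbit ((extChartAt 𝓘(ℝ, EG) (1 : G)).symm x) y).comp
        (tderiv 𝓘(ℝ, EG) 𝓘(ℝ, EG) (extChartAt 𝓘(ℝ, EG) (1 : G)).symm x)) := by
  have : IsManifold 𝓘(ℝ, EG) ∞ G := (inferInstance : ContMDiffMul 𝓘(ℝ, EG) ∞ G).toIsManifold
  have m1 := mdifferentiableAt_extChartAt_symm hx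
  have m2 : MDifferentiableAt 𝓘(ℝ, EG) 𝓘(ℝ, EY)
      (fun x => (extChartAt 𝓘(ℝ, EG) (1 : G)).symm x • y) x :=
    (D.mdifferentiableAt_smul_left _ y).comp x m1
  rw [← tderiv_eq_fderiv, tderiv_comp (g := extChartAt 𝓘(ℝ, EY) y)
    (f := fun x => (extChartAt 𝓘(ℝ, EG) (1 : G)).symm x • y)
    (mdifferentiableAt_extChartAt' hy) m2, tderiv_comp (g := fun a : G => a • y)
    (D.mdifferentiableAt_smul_left _ y) m1]
  rfl

include D in
/-- Limits of difference quotients of `b t • y` with `b t` tending to `1` are tangent to the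
orbit of `y`. -/
theorem mem_range_dOrbit_of_tendsto {y : Y} {l : Filter ℝ} [l.NeBot] {b : ℝ → EG} {w : EY}
    (hb : Filter.Tendsto b l (𝓝 (extChartAt 𝓘(ℝ, EG) (1 : G) 1)))
    (hw : Filter.Tendsto (fun t => t⁻¹ •
      (extChartAt 𝓘(ℝ, EY) y ((extChartAt 𝓘(ℝ, EG) (1 : G)).symm (b t) • y) -
        extChartAt 𝓘(ℝ, EY) y y)) l (𝓝 w)) :
    ∃ v : EG, tderiv 𝓘(ℝ, EY) 𝓘(ℝ, EY) (extChartAt 𝓘(ℝ, EY) y).symm (extChartAt 𝓘(ℝ, EY) y y) w =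
      dOrbit (1 : G) y v := by
  have : IsManifold 𝓘(ℝ, EG) ∞ G := (inferInstance : ContMDiffMul 𝓘(ℝ, EG) ∞ G).toIsManifold
  set e := extChartAt 𝓘(ℝ, EY) y with he
  set g := extChartAt 𝓘(ℝ, EG) (1 : G) with hg
  set f : EG → EY := fun x => e (g.symm x • y) with hf
  have hys : y ∈ e.source := mem_extChartAt_source _
  have h1s : (1 : G) ∈ g.source := mem_extChartAt_source _
  have hg1 : g.symm (g 1) = 1 := g.left_inv h1s
  have hf1 : f (g 1) = e y := by simp only [hf, hg1, one_smul]
  have hc1 : ContMDiffAt 𝓘(ℝ, EG) 𝓘(ℝ, EY) ∞ (fun x => g.symm x • y) (g 1) :=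
    (D.contMDiff_smul_left y).contMDiffAt.comp (g 1)
      ((contMDiffOn_extChartAt_symm (1 : G)).contMDiffAt (extChartAt_target_mem_nhds (1 : G)))
  have hfs : ContDiffAt ℝ ∞ f (g 1) := by
    have h2 : ContMDiffAt 𝓘(ℝ, EY) 𝓘(ℝ, EY) ∞ e (g.symm (g 1) • y) := by
      rw [hg1, one_smul]; exact contMDiffAt_extChartAt
    exact (h2.comp (g 1) hc1).contDiffAt
  have hd1 : fderiv ℝ f (g 1) = (tderiv 𝓘(ℝ, EY) 𝓘(ℝ, EY) e y).comp
      ((dOrbit (1 : G) y).comp (tderiv 𝓘(ℝ, EG) 𝓘(ℝ, EG) g.symm (g 1))) := by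
    have := D.fderiv_orbit_chart (y := y) (g.map_source h1s) (by rw [hg1, one_smul]; exact hys)
    rwa [hg1, one_smul] at this
  have hd2 : dOrbit (1 : G) y = (tderiv 𝓘(ℝ, EY) 𝓘(ℝ, EY) e.symm (e y)).comp
      ((fderiv ℝ f (g 1)).comp (tderiv 𝓘(ℝ, EG) 𝓘(ℝ, EG) g 1)) := by
    ext1 v
    have k1 := congrArg (fun L : EG →L[ℝ] EG => L v) (tderiv_extChartAt_symm_comp h1s)
    have k2 := congrArg (fun L : EY →L[ℝ] EY => L (dOrbit (1 : G) y v))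
      (tderiv_extChartAt_symm_comp hys)
    simp only [ContinuousLinearMap.comp_apply, ContinuousLinearMap.id_apply] at k1 k2
    rw [hd1]
    simp only [ContinuousLinearMap.comp_apply]
    rw [k1, k2]
  -- Chain of rank bounds: chart expression at `x`, orbit map at `g.symm x`, orbit map at `1`, chart
  -- expression at `g 1`.
  have hrank : ∀ᶠ x in 𝓝 (g 1), Module.finrank ℝ (fderiv ℝ f x).range ≤
      Module.finrank ℝ (fderiv ℝ f (g 1)).range := by
    have h2 : ∀ᶠ x in 𝓝 (g 1), g.symm x • y ∈ e.source :=
      hc1.continuousAt.eventually (by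
        simp only [hg1, one_smul]; exact extChartAt_source_mem_nhds y)
    filter_upwards [extChartAt_target_mem_nhds (I := 𝓘(ℝ, EG)) (1 : G), h2] with x hx hx'
    have h3 := finrank_range_comp_comp_le (tderiv 𝓘(ℝ, EY) 𝓘(ℝ, EY) e (g.symm x • y))
      (dOrbit (g.symm x) y) (tderiv 𝓘(ℝ, EG) 𝓘(ℝ, EG) g.symm x)
    have h4 := finrank_range_comp_comp_le (dL (EY := EY) (g.symm x) y) (dOrbit (1 : G) y)
      (tderiv 𝓘(ℝ, EG) 𝓘(ℝ, EG) (fun c : G => (g.symm x)⁻¹ * c) (g.symm x))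
    have h5 := finrank_range_comp_comp_le (tderiv 𝓘(ℝ, EY) 𝓘(ℝ, EY) e.symm (e y))
      (fderiv ℝ f (g 1)) (tderiv 𝓘(ℝ, EG) 𝓘(ℝ, EG) g 1)
    rw [← D.fderiv_orbit_chart hx hx'] at h3
    rw [← D.dOrbit_eq] at h4
    rw [← hd2] at h5
    exact h3.trans (h4.trans h5)
  obtain ⟨v, hv⟩ := mem_range_fderiv_of_tendsto (hfs.of_le (by simp)) hrank hb
    (by rw [hf1]; exact hw)
  refine ⟨tderiv 𝓘(ℝ, EG) 𝓘(ℝ, EG) g.symm (g 1) v, ?_⟩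
  have k2 := congrArg (fun L : EY →L[ℝ] EY => L (dOrbit (1 : G) y
    (tderiv 𝓘(ℝ, EG) 𝓘(ℝ, EG) g.symm (g 1) v))) (tderiv_extChartAt_symm_comp hys)
  rw [← hv]
  change tderiv 𝓘(ℝ, EY) 𝓘(ℝ, EY) e.symm (e y) (fderiv ℝ f (g 1) v) = _
  rw [hd1]
  exact k2

include D in
/-- If the curve `k` moves along `c` inside the orbits, then its initial velocity agrees, up to
vectors tangent to the orbit, with the image of the initial velocity of `c` under an element
of `G`. -/
theorem exists_smul_of_mem_orbit {c k : ℝ → Y} (hc : MDifferentiableAt 𝓘(ℝ, ℝ) 𝓘(ℝ, EY) c 0)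
    (hk : MDifferentiableAt 𝓘(ℝ, ℝ) 𝓘(ℝ, EY) k 0)
    (hck : ∀ᶠ t in 𝓝 (0 : ℝ), k t ∈ MulAction.orbit G (c t)) {η : Cotangent 𝓘(ℝ, EY) Y}
    (hη : η ∈ conormal 𝓘(ℝ, EY) (fun y : Y => MulAction.orbit G y)) (hη0 : k 0 = η.1) :
    ∃ a : G, a • c 0 = η.1 ∧ η.fn (tderiv 𝓘(ℝ, ℝ) 𝓘(ℝ, EY) k 0 1) =
      η.fn (dL a (c 0) (tderiv 𝓘(ℝ, ℝ) 𝓘(ℝ, EY) c 0 1)) := by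
  have : IsManifold 𝓘(ℝ, EG) ∞ G := (inferInstance : ContMDiffMul 𝓘(ℝ, EG) ∞ G).toIsManifold
  have : IsTopologicalGroup G := topologicalGroup_of_lieGroup 𝓘(ℝ, EG) ∞
  -- The group elements joining `c t` to `k t` are chosen without any continuity. Along an
  -- ultrafilter the compactness of `G` makes them converge, while difference quotients keep their
  -- limits.
  obtain ⟨l, hl⟩ := Ultrafilter.exists_le (𝓝[≠] (0 : ℝ))
  have hl0 : (l : Filter ℝ) ≤ 𝓝 0 := hl.trans nhdsWithin_le_nhds
  have hex : ∀ t, ∃ a : G, k t ∈ MulAction.orbit G (c t) → a • c t = k t := by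
    intro t
    by_cases h : k t ∈ MulAction.orbit G (c t)
    · obtain ⟨a, ha⟩ := h
      exact ⟨a, fun _ => ha⟩
    · exact ⟨1, fun h' => absurd h' h⟩
  choose α hα using hex
  have hαk : ∀ᶠ t in (l : Filter ℝ), α t • c t = k t := (hck.filter_mono hl0).mono hα
  obtain ⟨a, ha⟩ : ∃ a : G, Filter.Tendsto α l (𝓝 a) := ⟨_, (l.map α).le_nhds_lim⟩
  have hc0 : Filter.Tendsto c l (𝓝 (c 0)) := hc.continuousAt.tendsto.mono_left hl0
  have hk0 : Filter.Tendsto k l (𝓝 η.1) := by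
    have := hk.continuousAt.tendsto.mono_left hl0
    rwa [hη0] at this
  have hac : a • c 0 = η.1 := by
    have h1 : Filter.Tendsto (fun t => α t • c t) l (𝓝 (a • c 0)) :=
      (D.smooth_smul.continuous.tendsto (a, c 0)).comp (ha.prodMk_nhds hc0)
    exact tendsto_nhds_unique (h1.congr' hαk) hk0
  refine ⟨a, hac, ?_⟩
  set e := extChartAt 𝓘(ℝ, EY) η.1 with he
  set g := extChartAt 𝓘(ℝ, EG) (1 : G) with hg
  have hys : η.1 ∈ e.source := mem_extChartAt_source _
  have h1s : (1 : G) ∈ g.source := mem_extChartAt_source _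
  have hg1 : g.symm (g 1) = 1 := g.left_inv h1s
  have hey : e.symm (e η.1) = η.1 := e.left_inv hys
  have hz : MDifferentiableAt 𝓘(ℝ, ℝ) 𝓘(ℝ, EY) (fun t => a • c t) 0 :=
    (D.mdifferentiableAt_smul a _).comp 0 hc
  have key : ∀ {z : ℝ → Y}, MDifferentiableAt 𝓘(ℝ, ℝ) 𝓘(ℝ, EY) z 0 → z 0 = η.1 →
      HasDerivAt (fun t => e (z t))
        (tderiv 𝓘(ℝ, EY) 𝓘(ℝ, EY) e η.1 (tderiv 𝓘(ℝ, ℝ) 𝓘(ℝ, EY) z 0 1)) 0 ∧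
      ∀ᶠ t in (l : Filter ℝ), z t ∈ e.source := by
    intro z hz hz0
    have he : MDifferentiableAt 𝓘(ℝ, EY) 𝓘(ℝ, EY) e (z 0) := by
      rw [hz0]; exact mdifferentiableAt_extChartAt' hys
    have h1 : MDifferentiableAt 𝓘(ℝ, ℝ) 𝓘(ℝ, EY) (fun t => e (z t)) 0 := he.comp 0 hz
    have h2 := h1.differentiableAt.hasFDerivAt.hasDerivAt
    rw [← tderiv_eq_fderiv, tderiv_comp he hz, hz0] at h2
    refine ⟨h2, (hz.continuousAt.eventually ?_).filter_mono hl0⟩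
    rw [hz0]
    exact extChartAt_source_mem_nhds η.1
  obtain ⟨dz, sz⟩ := key hz hac
  obtain ⟨dk, -⟩ := key hk hη0
  -- The action near `(1, η.1)` in charts. The elements `α t * a⁻¹` tend to `1` and move the smooth
  -- curve `a • c t` to `k t`.
  set P : EG × EY → EY := fun q => e (g.symm q.1 • e.symm q.2) with hP
  have hPs : ContDiffAt ℝ ∞ P (g 1, e η.1) := by
    have c1 : ContMDiffAt 𝓘(ℝ, EG × EY) 𝓘(ℝ, EG) ∞ (fun q : EG × EY => g.symm q.1) (g 1, e η.1) :=
      ((contMDiffOn_extChartAt_symm (1 : G)).contMDiffAt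
        (extChartAt_target_mem_nhds (1 : G))).comp (g 1, e η.1)
        contDiff_fst.contMDiff.contMDiffAt
    have c2 : ContMDiffAt 𝓘(ℝ, EG × EY) 𝓘(ℝ, EY) ∞ (fun q : EG × EY => e.symm q.2) (g 1, e η.1) :=
      ((contMDiffOn_extChartAt_symm η.1).contMDiffAt
        (extChartAt_target_mem_nhds η.1)).comp (g 1, e η.1)
        contDiff_snd.contMDiff.contMDiffAt
    have c3 : ContMDiffAt 𝓘(ℝ, EG × EY) 𝓘(ℝ, EY) ∞ (fun q : EG × EY => g.symm q.1 • e.symm q.2)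
        (g 1, e η.1) :=
      D.smooth_smul.contMDiffAt.comp (g 1, e η.1) (c1.prodMk c2)
    have c4 : ContMDiffAt 𝓘(ℝ, EY) 𝓘(ℝ, EY) ∞ e (g.symm (g 1) • e.symm (e η.1)) := by
      rw [hg1, one_smul, hey]; exact contMDiffAt_extChartAt
    exact (c4.comp (g 1, e η.1) c3).contDiffAt
  have hPid : ∀ᶠ q in 𝓝 (e η.1), P (g 1, q) = q := by
    filter_upwards [extChartAt_target_mem_nhds (I := 𝓘(ℝ, EY)) η.1] with q hq
    simp only [hP, hg1, one_smul]
    exact e.right_inv hq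
  have hβ : Filter.Tendsto (fun t => α t * a⁻¹) l (𝓝 1) := by
    have := ha.mul_const a⁻¹
    rwa [mul_inv_cancel] at this
  have hb : Filter.Tendsto (fun t => g (α t * a⁻¹)) l (𝓝 (g 1)) :=
    (continuousAt_extChartAt (1 : G)).tendsto.comp hβ
  have hbz : ∀ᶠ t in (l : Filter ℝ), P (g (α t * a⁻¹), e (a • c t)) = e (k t) := by
    filter_upwards [sz, hαk, hβ.eventually (extChartAt_source_mem_nhds (I := 𝓘(ℝ, EG)) (1 : G))]
      with t h1 h2 h3
    simp only [hP]
    rw [e.left_inv h1, g.left_inv h3, smul_smul, inv_mul_cancel_right, h2]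
  have hlim := tendsto_smul_sub_of_hasStrictFDerivAt (hPs.hasStrictFDerivAt (by simp)) hPid hl hb
    dz (by simp only [hac]) dk (by simp only [hη0]) hbz
  simp only [hP, hey, hg1, one_smul] at hlim
  obtain ⟨v, hv⟩ := D.mem_range_dOrbit_of_tendsto hb hlim
  have hinv : ∀ u, tderiv 𝓘(ℝ, EY) 𝓘(ℝ, EY) e.symm (e η.1) (tderiv 𝓘(ℝ, EY) 𝓘(ℝ, EY) e η.1 u) = u :=
    fun u => congrArg (fun L : EY →L[ℝ] EY => L u) (tderiv_extChartAt_symm_comp hys)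
  -- The difference of the velocities of `k` and `a • c` is tangent to the orbit, so the conormal
  -- `η` does not see it.
  have h0 := D.conormal_apply_dOrbit hη v
  rw [← hv, map_sub, hinv, hinv, map_sub, sub_eq_zero] at h0
  rw [h0, tderiv_comp (g := fun y : Y => a • y) (D.mdifferentiableAt_smul a _) hc]
  rfl

/-! ### Holonomies of the suspension are given by the action -/

/-- Reduces to composing elements of `G`; needed to compose holonomies along the pieces of a curve.
-/
theorem leafClosure_trans {s s' s'' : D.S} (h : s' ∈ D.leafClosure s)
    (h' : s'' ∈ D.leafClosure s') : s'' ∈ D.leafClosure s := by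
  rw [← D.σ_rep s, ← D.σ_rep s', D.mem_leafClosure_iff] at h
  rw [← D.σ_rep s', ← D.σ_rep s'', D.mem_leafClosure_iff] at h'
  rw [← D.σ_rep s, ← D.σ_rep s'', D.mem_leafClosure_iff]
  obtain ⟨a, ha⟩ := h
  obtain ⟨b, hb⟩ := h'
  refine ⟨b * a, ?_⟩
  change (b * a) • _ = _
  rw [mul_smul]
  exact (congrArg (b • ·) ha).trans hb

/-- A holonomy along a piecewise smooth curve is a local map which preserves the leaf closures. -/
theorem exists_map_of_holonomyRelated {ζ η : Cotangent IS D.S}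
    (h : HolonomyRelated IS D.leafClosure ζ η) :
    ∃ k : D.S → D.S, MDifferentiableAt IS IS k ζ.1 ∧ k ζ.1 = η.1 ∧
      (∀ᶠ s in 𝓝 ζ.1, k s ∈ D.leafClosure s) ∧
      ∀ v, η.fn (tderiv IS IS k ζ.1 v) = ζ.fn v := by
  have step : ∀ {ζ η : Cotangent IS D.S}, HolonomyStep IS D.leafClosure ζ η →
      ∃ k : D.S → D.S, MDifferentiableAt IS IS k ζ.1 ∧ k ζ.1 = η.1 ∧
      (∀ᶠ s in 𝓝 ζ.1, k s ∈ D.leafClosure s) ∧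
      ∀ v, η.fn (tderiv IS IS k ζ.1 v) = ζ.fn v := by
    rintro ζ η ⟨α, U, h, hs, h0, h1, hv⟩
    have hU : U ∈ 𝓝 ζ.1 := hs.isOpen.mem_nhds (by rw [← h0]; exact hs.mem)
    have h1I : (1 : ℝ) ∈ Icc (0 : ℝ) 1 := right_mem_Icc.2 zero_le_one
    have hsm : ContMDiffOn IS IS ∞ (h 1) U :=
      hs.smooth.comp (f := fun z => ((1 : ℝ), z)) (contMDiff_const.prodMk contMDiff_id).contMDiffOn
        fun z hz => ⟨h1I, hz⟩
    refine ⟨h 1, (hsm.contMDiffAt hU).mdifferentiableAt (by simp), ?_, ?_, hv⟩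
    · rw [← h0, hs.along 1 h1I, h1]
    · filter_upwards [hU] with z hz
      exact hs.mem_leaf 1 h1I z hz
  induction h with
  | single h => exact step h
  | tail _ h ih =>
    obtain ⟨k, k1, k2, k3, k4⟩ := ih
    obtain ⟨m, m1, m2, m3, m4⟩ := step h
    rw [← k2] at m1 m3
    refine ⟨fun s => m (k s), m1.comp _ k1, by simp only [k2, m2], ?_, fun v => ?_⟩
    · filter_upwards [k3, k1.continuousAt.eventually m3] with s h1 h2
      exact D.leafClosure_trans h1 h2
    · rw [tderiv_comp m1 k1, ← k4, ← m4, k2]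
      rfl

/-- On covectors of equal length every holonomy between points over the same `x` is the lifted
action of an element of `G`. -/
theorem exists_eq_liftedAction_of_holonomyRelated {x : Xt} {ξ η : Cotangent 𝓘(ℝ, EY) Y}
    (hη : η ∈ conormal 𝓘(ℝ, EY) (fun y : Y => MulAction.orbit G y))
    (hnorm : covectorNorm 𝓘(ℝ, EY) (fun y v w => D.gY.inner y v w) η =
      covectorNorm 𝓘(ℝ, EY) (fun y v w => D.gY.inner y v w) ξ)
    (h : HolonomyRelated IS D.leafClosure (D.susp x ξ) (D.susp x η)) :
    ∃ a : G, η = liftedAction a ξ := by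
  obtain ⟨k, k1, k2, k3, k4⟩ := D.exists_map_of_holonomyRelated h
  -- The group element found below depends on the test curve, so only one direction can be used. The
  -- vector metrically dual to `ξ` is the one that suffices.
  obtain ⟨v, hv⟩ := (D.isInnerForm_formY ξ.1).exists_sharp ξ.fn
  obtain ⟨c, hc, hc0, hcv⟩ := exists_contMDiff_curve ξ.1 v
  have k1' : MDifferentiableAt IS IS k (D.σ (x, c 0)) := by rw [hc0]; exact k1
  have k2' : k (D.σ (x, c 0)) = D.σ (x, η.1) := by rw [hc0]; exact k2
  have hxc : ContMDiff 𝓘(ℝ, ℝ) IS ∞ (fun t => (x, c t)) := contMDiff_const.prodMk hc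
  have mσ : MDifferentiableAt 𝓘(ℝ, ℝ) IS (fun t => D.σ (x, c t)) 0 :=
    (D.contMDiff_σ.comp hxc).mdifferentiableAt (by simp)
  have mk : MDifferentiableAt 𝓘(ℝ, ℝ) IS (fun t => k (D.σ (x, c t))) 0 := k1'.comp 0 mσ
  set l := D.loc (x, η.1) with hl
  have hsrc : D.σ (x, η.1) ∈ l.source := D.σ_mem_source (D.self_mem_target _)
  have ml : MDifferentiableAt IS IS l (k (D.σ (x, c 0))) := by
    rw [k2']; exact D.mdifferentiableAt_loc hsrc
  have mlk : MDifferentiableAt 𝓘(ℝ, ℝ) IS (fun t => l (k (D.σ (x, c t)))) 0 := ml.comp 0 mk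
  have m2 : MDifferentiableAt 𝓘(ℝ, ℝ) 𝓘(ℝ, EY) (fun t => (l (k (D.σ (x, c t)))).2) 0 :=
    mdifferentiableAt_snd.comp 0 mlk
  have horb : ∀ᶠ t in 𝓝 (0 : ℝ), (l (k (D.σ (x, c t)))).2 ∈ MulAction.orbit G (c t) := by
    have k3' : ∀ᶠ s in 𝓝 (D.σ (x, c 0)), k s ∈ D.leafClosure s := by rw [hc0]; exact k3
    have hs : ∀ᶠ t in 𝓝 (0 : ℝ), k (D.σ (x, c t)) ∈ l.source :=
      mk.continuousAt.eventually (by simp only [k2']; exact l.open_source.mem_nhds hsrc)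
    filter_upwards [mσ.continuousAt.eventually k3', hs] with t h1 h2
    rw [← D.σ_loc h2] at h1
    exact D.mem_leafClosure_iff.1 h1
  obtain ⟨a, ha, hav⟩ := D.exists_smul_of_mem_orbit (hc.mdifferentiableAt (by simp)) m2 horb hη
    (by rw [k2', D.loc_σ (D.self_mem_target _)])
  refine ⟨a, ?_⟩
  rw [hc0] at ha hav
  rw [tderiv_comp (f := fun t => l (k (D.σ (x, c t)))) mdifferentiableAt_snd mlk, tderiv_snd,
    tderiv_comp (g := l) (f := fun t => k (D.σ (x, c t))) ml mk, k2',
    tderiv_comp (g := k) (f := fun t => D.σ (x, c t)) k1' mσ,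
    tderiv_comp (D.mdifferentiableAt_σ _) (hxc.mdifferentiableAt (by simp)),
    tderiv_prodMk mdifferentiableAt_const (hc.mdifferentiableAt (by simp)), tderiv_const, hc0,
    hcv] at hav
  have e1 := k4 (D.dσ (x, ξ.1) (0, v))
  rw [D.susp_fn_dσ] at e1
  have e2 : η.fn (dL a ξ.1 v) = ξ.fn v := by
    rw [← hav, ← e1]
    simp only [ContinuousLinearMap.comp_apply, ContinuousLinearMap.prod_apply, hcv]
    rfl
  have e3 : D.formY η.1 (dL a ξ.1 v) (dL a ξ.1 v) = ξ.fn v := by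
    rw [← ha, D.formY_smul, hv]
  rw [D.covectorNorm_Y, D.covectorNorm_Y] at hnorm
  -- `η` takes the value `|v|²` on `dL a v`, and both `η` and `dL a v` have length `|v|`: equality
  -- in Cauchy–Schwarz, so `η` is dual to `dL a v`.
  have e4 : η.fn = D.formY η.1 (dL a ξ.1 v) :=
    (D.isInnerForm_formY η.1).eq_of_apply_eq (e2.trans e3.symm)
      (by rw [hnorm, (D.isInnerForm_formY ξ.1).dualNorm_sq hv, e3])
  refine Cotangent.ext' ha.symm ?_
  rw [liftedAction_fn, e4, ← ha]
  ext u
  rw [ContinuousLinearMap.comp_apply, ← hv, ← D.formY_smul a ξ.1, D.dL_dL_inv]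

/-! ### Relatively closed arcs -/

/-- Each of the conditions transfers along `susp x`. From the foliation to the action, the flow
condition must come first: conservation of length provides the equality of norms by which a holonomy
is recognised as a lifted action. -/
theorem relClosedFoliation_susp_iff {T : ℝ} {x : Xt} {ξ η : Cotangent 𝓘(ℝ, EY) Y} :
    D.RelClosedFoliation T (D.susp x ξ) (D.susp x η) ↔ D.RelClosedAction T ξ η := by
  unfold RelClosedFoliation RelClosedAction
  rw [D.susp_mem_conormal_iff, D.susp_mem_conormal_iff]
  constructor
  · rintro ⟨hξ, hη, ⟨c, hc, hc0, hcT⟩, hol⟩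
    obtain ⟨b, hb0, hcb, hb⟩ := D.exists_eq_susp hc hc0
    have hbT : b T = η := by
      rw [hcb T] at hcT
      have h1 : (b T).1 = η.1 :=
        D.σ_injective_right (congrArg (fun ζ : Cotangent IS D.S => ζ.1) hcT)
      rw [← D.partY_susp x (b T), ← D.partY_susp x η, hcT, h1]
    refine ⟨hξ, hη, ⟨b, hb, hb0, hbT⟩, ?_⟩
    refine D.exists_eq_liftedAction_of_holonomyRelated hη ?_ hol
    rw [← hb0, ← hbT]
    exact D.covectorNorm_eq_of_isHamiltonianCurve hb T 0
  · rintro ⟨hξ, hη, ⟨b, hb, hb0, hbT⟩, a, rfl⟩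
    exact ⟨hξ, hη, ⟨fun t => D.susp x (b t),
      (D.isHamiltonianCurve_susp_iff x hb.continuous_base).2 hb, by simp only [hb0],
      by simp only [hbT]⟩, D.holonomyRelated_liftedAction a x ξ⟩

/-- The arc stays over `x₁`, so its endpoint has a lift over `x₁` besides the one over `x₂`. The
deck transformation between them rewrites the endpoint as a covector suspended over `x₁`. -/
theorem relClosedFoliation_susp_susp_iff {T : ℝ} {x₁ x₂ : Xt} {ξ η : Cotangent 𝓘(ℝ, EY) Y} :
    D.RelClosedFoliation T (D.susp x₁ ξ) (D.susp x₂ η) ↔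
      ∃ d : deckGroup D.p, d.1 x₁ = x₂ ∧
        D.RelClosedAction T ξ (liftedAction (D.φ d)⁻¹ η) := by
  have hdeck : ∀ d : deckGroup D.p, d.1 x₁ = x₂ →
      D.susp x₂ η = D.susp x₁ (liftedAction (D.φ d)⁻¹ η) := by
    rintro d rfl
    have h := D.liftedAction_inv_liftedAction (D.φ d)⁻¹ η
    rw [inv_inv] at h
    rw [← D.susp_deck d x₁, h]
  constructor
  · intro h
    obtain ⟨-, -, ⟨c, hc, hc0, hcT⟩, -⟩ := id h
    obtain ⟨b, -, hcb, -⟩ := D.exists_eq_susp hc hc0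
    rw [hcb T] at hcT
    obtain ⟨d, hd⟩ := D.σ_eq_iff.1 (congrArg (fun ζ : Cotangent IS D.S => ζ.1) hcT)
    have hd1 : d.1 x₁ = x₂ := congrArg Prod.fst hd
    refine ⟨d, hd1, ?_⟩
    rwa [hdeck d hd1, D.relClosedFoliation_susp_iff] at h
  · rintro ⟨d, hd, h⟩
    rwa [hdeck d hd, D.relClosedFoliation_susp_iff]

theorem lengthSpectrumFoliation_eq : D.lengthSpectrumFoliation = D.lengthSpectrumAction := by
  ext T
  constructor
  · rintro ⟨hT, ξ, η, h⟩
    rw [D.exists_eq_susp_of_mem_conormal h.1 (D.σ_rep ξ.1).symm,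
      D.exists_eq_susp_of_mem_conormal h.2.1 (D.σ_rep η.1).symm,
      D.relClosedFoliation_susp_susp_iff] at h
    obtain ⟨d, -, h⟩ := h
    exact ⟨hT, _, _, h⟩
  · rintro ⟨hT, ξ, η, h⟩
    obtain ⟨x⟩ : Nonempty Xt := inferInstance
    exact ⟨hT, _, _, (D.relClosedFoliation_susp_iff (x := x)).2 h⟩

/-- The derivative of `p × id` is invertible and is the identity on the `Y`-factor. Evaluating the
hypothesis on its image cancels the inverse in `phi` and leaves the formula defining `susp`. -/
theorem eq_susp_of_phi_eq {x : Xt} {y : Y} {ξs : TangentSpace IS (D.σ (x, y)) →L[ℝ] ℝ}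
    {ξ : TangentSpace 𝓘(ℝ, EY) y →L[ℝ] ℝ} (h : D.phi (x, y) ξs = D.pullbackSnd (x, y) ξ) :
    (⟨D.σ (x, y), ξs⟩ : Cotangent IS D.S) = D.susp x ⟨y, ξ⟩ := by
  refine Cotangent.ext' rfl (ContinuousLinearMap.ext fun v => ?_)
  obtain ⟨u, rfl⟩ := D.dσ_surjective (x, y) v
  have hsusp : (D.susp x ⟨y, ξ⟩).fn (D.dσ (x, y) u) = ξ u.2 := D.susp_fn_dσ x ⟨y, ξ⟩ u
  rw [hsusp]
  set A : EX × EY →L[ℝ] EX × EY := tderiv IS IS (Prod.map D.p (id : Y → Y)) (x, y) with hA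
  have hAe : A = (tderiv 𝓘(ℝ, EX) 𝓘(ℝ, EX) D.p x).prodMap (.id ℝ EY) := by
    have := tderiv_prodMap (x := (x, y)) (g := fun y : Y => y) (D.mdifferentiableAt_p x)
      (mdifferentiableAt_id (I := 𝓘(ℝ, EY)))
    rw [tderiv_id] at this
    exact this
  have hbij : Bijective A := by
    rw [hAe]
    exact (D.tderiv_p_bijective x).prodMap bijective_id
  have hinv : A.inverse (A u) = u := by
    have hi : A.IsInvertible :=
      ⟨(LinearEquiv.ofBijective (A : EX × EY →ₗ[ℝ] EX × EY) hbij).toContinuousLinearEquiv, rfl⟩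
    exact congrArg (fun L : EX × EY →L[ℝ] EX × EY => L u) hi.inverse_comp_self
  have h1 : D.phi (x, y) ξs (A u) = D.pullbackSnd (x, y) ξ (A u) := by rw [h]
  have h2 : D.phi (x, y) ξs (A u) = ξs (D.dσ (x, y) (A.inverse (A u))) := rfl
  have h3 : D.pullbackSnd (x, y) ξ (A u) =
      ξ (tderiv IS 𝓘(ℝ, EY) (Prod.snd : X × Y → Y) (Prod.map D.p id (x, y)) (A u)) := rfl
  rw [h2, h3, hinv, tderiv_snd, hAe] at h1
  exact h1

end SuspensionData

end GWave

end

/-! ### The theorem in terms of `phi` and `pullbackSnd` -/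

open GWave GWave.SuspensionData in
theorem mainTheorem6 {EX EG EY X Xt G Y : Type*}
    [NormedAddCommGroup EX] [NormedSpace ℝ EX] [FiniteDimensional ℝ EX]
    [NormedAddCommGroup EG] [NormedSpace ℝ EG] [FiniteDimensional ℝ EG]
    [NormedAddCommGroup EY] [NormedSpace ℝ EY] [FiniteDimensional ℝ EY]
    [TopologicalSpace X] [ChartedSpace EX X] [IsManifold 𝓘(ℝ, EX) ∞ X]
    [T2Space X] [CompactSpace X] [ConnectedSpace X]
    [TopologicalSpace Xt] [ChartedSpace EX Xt] [IsManifold 𝓘(ℝ, EX) ∞ Xt]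
    [T2Space Xt] [SimplyConnectedSpace Xt]
    [TopologicalSpace G] [ChartedSpace EG G] [Group G] [LieGroup 𝓘(ℝ, EG) ∞ G]
    [T2Space G] [CompactSpace G]
    [TopologicalSpace Y] [ChartedSpace EY Y] [IsManifold 𝓘(ℝ, EY) ∞ Y]
    [T2Space Y] [CompactSpace Y] [MulAction G Y]
    (D : SuspensionData (EX := EX) (EG := EG) (EY := EY) X Xt G Y) :
    (∀ (T : ℝ) (x : Xt) (y₁ y₂ : Y)
      (ξs : TangentSpace (𝓘(ℝ, EX).prod 𝓘(ℝ, EY)) (D.σ (x, y₁)) →L[ℝ] ℝ)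
      (ηs : TangentSpace (𝓘(ℝ, EX).prod 𝓘(ℝ, EY)) (D.σ (x, y₂)) →L[ℝ] ℝ)
      (ξ : TangentSpace 𝓘(ℝ, EY) y₁ →L[ℝ] ℝ) (η : TangentSpace 𝓘(ℝ, EY) y₂ →L[ℝ] ℝ),
      D.phi (x, y₁) ξs = D.pullbackSnd (x, y₁) ξ →
      D.phi (x, y₂) ηs = D.pullbackSnd (x, y₂) η →
      (D.RelClosedFoliation T ⟨D.σ (x, y₁), ξs⟩ ⟨D.σ (x, y₂), ηs⟩ ↔
        D.RelClosedAction T ⟨y₁, ξ⟩ ⟨y₂, η⟩)) ∧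
    (∀ (T : ℝ) (x₁ x₂ : Xt) (y₁ y₂ : Y)
      (ξs : TangentSpace (𝓘(ℝ, EX).prod 𝓘(ℝ, EY)) (D.σ (x₁, y₁)) →L[ℝ] ℝ)
      (ηs : TangentSpace (𝓘(ℝ, EX).prod 𝓘(ℝ, EY)) (D.σ (x₂, y₂)) →L[ℝ] ℝ)
      (ξ : TangentSpace 𝓘(ℝ, EY) y₁ →L[ℝ] ℝ) (η : TangentSpace 𝓘(ℝ, EY) y₂ →L[ℝ] ℝ),
      D.phi (x₁, y₁) ξs = D.pullbackSnd (x₁, y₁) ξ →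
      D.phi (x₂, y₂) ηs = D.pullbackSnd (x₂, y₂) η →
      (D.RelClosedFoliation T ⟨D.σ (x₁, y₁), ξs⟩ ⟨D.σ (x₂, y₂), ηs⟩ ↔
        ∃ d : deckGroup D.p, d.1 x₁ = x₂ ∧
          D.RelClosedAction T ⟨y₁, ξ⟩ (liftedAction (D.φ d)⁻¹ ⟨y₂, η⟩))) ∧
    D.lengthSpectrumFoliation = D.lengthSpectrumAction := by
  refine ⟨?_, ?_, D.lengthSpectrumFoliation_eq⟩
  · intro T x y₁ y₂ ξs ηs ξ η hξ hη
    rw [D.eq_susp_of_phi_eq hξ, D.eq_susp_of_phi_eq hη]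
    exact D.relClosedFoliation_susp_iff
  · intro T x₁ x₂ y₁ y₂ ξs ηs ξ η hξ hη
    rw [D.eq_susp_of_phi_eq hξ, D.eq_susp_of_phi_eq hη]
    exact D.relClosedFoliation_susp_susp_iff
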